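/- Let $n\ge 2$, let $F_q$ be a finite field with $q$ elements and characteristic $p$, let $G=\mathrm{GL}_n(q)$, and let $B\le G$ be the group of upper triangular matrices. Let $\ell\ne p$ be a prime and let $R$ be a local principal ideal domain of characteristic $0$ with maximal ideal $\ell R$ that contains a primitive $p$-th root of unity; put $K=R/\ell R$. Let $I=RG\cdot\underline{e}$ be the Steinberg lattice, the left ideal of $RG$ generated by $\underline{e}=\sum_{\sigma\in S_n}\mathrm{sg}(\sigma)\,\sigma\widehat B$, where $\widehat B=\sum_{b\in B}b$ and $S_n$ is embedded in $G$ as the permutation matrices. Let $f:I\times I\to R$ be $1/|B|$ times the restriction to $I$ of the symmetric bilinear form on $RG$ for which $G$ is an orthonormal basis. For $c\ge 0$ put $I(c)=\{x\in I: f(x,I)\subseteq \ell^cR\}$. Let $L=I/\ell I$, a $KG$-module, and let $L(c)=(I(c)+\ell I)/\ell I$. The filtration $L=L(0)\supseteq L(1)\supseteq L(2)\supseteq\cdots$ is called the Gow filtration of $L$. Let $e=\min\{i\ge 2: \ell \text{ divides } (q^i-1)/(q-1)\}$, let $\nu_\ell$ be the $\ell$-adic valuation, and let $d=\nu_\ell\big((q^e-1)/(q-1)\big)$.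 For positive integers $a_1,\dots,a_k$ with sum $n$, let $P_{(a_1,\dots,a_k)}\le G$ be the group of block upper triangular matrices with diagonal blocks of sizes $a_1,\dots,a_k$. Let $\mathcal P^*$ be the set of those $P_{(a_1,\dots,a_k)}$ for which $a_1\le\dots\le a_k$ and every $a_j$ is equal to $1$ or of the form $e\ell^i$ with $i\ge 0$. **Theorem.** Suppose that one of the following holds: (a) $d\le \ell$ and $\lfloor n/e\rfloor\le d\ell$; (b) $d=\ell+1$ and $\lfloor n/e\rfloor\le \ell^2$; (c) $d>\ell+1$ and $\lfloor n/e\rfloor<\ell^2+\ell$. Then the Gow filtration is, after deletion of repeated terms, a composition series of the $KG$-module $L$; that is, the distinct terms $L(c)$, $c\ge 0$, are the terms of a composition series of $L$ from $0$ to $L$. Moreover, the map $P\mapsto \nu_\ell([G:P])$ is injective on $\mathcal P^*$. -/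

import Mathlib

namespace GowSteinberg

noncomputable section

section Parabolic

variable {n : ℕ} {F : Type*} [Field F]

/-- The subgroup of `GL_n(F)` of the matrices that are block upper triangular for the block
labelling `b`: the `(i, j)` entry vanishes whenever `b j < b i`. -/
def blockUpper {α : Type*} [LinearOrder α] (b : Fin n → α) :
    Subgroup (Matrix.GeneralLinearGroup (Fin n) F) where
  carrier := {g | Matrix.BlockTriangular (g : Matrix (Fin n) (Fin n) F) b}
  one_mem' := Matrix.blockTriangular_one
  mul_mem' {g h} hg hh := by
    simpa using Matrix.BlockTriangular.mul (show Matrix.BlockTriangular g.val b from hg)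
      (show Matrix.BlockTriangular h.val b from hh)
  inv_mem' {g} hg := by
    have : Invertible (g : Matrix (Fin n) (Fin n) F) := g.invertible
    simpa using Matrix.blockTriangular_inv_of_blockTriangular
      (show Matrix.BlockTriangular g.val b from hg)

variable (n F) in
/-- The group `B` of upper triangular matrices in `GL_n(F)`. -/
def borel : Subgroup (Matrix.GeneralLinearGroup (Fin n) F) := blockUpper (id : Fin n → Fin n)

/-- The standard parabolic subgroup `P_(a₁, …, a_k)` of the block upper triangular matrices with
diagonal blocks of sizes `a₁, …, a_k`, for a composition `(a₁, …, a_k)` of `n`. -/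
def parabolic (a : Composition n) : Subgroup (Matrix.GeneralLinearGroup (Fin n) F) :=
  blockUpper a.index

variable (n F) in
/-- The set `𝒫*` of the standard parabolic subgroups
`P_(1, …, 1, e, …, e, eℓ, …, eℓ, eℓ², …)`, one for each partition of `n` all of whose parts are
equal to `1` or of the form `e ℓ^i` with `i ≥ 0`. -/
def parabolicStar (ℓ e : ℕ) : Set (Subgroup (Matrix.GeneralLinearGroup (Fin n) F)) :=
  {P | ∃ a : Composition n, a.blocks.Pairwise (· ≤ ·) ∧
    (∀ k ∈ a.blocks, k = 1 ∨ ∃ i : ℕ, k = e * ℓ ^ i) ∧ P = parabolic a}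

/-- The permutation matrices, as elements of `GL_n(F)`: the `(i, j)` entry of `permGL σ` is `1` if
`i = σ j` and `0` otherwise, so that it sends the `j`-th canonical column to the `σ j`-th one. -/
def permGL : Equiv.Perm (Fin n) →* Matrix.GeneralLinearGroup (Fin n) F :=
  (Matrix.permMatrixHom (n := Fin n) (R := F)).toHomUnits

end Parabolic

section Form

variable {R G : Type*} [CommRing R]

/-- The symmetric bilinear form on the group algebra `RG` for which `G` is orthonormal. -/
def groupForm (x y : MonoidAlgebra R G) : R :=
  x.coeff.sum fun g r ↦ r * y.coeff g

lemma groupForm_zero_left (y : MonoidAlgebra R G) : groupForm 0 y = 0 := by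
  simp [groupForm]

lemma groupForm_add_left (x x' y : MonoidAlgebra R G) :
    groupForm (x + x') y = groupForm x y + groupForm x' y := by
  unfold groupForm
  rw [MonoidAlgebra.coeff_add, Finsupp.sum_add_index']
  · simp
  · intros; ring

lemma groupForm_single_left (g : G) (r : R) (y : MonoidAlgebra R G) :
    groupForm (MonoidAlgebra.single g r) y = r * y.coeff g := by
  simp [groupForm]

lemma groupForm_single_mul [Group G] (g : G) (r : R) (x y : MonoidAlgebra R G) :
    groupForm (MonoidAlgebra.single g r * x) y =
      r * groupForm x (MonoidAlgebra.single g⁻¹ 1 * y) := by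
  induction x using MonoidAlgebra.induction_linear with
  | zero => simp [groupForm_zero_left]
  | add x x' hx hx' => rw [mul_add, groupForm_add_left, groupForm_add_left, hx, hx', mul_add]
  | single h s =>
    rw [MonoidAlgebra.single_mul_single, groupForm_single_left, groupForm_single_left]
    simp [mul_assoc]

/-- The sum `Ŝ` in `RG` of the elements of a subset `S` of a finite group `G`. -/
def hatSum [Finite G] (S : Set G) : MonoidAlgebra R G :=
  ∑ g ∈ S.toFinite.toFinset, MonoidAlgebra.single g 1

end Form

section Steinberg

variable (n : ℕ) (F R : Type*) [Field F] [CommRing R]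

/-- The field `K = R / ℓR` (it is a field as soon as `ℓR` is the maximal ideal of `R`). -/
abbrev ResidueRing (ℓ : ℕ) : Type _ := R ⧸ Ideal.span {(ℓ : R)}

/-- The reduction of coefficients `RG → KG`. -/
def reduce (ℓ : ℕ) : MonoidAlgebra R (Matrix.GeneralLinearGroup (Fin n) F) →+*
    MonoidAlgebra (ResidueRing R ℓ) (Matrix.GeneralLinearGroup (Fin n) F) :=
  MonoidAlgebra.mapRingHom _ (Ideal.Quotient.mk (Ideal.span {(ℓ : R)}))

lemma reduce_surjective (ℓ : ℕ) : Function.Surjective (reduce n F R ℓ) := by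
  intro a
  induction a using MonoidAlgebra.induction_linear with
  | zero => exact ⟨0, map_zero _⟩
  | add a a' ha ha' =>
    obtain ⟨b, rfl⟩ := ha
    obtain ⟨b', rfl⟩ := ha'
    exact ⟨b + b', map_add _ _ _⟩
  | single g s =>
    obtain ⟨r, rfl⟩ := Ideal.Quotient.mk_surjective s
    exact ⟨MonoidAlgebra.single g r, by simp [reduce]⟩

lemma exists_eq_nsmul_of_reduce_eq_zero (ℓ : ℕ)
    (a : MonoidAlgebra R (Matrix.GeneralLinearGroup (Fin n) F)) (ha : reduce n F R ℓ a = 0) :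
    ∃ b, a = ℓ • b := by
  have h : ∀ g, ∃ r : R, a.coeff g = ℓ * r := fun g ↦ by
    have hg : (reduce n F R ℓ a).coeff g = 0 := by rw [ha]; simp
    rw [reduce, MonoidAlgebra.coeff_mapRingHom, Ideal.Quotient.eq_zero_iff_mem,
      Ideal.mem_span_singleton] at hg
    exact hg
  choose r hr using h
  refine ⟨∑ g ∈ a.coeff.support, MonoidAlgebra.single g (r g), ?_⟩
  rw [Finset.smul_sum]
  conv_lhs => rw [← MonoidAlgebra.sum_coeff_single a]
  refine Finset.sum_congr rfl fun g _ ↦ ?_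
  rw [hr g, MonoidAlgebra.smul_single, nsmul_eq_mul]

variable [Finite F]

/-- The element `∑_σ sg(σ) σ B̂` of `RG`, for `G = GL_n(F)`. -/
def steinbergElement : MonoidAlgebra R (Matrix.GeneralLinearGroup (Fin n) F) :=
  ∑ σ : Equiv.Perm (Fin n),
    MonoidAlgebra.single (permGL σ) (((Equiv.Perm.sign σ : ℤ) : R)) *
      hatSum (borel n F : Set (Matrix.GeneralLinearGroup (Fin n) F))

/-- The Steinberg lattice `I`, the left ideal of `RG` generated by `∑_σ sg(σ) σ B̂`. -/
def lattice : Submodule (MonoidAlgebra R (Matrix.GeneralLinearGroup (Fin n) F))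
    (MonoidAlgebra R (Matrix.GeneralLinearGroup (Fin n) F)) :=
  Submodule.span _ {steinbergElement n F R}

variable {n F R} in
/-- The form on `I` obtained from the canonical form of `RG` by scaling by `1 / |B|`. It is
written with values in the field of fractions of `R`, where the division takes place. -/
def form [IsDomain R] (x y : lattice n F R) : FractionRing R :=
  algebraMap R (FractionRing R) (groupForm x.1 y.1) /
    (Nat.card (borel n F) : FractionRing R)

/-- The `RG`-submodule `I(c) = {x ∈ I | f(x, I) ⊆ ℓ^c R}` of `I`. -/
def latticeFiltration [IsDomain R] (ℓ c : ℕ) :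
    Submodule (MonoidAlgebra R (Matrix.GeneralLinearGroup (Fin n) F)) (lattice n F R) where
  carrier := {x | ∀ y : lattice n F R,
    ∃ r : R, form x y = algebraMap R (FractionRing R) ((ℓ : R) ^ c * r)}
  zero_mem' y := ⟨0, by simp [form, groupForm_zero_left]⟩
  add_mem' {x x'} hx hx' y := by
    obtain ⟨r, hr⟩ := hx y
    obtain ⟨r', hr'⟩ := hx' y
    refine ⟨r + r', ?_⟩
    rw [mul_add, map_add, ← hr, ← hr']
    simp [form, groupForm_add_left, add_div]
  smul_mem' a x hx := by
    induction a using MonoidAlgebra.induction_linear with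
    | zero => exact fun y ↦ ⟨0, by simp [form, groupForm_zero_left]⟩
    | add a a' ha ha' =>
      intro y
      obtain ⟨r, hr⟩ := ha y
      obtain ⟨r', hr'⟩ := ha' y
      refine ⟨r + r', ?_⟩
      rw [mul_add, map_add, ← hr, ← hr']
      simp [form, add_smul, groupForm_add_left, add_div]
    | single g s =>
      intro y
      obtain ⟨r, hr⟩ := hx (MonoidAlgebra.single g⁻¹ (1 : R) • y)
      refine ⟨s * r, ?_⟩
      rw [mul_left_comm, map_mul, ← hr]
      simp [form, groupForm_single_mul, mul_div_assoc]

/-- The submodule `ℓI` of `I`, the image of multiplication by `ℓ`. -/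
def ellLattice (ℓ : ℕ) :
    Submodule (MonoidAlgebra R (Matrix.GeneralLinearGroup (Fin n) F)) (lattice n F R) :=
  LinearMap.range (ℓ • (LinearMap.id : lattice n F R →ₗ[MonoidAlgebra R
    (Matrix.GeneralLinearGroup (Fin n) F)] lattice n F R))

/-- The `ℓ`-modular reduction `L = I / ℓI`. -/
abbrev Reduction (ℓ : ℕ) : Type _ := lattice n F R ⧸ ellLattice n F R ℓ

lemma nsmul_reduction_eq_zero (ℓ : ℕ) (x : Reduction n F R ℓ) : ℓ • x = 0 := by
  obtain ⟨y, rfl⟩ := Submodule.Quotient.mk_surjective _ x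
  rw [← Submodule.Quotient.mk_smul, Submodule.Quotient.mk_eq_zero]
  exact ⟨y, rfl⟩

lemma smul_eq_of_reduce_eq (ℓ : ℕ)
    {a a' : MonoidAlgebra R (Matrix.GeneralLinearGroup (Fin n) F)}
    (h : reduce n F R ℓ a = reduce n F R ℓ a') (x : Reduction n F R ℓ) : a • x = a' • x := by
  obtain ⟨b, hb⟩ := exists_eq_nsmul_of_reduce_eq_zero n F R ℓ (a - a') (by rw [map_sub, h, sub_self])
  rw [← sub_eq_zero, ← sub_smul, hb, smul_assoc, nsmul_reduction_eq_zero]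

/-- An element of `KG` acts on `L` as any of its preimages in `RG`. -/
instance reductionSMul (ℓ : ℕ) :
    SMul (MonoidAlgebra (ResidueRing R ℓ) (Matrix.GeneralLinearGroup (Fin n) F))
      (Reduction n F R ℓ) where
  smul a x := (reduce_surjective n F R ℓ a).choose • x

lemma reduce_smul (ℓ : ℕ) (a : MonoidAlgebra R (Matrix.GeneralLinearGroup (Fin n) F))
    (x : Reduction n F R ℓ) : reduce n F R ℓ a • x = a • x :=
  smul_eq_of_reduce_eq n F R ℓ (reduce_surjective n F R ℓ (reduce n F R ℓ a)).choose_spec x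

/-- The structure of `KG`-module of `L`. -/
instance reductionModule (ℓ : ℕ) :
    Module (MonoidAlgebra (ResidueRing R ℓ) (Matrix.GeneralLinearGroup (Fin n) F))
      (Reduction n F R ℓ) :=
  Function.Surjective.moduleLeft (reduce n F R ℓ) (reduce_surjective n F R ℓ)
    (reduce_smul n F R ℓ)

/-- The term `L(c) = (I(c) + ℓI) / ℓI` of the Gow filtration, a `KG`-submodule of `L`. -/
def gowFiltration [IsDomain R] (ℓ c : ℕ) :
    Submodule (MonoidAlgebra (ResidueRing R ℓ) (Matrix.GeneralLinearGroup (Fin n) F))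
      (Reduction n F R ℓ) where
  carrier := {x | ∃ y ∈ latticeFiltration n F R ℓ c, Submodule.Quotient.mk y = x}
  zero_mem' := ⟨0, zero_mem _, rfl⟩
  add_mem' := by
    rintro _ _ ⟨y, hy, rfl⟩ ⟨y', hy', rfl⟩
    exact ⟨y + y', add_mem hy hy', rfl⟩
  smul_mem' := by
    rintro a _ ⟨y, hy, rfl⟩
    obtain ⟨b, rfl⟩ := reduce_surjective n F R ℓ a
    exact ⟨b • y, Submodule.smul_mem _ b hy, by
      rw [reduce_smul, Submodule.Quotient.mk_smul]⟩

end Steinberg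

/-- `e = min {i ≥ 2 | ℓ divides (q^i - 1) / (q - 1)}`. -/
def gowE (ℓ q : ℕ) : ℕ := sInf {i : ℕ | 2 ≤ i ∧ ℓ ∣ (q ^ i - 1) / (q - 1)}

/-- `d = ν_ℓ((q^e - 1) / (q - 1))`. -/
def gowD (ℓ q : ℕ) : ℕ := padicValNat ℓ ((q ^ gowE ℓ q - 1) / (q - 1))

end

end GowSteinberg

namespace GowSteinberg

open Matrix
open scoped MatrixGroups

noncomputable section

/-! ### Matrix computations in `GL_n(F)` and the Bruhat decomposition -/

section GroupBasics

variable {n : ℕ} {F : Type*} [Field F]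

/-! Let `U` be the unitriangular group and `ψ` a nontrivial additive character of `F` with values in
`R`. For every composition of `n`, applying `ψ` to the sum of the superdiagonal entries inside the
diagonal blocks gives a linear character of `U`. Twisting the sum over `U` of the translates of the
Steinberg element by this character yields an eigenvector, `whittaker ψ b`. The lattice is spanned
over `R` by the `U`-translates of its generator (`lattice_le_span`), so the twisted sum maps the
whole lattice into the multiples of this one vector (`exists_charProj_eq_smul`).

Position in the filtration: the group form of `whittaker ψ b` with the Steinberg element is `|B| [G
: P]`, where `P` is the parabolic subgroup of the composition
(`groupForm_whittaker_steinbergElement`). Only permutations that reverse each block contribute, and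
the sum of their contributions is an index by a count of Bruhat cells. By multiplicity one, the
class of the eigenvector lies in `L(c)` exactly when `c ≤ ν_ℓ([G : P])`
(`whittakerClass_mem_gowFiltration_iff`).

Detection: if `X` and `Y` are submodules of `L` with `X` not inside `Y`, some eigenvector class lies
in `X` but not in `Y` (`exists_whittaker_mem`). One treats the columns of `U` from right to left,
decomposes under the abelian group of each column, whose order is prime to `ℓ`, and moves the
character found to standard form by an element of a mirabolic group.

Reduction to `𝒫*`: a submodule that contains the eigenvector of a composition contains those of its
refinements, and the converse holds when the index grows by a factor prime to `ℓ`
(`whittaker_mem_iff_of_split`); the order of the blocks is immaterial (`whittaker_mem_iff_of_perm`).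
Every part other than `1` and `e ℓ^i` can be split without change of the valuation
(`exists_qFactVal_split`), so the eigenvectors of `𝒫*` already detect submodules.

Conclusion: the bounds on `d` and `n / e` make the valuation of the index injective on `𝒫*`
(`star_list_unique`). If `X` were strictly between `L(c + 1)` and `L(c)`, there would be an
eigenvector from `𝒫*` in `X` outside `L(c + 1)` and one in `L(c)` outside `X`. Both have valuation
`c`, so they coincide, a contradiction. -/

lemma permGL_val (σ : Equiv.Perm (Fin n)) :
    (permGL σ : GL (Fin n) F).val = (σ⁻¹).permMatrix F := rfl

lemma permGL_mul_apply (σ : Equiv.Perm (Fin n)) (g : GL (Fin n) F) (i j : Fin n) :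
    (permGL σ * g).val i j = g.val (σ⁻¹ i) j := by
  rw [Units.val_mul, permGL_val, PEquiv.toMatrix_toPEquiv_mul]
  rfl

lemma mul_permGL_apply (σ : Equiv.Perm (Fin n)) (g : GL (Fin n) F) (i j : Fin n) :
    (g * permGL σ).val i j = g.val i (σ j) := by
  rw [Units.val_mul, permGL_val, PEquiv.mul_toMatrix_toPEquiv]
  rfl

lemma permGL_apply (σ : Equiv.Perm (Fin n)) (i j : Fin n) :
    (permGL σ : GL (Fin n) F).val i j = if i = σ j then 1 else 0 := by
  rw [← one_mul (permGL σ), mul_permGL_apply, Units.val_one, Matrix.one_apply]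

lemma permGL_inv_mul_apply (σ τ : Equiv.Perm (Fin n)) (g : GL (Fin n) F) (i j : Fin n) :
    ((permGL σ)⁻¹ * g * permGL τ).val i j = g.val (σ i) (τ j) := by
  rw [mul_permGL_apply, ← map_inv, permGL_mul_apply, inv_inv]

lemma mem_blockUpper {α : Type*} [LinearOrder α] {b : Fin n → α} {g : GL (Fin n) F} :
    g ∈ blockUpper b ↔ ∀ i j, b j < b i → g.val i j = 0 :=
  ⟨fun h _ _ hij ↦ h hij, fun h i j hij ↦ h i j hij⟩

lemma mem_borel {g : GL (Fin n) F} : g ∈ borel n F ↔ ∀ i j, j < i → g.val i j = 0 :=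
  mem_blockUpper

lemma borel_le_blockUpper {α : Type*} [LinearOrder α] {b : Fin n → α} (hb : Monotone b) :
    borel n F ≤ blockUpper b := fun _ hg ↦ mem_blockUpper.2 fun i j hij ↦
  mem_borel.1 hg i j (hb.reflect_lt hij)

lemma borel_apply_self_ne_zero {g : GL (Fin n) F} (hg : g ∈ borel n F) (i : Fin n) :
    g.val i i ≠ 0 := by
  have h := Matrix.GeneralLinearGroup.det_ne_zero g
  rw [Matrix.det_of_isUpperTriangular (M := g.val) hg] at h
  exact Finset.prod_ne_zero_iff.1 h i (Finset.mem_univ _)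

lemma borel_mul_apply_self {g h : GL (Fin n) F} (hg : g ∈ borel n F) (hh : h ∈ borel n F)
    (i : Fin n) : (g * h).val i i = g.val i i * h.val i i := by
  rw [Units.val_mul, Matrix.mul_apply, Finset.sum_eq_single i]
  · intro j _ hj
    rcases lt_or_gt_of_ne hj with h1 | h1
    · rw [mem_borel.1 hg i j h1, zero_mul]
    · rw [mem_borel.1 hh j i h1, mul_zero]
  · simp

lemma borel_mul_apply_succ {g h : GL (Fin n) F} (hg : g ∈ borel n F) (hh : h ∈ borel n F)
    {i j : Fin n} (hij : (j : ℕ) = i + 1) :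
    (g * h).val i j = g.val i i * h.val i j + g.val i j * h.val j j := by
  have hne : i ≠ j := by rintro rfl; omega
  rw [Units.val_mul, Matrix.mul_apply, ← Finset.sum_subset (Finset.subset_univ {i, j}),
    Finset.sum_pair hne]
  intro k _ hk
  simp only [Finset.mem_insert, Finset.mem_singleton, not_or] at hk
  rcases lt_or_gt_of_ne hk.1 with h1 | h1
  · rw [mem_borel.1 hg i k h1, zero_mul]
  · rw [mem_borel.1 hh k j (by
      have := Fin.val_ne_of_ne hk.2
      rw [Fin.lt_def] at h1 ⊢; omega), mul_zero]

variable (n F) in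
/-- The group of upper unitriangular matrices. -/
def unitri : Subgroup (GL (Fin n) F) where
  carrier := {g | g ∈ borel n F ∧ ∀ i, g.val i i = 1}
  one_mem' := ⟨one_mem _, fun i ↦ by simp⟩
  mul_mem' {g h} hg hh := ⟨mul_mem hg.1 hh.1, fun i ↦ by
    rw [borel_mul_apply_self hg.1 hh.1, hg.2, hh.2, one_mul]⟩
  inv_mem' {g} hg := ⟨inv_mem hg.1, fun i ↦ by
    have h := borel_mul_apply_self hg.1 (inv_mem hg.1) i
    rw [hg.2, one_mul, mul_inv_cancel] at h
    rw [← h]; simp⟩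

/-- The elementary matrix with entry `t` in position `(i, j)`. -/
def elemGL (i j : Fin n) (hij : i ≠ j) (t : F) : GL (Fin n) F where
  val := transvection i j t
  inv := transvection i j (-t)
  val_inv := by rw [transvection_mul_transvection_same i j hij]; simp
  inv_val := by rw [transvection_mul_transvection_same i j hij]; simp

lemma elemGL_mul_elemGL (i j : Fin n) (hij : i ≠ j) (s t : F) :
    elemGL i j hij s * elemGL i j hij t = elemGL i j hij (s + t) :=
  Units.ext (transvection_mul_transvection_same i j hij s t)

lemma elemGL_zero (i j : Fin n) (hij : i ≠ j) : elemGL i j hij (0 : F) = 1 :=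
  Units.ext (transvection_zero i j)

lemma elemGL_inv (i j : Fin n) (hij : i ≠ j) (t : F) :
    (elemGL i j hij t)⁻¹ = elemGL i j hij (-t) := by
  rw [inv_eq_iff_mul_eq_one, elemGL_mul_elemGL, add_neg_cancel, elemGL_zero]

lemma elemGL_apply (i j : Fin n) (hij : i ≠ j) (t : F) (k l : Fin n) :
    (elemGL i j hij t).val k l = (if k = l then 1 else 0) + if k = i ∧ l = j then t else 0 := by
  change transvection i j t k l = _
  rw [transvection, Matrix.add_apply, Matrix.one_apply, Matrix.single_apply]
  simp only [eq_comm]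

lemma elemGL_mul_apply (i j : Fin n) (hij : i ≠ j) (t : F) (g : GL (Fin n) F) (k l : Fin n) :
    (elemGL i j hij t * g).val k l = g.val k l + if k = i then t * g.val j l else 0 := by
  change (transvection i j t * g.val) k l = _
  split_ifs with h
  · subst h; rw [transvection_mul_apply_same]
  · rw [transvection_mul_apply_of_ne _ _ _ _ h, add_zero]

lemma mul_elemGL_apply (i j : Fin n) (hij : i ≠ j) (t : F) (g : GL (Fin n) F) (k l : Fin n) :
    (g * elemGL i j hij t).val k l = g.val k l + if l = j then t * g.val k i else 0 := by
  change (g.val * transvection i j t) k l = _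
  split_ifs with h
  · subst h; rw [mul_transvection_apply_same]
  · rw [mul_transvection_apply_of_ne _ _ _ _ h, add_zero]

lemma elemGL_mem_unitri {i j : Fin n} (hij : i < j) (t : F) :
    elemGL i j hij.ne t ∈ unitri n F := by
  refine ⟨mem_borel.2 fun k l hkl ↦ ?_, fun k ↦ ?_⟩
  · rw [elemGL_apply, if_neg hkl.ne', if_neg, add_zero]
    rintro ⟨rfl, rfl⟩; exact absurd hij hkl.asymm
  · rw [elemGL_apply, if_pos rfl, if_neg, add_zero]
    rintro ⟨rfl, rfl⟩; exact lt_irrefl _ hij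

lemma permGL_conj_elemGL (σ : Equiv.Perm (Fin n)) (i j : Fin n) (hij : i ≠ j) (t : F) :
    permGL σ * elemGL i j hij t * (permGL σ)⁻¹ =
      elemGL (σ i) (σ j) (σ.injective.ne hij) t := by
  ext k l
  rw [← map_inv, mul_permGL_apply, permGL_mul_apply, elemGL_apply, elemGL_apply]
  simp [Equiv.symm_apply_eq]

lemma eq_one_of_forall_le {π : Equiv.Perm (Fin n)} (h : ∀ j, π j ≤ j) : π = 1 := by
  have key : ∀ m : ℕ, ∀ j : Fin n, (j : ℕ) = m → π j = j := by
    intro m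
    induction m using Nat.strong_induction_on with
    | _ m ih =>
      intro j hj
      by_contra hne
      have hlt : π j < j := lt_of_le_of_ne (h j) hne
      have := ih (π j) (by rw [← hj]; exact hlt) (π j) rfl
      exact hne (π.injective this)
  exact Equiv.ext fun j ↦ key j j rfl

/-- This is the disjointness of Bruhat cells. The nonzero diagonal entries of `g` reappear at the
positions `(τ⁻¹ σ j, j)`, so triangularity forces `τ⁻¹ σ j ≤ j` for all `j`. -/
lemma perm_eq_of_inv_mul_mem_borel {g : GL (Fin n) F} (hg : g ∈ borel n F)
    {σ τ : Equiv.Perm (Fin n)} (h : (permGL τ)⁻¹ * g * permGL σ ∈ borel n F) : σ = τ := by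
  have : τ⁻¹ * σ = 1 := eq_one_of_forall_le fun j ↦ by
    by_contra hlt
    rw [not_le] at hlt
    have h1 := mem_borel.1 h _ _ hlt
    rw [permGL_inv_mul_apply] at h1
    exact borel_apply_self_ne_zero hg (σ j) (by simpa using h1)
  rw [inv_mul_eq_one] at this
  exact this.symm

lemma inv_mul_elemGL_mul_mem_borel {σ : Equiv.Perm (Fin n)} {i j : Fin n} (hij : i ≠ j) (t : F)
    (h : σ⁻¹ i < σ⁻¹ j) : (permGL σ)⁻¹ * elemGL i j hij t * permGL σ ∈ borel n F := by
  rw [mem_borel]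
  intro k l hkl
  rw [permGL_inv_mul_apply, elemGL_apply, if_neg (σ.injective.ne hkl.ne'), if_neg, add_zero]
  rintro ⟨rfl, rfl⟩
  simp only [Equiv.Perm.inv_def, Equiv.symm_apply_apply] at h
  exact absurd h hkl.asymm

/-- The rank-one identity in `GL_2`: swap times `x(t)` equals `x(t⁻¹)` times the lower triangular
matrix with rows `(-t⁻¹, 0)` and `(1, t)`. Conjugation by `σ` makes this last factor upper
triangular when `σ⁻¹` reverses `i` and `j`. -/
lemma swap_mul_elemGL_mul {σ : Equiv.Perm (Fin n)} {i j : Fin n} (hij : i ≠ j) {t : F}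
    (ht : t ≠ 0) (h : σ⁻¹ j < σ⁻¹ i) :
    ∃ b ∈ borel n F, permGL (Equiv.swap i j) * elemGL i j hij t * permGL σ =
      elemGL i j hij t⁻¹ * permGL σ * b := by
  refine ⟨(elemGL i j hij t⁻¹ * permGL σ)⁻¹ *
    (permGL (Equiv.swap i j) * elemGL i j hij t * permGL σ), ?_, by group⟩
  have : (elemGL i j hij t⁻¹ * permGL σ)⁻¹ *
      (permGL (Equiv.swap i j) * elemGL i j hij t * permGL σ) = (permGL σ)⁻¹ *
      (elemGL i j hij (-t⁻¹) * (permGL (Equiv.swap i j) * elemGL i j hij t)) * permGL σ := by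
    rw [← elemGL_inv]; group
  rw [this, mem_borel]
  intro k l hkl
  rw [permGL_inv_mul_apply, elemGL_mul_apply, permGL_mul_apply, permGL_mul_apply,
    Equiv.swap_inv, elemGL_apply, elemGL_apply]
  have hne : σ k ≠ σ l := σ.injective.ne hkl.ne'
  simp only [Equiv.swap_apply_right]
  by_cases h1 : σ k = i
  · rw [h1] at hne
    rw [h1, Equiv.swap_apply_left]
    by_cases h2 : σ l = j
    · simp [h2, hij, hij.symm, ht]
    · simp [Ne.symm h2, hne, h2]
  · by_cases h2 : σ k = j
    · rw [h2] at hne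
      rw [h2, Equiv.swap_apply_right]
      have h3 : σ l ≠ i := by
        rintro h3
        rw [← h2, ← h3] at h
        simp only [Equiv.Perm.inv_def, Equiv.symm_apply_apply] at h
        exact absurd h hkl.asymm
      simp [h3.symm, hij.symm, hne.symm]
    · rw [Equiv.swap_apply_of_ne_of_ne h1 h2]
      simp [hne, h1]

/-- An adjacent transposition permutes the positions above the diagonal except `(i, j)`, the one
that it sends below, and there the entry is zero. -/
lemma swap_conj_mem_borel {g : GL (Fin n) F} (hg : g ∈ borel n F) {i j : Fin n}
    (hij : (j : ℕ) = i + 1) (h0 : g.val i j = 0) :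
    permGL (Equiv.swap i j) * g * permGL (Equiv.swap i j) ∈ borel n F := by
  have hs : (permGL (Equiv.swap i j) : GL (Fin n) F) = (permGL (Equiv.swap i j))⁻¹ := by
    rw [← map_inv, Equiv.swap_inv]
  rw [mem_borel]
  intro k l hkl
  conv_lhs => rw [hs]
  rw [← hs, mul_permGL_apply, permGL_mul_apply, Equiv.swap_inv]
  by_cases hk : k = j ∧ l = i
  · rw [hk.1, hk.2]; simpa using h0
  · refine mem_borel.1 hg _ _ ?_
    simp only [Equiv.swap_apply_def, Fin.lt_def, Fin.ext_iff] at hkl hk ⊢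
    split_ifs <;> omega

lemma swap_conj_mem_unitri {g : GL (Fin n) F} (hg : g ∈ unitri n F) {i j : Fin n}
    (hij : (j : ℕ) = i + 1) (h0 : g.val i j = 0) :
    permGL (Equiv.swap i j) * g * permGL (Equiv.swap i j) ∈ unitri n F :=
  ⟨swap_conj_mem_borel hg.1 hij h0, fun k ↦ by
    rw [mul_permGL_apply, permGL_mul_apply, Equiv.swap_inv]; exact hg.2 _⟩

lemma swap_perm_induction (S : Submonoid (Equiv.Perm (Fin n)))
    (h : ∀ i j : Fin n, (j : ℕ) = i + 1 → Equiv.swap i j ∈ S) : S = ⊤ := by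
  cases n with
  | zero =>
    rw [eq_top_iff]
    intro x _
    rw [Subsingleton.elim x 1]
    exact one_mem _
  | succ m =>
    rw [eq_top_iff, ← Equiv.Perm.mclosure_swap_castSucc_succ, Submonoid.closure_le]
    rintro _ ⟨i, rfl⟩
    exact h _ _ (by simp)

/-- Diagonal matrices and transvections generate `GL_n`, and a lower transvection is conjugate to an
upper one by a permutation matrix. A submonoid suffices, which suits sets defined by stability under
left translation. -/
lemma borel_swap_induction (S : Submonoid (GL (Fin n) F)) (hB : ∀ g ∈ borel n F, g ∈ S)
    (h : ∀ i j : Fin n, (j : ℕ) = i + 1 → permGL (Equiv.swap i j) ∈ S) (g : GL (Fin n) F) :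
    g ∈ S := by
  have hW : ∀ σ : Equiv.Perm (Fin n), permGL σ ∈ S := fun σ ↦ by
    have := swap_perm_induction (S.comap permGL) h
    have h1 : σ ∈ S.comap permGL := this ▸ Submonoid.mem_top σ
    exact h1
  have hE : ∀ (i j : Fin n) (hij : i ≠ j) (t : F), elemGL i j hij t ∈ S := by
    intro i j hij t
    rcases lt_or_gt_of_ne hij with h1 | h1
    · exact hB _ (elemGL_mem_unitri h1 t).1
    · have h2 := permGL_conj_elemGL (Equiv.swap i j) j i hij.symm t
      simp only [Equiv.swap_apply_left, Equiv.swap_apply_right] at h2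
      rw [← h2, ← map_inv]
      exact mul_mem (mul_mem (hW _) (hB _ (elemGL_mem_unitri h1 t).1)) (hW _)
  have := Matrix.diagonal_transvection_induction_of_det_ne_zero
    (fun M ↦ ∀ g : GL (Fin n) F, g.val = M → g ∈ S) g.val
    (Matrix.GeneralLinearGroup.det_ne_zero g) ?_ ?_ ?_
  · exact this g rfl
  · intro D _ g hg
    refine hB _ (mem_borel.2 fun i j hij ↦ ?_)
    rw [hg, Matrix.diagonal_apply_ne _ hij.ne']
  · rintro ⟨i, j, hij, t⟩ g hg
    have : g = elemGL i j hij t := Units.ext hg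
    rw [this]
    exact hE _ _ _ _
  · intro A B hA hB' PA PB g hg
    have : g = Matrix.GeneralLinearGroup.mkOfDetNeZero A hA *
      Matrix.GeneralLinearGroup.mkOfDetNeZero B hB' := Units.ext hg
    rw [this]
    exact mul_mem (PA _ rfl) (PB _ rfl)

/-- Splitting off the simple root factor of an upper triangular matrix. -/
lemma borel_eq_mul_elemGL {g : GL (Fin n) F} (hg : g ∈ borel n F) {i j : Fin n}
    (hij : (j : ℕ) = i + 1) (hne : i ≠ j) : ∃ (g' : GL (Fin n) F) (t : F), g' ∈ borel n F ∧
      g'.val i j = 0 ∧ g = g' * elemGL i j hne t ∧ (g ∈ unitri n F → g' ∈ unitri n F) := by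
  have hlt : i < j := by rw [Fin.lt_def]; omega
  have hx := fun t : F ↦ elemGL_mem_unitri hlt t
  refine ⟨g * elemGL i j hne (-(g.val i j / g.val i i)), g.val i j / g.val i i,
    mul_mem hg (hx _).1, ?_, ?_, fun h ↦ mul_mem h (hx _)⟩
  · rw [mul_elemGL_apply, if_pos rfl]
    have := borel_apply_self_ne_zero hg i
    field_simp
    ring
  · rw [mul_assoc, elemGL_mul_elemGL, neg_add_cancel, elemGL_zero, mul_one]

lemma exists_bruhat (g : GL (Fin n) F) : ∃ b ∈ borel n F, ∃ σ, ∃ b' ∈ borel n F,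
    g = b * permGL σ * b' := by
  let Z : Set (GL (Fin n) F) := {g | ∃ b ∈ borel n F, ∃ σ, ∃ b' ∈ borel n F,
    g = b * permGL σ * b'}
  let S : Submonoid (GL (Fin n) F) :=
    { carrier := {g | ∀ z ∈ Z, g * z ∈ Z}
      one_mem' := fun z hz ↦ by rwa [one_mul]
      mul_mem' := fun {a b} ha hb z hz ↦ by rw [mul_assoc]; exact ha _ (hb _ hz) }
  have hS := borel_swap_induction S ?_ ?_ g
  · have := hS 1 ⟨1, one_mem _, 1, 1, one_mem _, by simp⟩
    rwa [mul_one] at this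
  · rintro c hc _ ⟨b, hb, σ, b', hb', rfl⟩
    exact ⟨c * b, mul_mem hc hb, σ, b', hb', by group⟩
  · rintro i j hij _ ⟨b, hb, σ, b', hb', rfl⟩
    have hne : i ≠ j := by rintro rfl; omega
    have hlt : i < j := by rw [Fin.lt_def]; omega
    obtain ⟨c, t, hc, h0, rfl, -⟩ := borel_eq_mul_elemGL hb hij hne
    have hcs := swap_conj_mem_borel hc hij h0
    set s : GL (Fin n) F := permGL (Equiv.swap i j) with hs
    have hss : s * s = 1 := by rw [hs, ← map_mul, Equiv.swap_mul_self, map_one]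
    have e1 : s * (c * elemGL i j hne t * permGL σ * b') =
        (s * c * s) * (s * elemGL i j hne t * permGL σ) * b' := by
      simp only [mul_assoc]
      rw [← mul_assoc s s, hss, one_mul]
    rw [e1]
    -- The root factor either passes through `σ` into `B`, or, when `t ≠ 0`, is rewritten by the
    -- rank-one identity, which leaves `σ` unchanged.
    by_cases hcase : σ⁻¹ i < σ⁻¹ j
    · refine ⟨s * c * s, hcs, Equiv.swap i j * σ, _,
        mul_mem (inv_mul_elemGL_mul_mem_borel hne t hcase) hb', ?_⟩
      rw [map_mul, ← hs]
      group
    · have hcase' : σ⁻¹ j < σ⁻¹ i := lt_of_le_of_ne (not_lt.1 hcase) (σ⁻¹.injective.ne hne.symm)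
      by_cases ht : t = 0
      · refine ⟨s * c * s, hcs, Equiv.swap i j * σ, b', hb', ?_⟩
        rw [map_mul, ← hs, ht, elemGL_zero]
        group
      · obtain ⟨d, hd, hd'⟩ := swap_mul_elemGL_mul hne ht hcase'
        refine ⟨s * c * s * elemGL i j hne t⁻¹, mul_mem hcs (elemGL_mem_unitri hlt _).1, σ,
          d * b', mul_mem hd hb', ?_⟩
        rw [hs, hd']
        group

end GroupBasics

/-! ### Inversion counts, Bruhat cells and the index of a parabolic subgroup -/

section Counting

variable {n : ℕ}

open Classical in
/-- The number of pairs `i < j` whose order is preserved by `ρ`. -/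
def coinv (ρ : Equiv.Perm (Fin n)) : ℕ :=
  (Finset.univ.filter fun p : Fin n × Fin n ↦ p.1 < p.2 ∧ ρ p.1 < ρ p.2).card

open Classical in
/-- The number of inversions of `ρ`. -/
def invNumber (ρ : Equiv.Perm (Fin n)) : ℕ :=
  (Finset.univ.filter fun p : Fin n × Fin n ↦ p.1 < p.2 ∧ ρ p.2 < ρ p.1).card

lemma coinv_add_invNumber (ρ : Equiv.Perm (Fin n)) :
    coinv ρ + invNumber ρ = coinv (1 : Equiv.Perm (Fin n)) := by
  classical
  unfold coinv invNumber
  rw [← Finset.card_union_of_disjoint]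
  · congr 1
    ext p
    have h : p.1 < p.2 → ρ p.1 ≠ ρ p.2 := fun h ↦ ρ.injective.ne h.ne
    simp only [Finset.mem_union, Finset.mem_filter, Finset.mem_univ, true_and,
      Equiv.Perm.coe_one, id_eq, and_self]
    constructor
    · tauto
    · intro hp
      rcases lt_or_gt_of_ne (h hp) with h1 | h1
      · exact Or.inl ⟨hp, h1⟩
      · exact Or.inr ⟨hp, h1⟩
  · rw [Finset.disjoint_filter]
    exact fun p _ h1 h2 ↦ absurd h1.2 h2.2.asymm

lemma coinv_revPerm_mul (ρ : Equiv.Perm (Fin n)) : coinv (Fin.revPerm * ρ) = invNumber ρ := by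
  simp [coinv, invNumber]

/-- `ρ` is decreasing on the blocks of the labelling `b`. -/
def BlockAnti (b : Fin n → ℕ) (ρ : Equiv.Perm (Fin n)) : Prop :=
  ∀ i j, i < j → b i = b j → ρ j < ρ i

/-- `x` preserves the blocks of the labelling `b`. -/
def BlockPres (b : Fin n → ℕ) (x : Equiv.Perm (Fin n)) : Prop := ∀ i, b (x i) = b i

lemma BlockPres.inv {b : Fin n → ℕ} {x : Equiv.Perm (Fin n)} (hx : BlockPres b x) :
    BlockPres b x⁻¹ := fun i ↦ by
  have := hx (x⁻¹ i)
  simpa using this.symm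

lemma BlockPres.mul {b : Fin n → ℕ} {x y : Equiv.Perm (Fin n)} (hx : BlockPres b x)
    (hy : BlockPres b y) : BlockPres b (x * y) := fun i ↦ by
  rw [Equiv.Perm.mul_apply, hx, hy]

lemma exists_blockPres_blockAnti {b : Fin n → ℕ} (hb : Monotone b) (ρ : Equiv.Perm (Fin n)) :
    ∃ y, BlockPres b y ∧ BlockAnti b (ρ * y) := by
  -- Positions are sorted by block, and inside a block by decreasing value of `ρ`.
  let f : Fin n → ℕ ×ₗ Fin n := fun i ↦ toLex (b i, Fin.rev (ρ i))
  have hf := Tuple.monotone_sort f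
  set y := Tuple.sort f
  have hf' : ∀ i j, i ≤ j → b (y i) < b (y j) ∨
      b (y i) = b (y j) ∧ Fin.rev (ρ (y i)) ≤ Fin.rev (ρ (y j)) := fun i j hij ↦ by
    have := hf hij
    simp only [Function.comp_apply, f] at this
    rwa [Prod.Lex.toLex_le_toLex] at this
  -- Both sides are monotone rearrangements of the same labels, so the sorting does not mix the
  -- blocks.
  have h1 : b ∘ y = b ∘ (1 : Equiv.Perm (Fin n)) := by
    refine Tuple.unique_monotone (fun i j hij ↦ ?_) (by simpa using hb)
    rcases hf' i j hij with h | h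
    · exact h.le
    · exact h.1.le
  have h2 : BlockPres b y := fun i ↦ congrFun h1 i
  refine ⟨y, h2, fun i j hij hbij ↦ ?_⟩
  rcases hf' i j hij.le with h | h
  · rw [h2, h2, hbij] at h
    exact absurd h (lt_irrefl _)
  · refine lt_of_le_of_ne (Fin.rev_le_rev.1 h.2) fun h3 ↦ hij.ne' ?_
    simpa using h3

/-- Pairs in different blocks are merely permuted by `x` and give `coinv ρ`; a pair inside a block
has its order preserved by `ρ * x` exactly when `x` inverts it, since `ρ` is decreasing there. -/
lemma coinv_mul {b : Fin n → ℕ} (hb : Monotone b) {ρ x : Equiv.Perm (Fin n)}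
    (hρ : BlockAnti b ρ) (hx : BlockPres b x) : coinv (ρ * x) = coinv ρ + invNumber x := by
  classical
  have hρ' : ∀ i j, b i = b j → (ρ i < ρ j ↔ j < i) := fun i j hij ↦ by
    constructor
    · intro h
      by_contra h1
      rcases (not_lt.1 h1).lt_or_eq with h2 | h2
      · exact absurd h (hρ i j h2 hij).asymm
      · rw [h2] at h; exact lt_irrefl _ h
    · exact fun h ↦ hρ j i h hij.symm
  have e1 : coinv ρ = (Finset.univ.filter fun p : Fin n × Fin n ↦
      b p.1 < b p.2 ∧ ρ p.1 < ρ p.2).card := by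
    unfold coinv
    congr 1
    ext p
    simp only [Finset.mem_filter, Finset.mem_univ, true_and]
    constructor
    · rintro ⟨h1, h2⟩
      refine ⟨lt_of_le_of_ne (hb h1.le) fun h3 ↦ ?_, h2⟩
      exact absurd ((hρ' _ _ h3).1 h2) h1.asymm
    · rintro ⟨h1, h2⟩
      exact ⟨hb.reflect_lt h1, h2⟩
  have e2 : coinv ρ = (Finset.univ.filter fun p : Fin n × Fin n ↦
      b p.1 < b p.2 ∧ ρ (x p.1) < ρ (x p.2)).card := by
    rw [e1]
    refine (Finset.card_equiv (x.prodCongr x) fun p ↦ ?_).symm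
    simp [hx p.1, hx p.2]
  rw [e2]
  unfold coinv invNumber
  rw [← Finset.card_union_of_disjoint]
  · congr 1
    ext p
    simp only [Finset.mem_union, Finset.mem_filter, Finset.mem_univ, true_and]
    rw [Equiv.Perm.mul_apply, Equiv.Perm.mul_apply]
    have hbx : b (x p.1) = b (x p.2) ↔ b p.1 = b p.2 := by rw [hx, hx]
    constructor
    · rintro ⟨h1, h2⟩
      rcases (hb h1.le).lt_or_eq with h3 | h3
      · exact Or.inl ⟨h3, h2⟩
      · exact Or.inr ⟨h1, (hρ' _ _ (hbx.2 h3)).1 h2⟩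
    · rintro (⟨h1, h2⟩ | ⟨h1, h2⟩)
      · exact ⟨hb.reflect_lt h1, h2⟩
      · refine ⟨h1, (hρ' _ _ (hbx.2 ?_)).2 h2⟩
        refine le_antisymm (hb h1.le) ?_
        rw [← hx p.1, ← hx p.2]
        exact hb h2.le
  · rw [Finset.disjoint_filter]
    rintro p _ ⟨h1, _⟩ ⟨_, h3⟩
    have := hb h3.le
    rw [hx, hx] at this
    exact absurd h1 (not_lt.2 this)

/-- The quotient `x * x'⁻¹` preserves the blocks, and it is increasing on each of them because `ρ`
and `ρ'` are both decreasing there. Hence it is strictly monotone, and so the identity. -/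
lemma blockAnti_mul_unique {b : Fin n → ℕ} (hb : Monotone b) {ρ ρ' x x' : Equiv.Perm (Fin n)}
    (hρ : BlockAnti b ρ) (hρ' : BlockAnti b ρ') (hx : BlockPres b x) (hx' : BlockPres b x')
    (h : ρ * x = ρ' * x') : ρ = ρ' ∧ x = x' := by
  have hy : BlockPres b (x * x'⁻¹) := hx.mul hx'.inv
  have e : ρ' = ρ * (x * x'⁻¹) := by rw [← mul_assoc, h]; simp
  set y := x * x'⁻¹ with hyd
  have hmono : StrictMono y := by
    intro i j hij
    rcases (hb hij.le).lt_or_eq with h1 | h1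
    · rw [← hy i, ← hy j] at h1
      exact hb.reflect_lt h1
    · have h2 := hρ' i j hij h1
      rw [e, Equiv.Perm.mul_apply, Equiv.Perm.mul_apply] at h2
      by_contra h3
      rcases (not_lt.1 h3).lt_or_eq with h4 | h4
      · exact absurd h2 (hρ _ _ h4 (by rw [hy, hy, h1])).asymm
      · exact hij.ne' (y.injective h4)
  have h1 : y = 1 := by
    refine Equiv.ext fun i ↦ ?_
    have := Subsingleton.elim (hmono.orderIsoOfSurjective y y.surjective) (OrderIso.refl _)
    exact congrArg (fun e : Fin n ≃o Fin n ↦ e i) this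
  rw [h1, mul_one] at e
  refine ⟨e.symm, ?_⟩
  rw [hyd, mul_inv_eq_one] at h1
  exact h1

open Classical in
-- The factorisation of the Poincaré polynomial of the symmetric group along a Young subgroup. The
-- coset representatives decrease on blocks, hence the count by preserved pairs; reversing the
-- values turns preserved pairs into inversions.
lemma sum_coinv_mul_sum_invNumber {b : Fin n → ℕ} (hb : Monotone b) (q : ℕ) :
    (∑ ρ ∈ Finset.univ.filter (BlockAnti b), q ^ coinv ρ) *
      (∑ x ∈ Finset.univ.filter (BlockPres b), q ^ invNumber x) =
    ∑ ρ : Equiv.Perm (Fin n), q ^ invNumber ρ := by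
  rw [Finset.sum_mul_sum, ← Finset.sum_product']
  trans ∑ ρ : Equiv.Perm (Fin n), q ^ coinv ρ
  · refine Finset.sum_bij (fun p _ ↦ p.1 * p.2) (fun _ _ ↦ Finset.mem_univ _) ?_ ?_ ?_
    · rintro ⟨ρ, x⟩ h ⟨ρ', x'⟩ h' e
      simp only [Finset.mem_product, Finset.mem_filter, Finset.mem_univ, true_and] at h h'
      obtain ⟨h1, h2⟩ := blockAnti_mul_unique hb h.1 h'.1 h.2 h'.2 e
      rw [h1, h2]
    · intro ρ _
      obtain ⟨y, hy, hy'⟩ := exists_blockPres_blockAnti hb ρ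
      refine ⟨(ρ * y, y⁻¹), ?_, by simp⟩
      simp only [Finset.mem_product, Finset.mem_filter, Finset.mem_univ, true_and]
      exact ⟨hy', hy.inv⟩
    · rintro ⟨ρ, x⟩ h
      simp only [Finset.mem_product, Finset.mem_filter, Finset.mem_univ, true_and] at h
      rw [coinv_mul hb h.1 h.2, pow_add]
  · rw [← Equiv.sum_comp (Equiv.mulLeft Fin.revPerm)]
    simp [coinv_revPerm_mul]

variable {F : Type*} [Field F]

/-- The group of the upper unitriangular matrices `u` with `σ⁻¹ u σ` upper triangular. -/
def unitriStab (F : Type*) [Field F] (σ : Equiv.Perm (Fin n)) : Subgroup (GL (Fin n) F) :=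
  unitri n F ⊓ (borel n F).comap (MulAut.conj (permGL σ)⁻¹).toMonoidHom

lemma mem_unitriStab {σ : Equiv.Perm (Fin n)} {g : GL (Fin n) F} :
    g ∈ unitriStab F σ ↔ g ∈ unitri n F ∧ (permGL σ)⁻¹ * g * permGL σ ∈ borel n F := by
  simp [unitriStab, Subgroup.mem_inf]

lemma mem_unitriStab_iff {σ : Equiv.Perm (Fin n)} {g : GL (Fin n) F} :
    g ∈ unitriStab F σ ↔
      g ∈ unitri n F ∧ ∀ i j, i < j → σ⁻¹ j < σ⁻¹ i → g.val i j = 0 := by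
  rw [mem_unitriStab, mem_borel]
  refine and_congr_right fun hg ↦ ⟨fun h i j _ hij ↦ ?_, fun h i j hij ↦ ?_⟩
  · have := h _ _ hij
    rw [permGL_inv_mul_apply] at this
    simpa using this
  · rw [permGL_inv_mul_apply]
    rcases lt_or_gt_of_ne (σ.injective.ne hij.ne) with h1 | h1
    · exact mem_borel.1 hg.1 _ _ h1
    · exact h _ _ h1 (by simpa using hij)

variable (n F) in
lemma card_unitriangular_pattern (S : Finset (Fin n × Fin n)) (hS : ∀ p ∈ S, p.1 < p.2) :
    Nat.card {g : GL (Fin n) F // g ∈ unitri n F ∧ ∀ i j, i < j → (i, j) ∉ S → g.val i j = 0} =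
      Nat.card F ^ S.card := by
  classical
  let M : (S → F) → Matrix (Fin n) (Fin n) F := fun f ↦ Matrix.of fun i j ↦
    if i = j then 1 else if h : (i, j) ∈ S then f ⟨(i, j), h⟩ else 0
  have hup : ∀ f, (M f).IsUpperTriangular := fun f i j hij ↦ by
    have h2 : (i, j) ∉ S := fun h ↦ absurd (hS _ h) (not_lt.2 (le_of_lt hij))
    have h1 : i ≠ j := (ne_of_lt hij).symm
    simp [M, h1, h2]
  have hdet : ∀ f, (M f).det ≠ 0 := fun f ↦ by
    rw [Matrix.det_of_isUpperTriangular (hup f)]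
    simp [M]
  have key : Nat.card {g : GL (Fin n) F // g ∈ unitri n F ∧
      ∀ i j, i < j → (i, j) ∉ S → g.val i j = 0} = Nat.card (S → F) := by
    refine Nat.card_congr
      { toFun := fun g p ↦ g.1.val p.1.1 p.1.2
        invFun := fun f ↦ ⟨Matrix.GeneralLinearGroup.mkOfDetNeZero (M f) (hdet f),
          ⟨mem_borel.2 fun i j hij ↦ hup f hij, fun i ↦ ?_⟩, fun i j hij h ↦ ?_⟩
        left_inv := fun g ↦ ?_
        right_inv := fun f ↦ ?_ }
    · change M f i i = 1
      simp [M]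
    · change M f i j = 0
      simp [M, hij.ne, h]
    · refine Subtype.ext (Units.ext (Matrix.ext fun i j ↦ ?_))
      change M (fun p ↦ g.1.val p.1.1 p.1.2) i j = g.1.val i j
      obtain ⟨g, hg, hg'⟩ := g
      simp only [M, Matrix.of_apply]
      split_ifs with h1 h2
      · rw [h1, hg.2]
      · rfl
      · rcases lt_or_gt_of_ne h1 with h3 | h3
        · exact (hg' i j h3 h2).symm
        · exact (mem_borel.1 hg.1 i j h3).symm
    · ext ⟨⟨i, j⟩, h⟩
      change M f i j = _
      simp [M, (hS _ h).ne, h]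
  rw [key, Nat.card_fun, Nat.card_eq_fintype_card (α := S), Fintype.card_coe]

lemma card_unitriStab (σ : Equiv.Perm (Fin n)) :
    Nat.card (unitriStab F σ) = Nat.card F ^ coinv σ⁻¹ := by
  classical
  rw [coinv, ← card_unitriangular_pattern n F _ (by simp +contextual)]
  refine Nat.card_congr (Equiv.subtypeEquivRight fun g ↦ ?_)
  rw [mem_unitriStab_iff]
  refine and_congr_right fun _ ↦ forall₂_congr fun i j ↦ forall_congr' fun hij ↦ ?_
  have hne : σ⁻¹ i ≠ σ⁻¹ j := σ⁻¹.injective.ne hij.ne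
  have : (i, j) ∉ Finset.univ.filter (fun p : Fin n × Fin n ↦
      p.1 < p.2 ∧ σ⁻¹ p.1 < σ⁻¹ p.2) ↔ σ⁻¹ j < σ⁻¹ i := by
    simp only [Finset.mem_filter, Finset.mem_univ, true_and, hij, not_lt]
    exact ⟨fun h ↦ lt_of_le_of_ne h hne.symm, le_of_lt⟩
  rw [this]

lemma unitriStab_one : unitriStab F (1 : Equiv.Perm (Fin n)) = unitri n F := by
  ext g
  rw [mem_unitriStab]
  simp only [map_one, inv_one, one_mul, mul_one, and_iff_left_iff_imp]
  exact fun h ↦ h.1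

lemma card_unitri : Nat.card (unitri n F) = Nat.card F ^ coinv (1 : Equiv.Perm (Fin n)) := by
  rw [← unitriStab_one, card_unitriStab, inv_one]

/-- An upper triangular matrix is the product of a unitriangular one and a diagonal one. -/
lemma exists_unitri_mul_diagonal {g : GL (Fin n) F} (hg : g ∈ borel n F) :
    ∃ u ∈ unitri n F, ∃ t : GL (Fin n) F, (∀ i j, i ≠ j → t.val i j = 0) ∧ g = u * t := by
  have hd : (Matrix.diagonal fun i ↦ g.val i i).det ≠ 0 := by
    rw [Matrix.det_diagonal, Finset.prod_ne_zero_iff]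
    exact fun i _ ↦ borel_apply_self_ne_zero hg i
  set t := Matrix.GeneralLinearGroup.mkOfDetNeZero _ hd with ht
  have htd : ∀ i j, i ≠ j → t.val i j = 0 := fun i j hij ↦ Matrix.diagonal_apply_ne _ hij
  have htB : t ∈ borel n F := mem_borel.2 fun i j hij ↦ htd i j hij.ne'
  have htt : ∀ i, t.val i i = g.val i i := fun i ↦ Matrix.diagonal_apply_eq _ i
  refine ⟨g * t⁻¹, ⟨mul_mem hg (inv_mem htB), fun i ↦ ?_⟩, t, htd, by group⟩
  have h1 := borel_mul_apply_self (mul_mem hg (inv_mem htB)) htB i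
  rw [inv_mul_cancel_right, htt] at h1
  exact mul_right_cancel₀ (borel_apply_self_ne_zero hg i) (by rw [← h1, one_mul])

lemma diagonal_conj_mem_borel {t : GL (Fin n) F} (ht : ∀ i j, i ≠ j → t.val i j = 0)
    (σ : Equiv.Perm (Fin n)) : (permGL σ)⁻¹ * t * permGL σ ∈ borel n F :=
  mem_borel.2 fun i j hij ↦ by
    rw [permGL_inv_mul_apply]
    exact ht _ _ (σ.injective.ne hij.ne')

lemma exists_bruhat_unitri (g : GL (Fin n) F) : ∃ u ∈ unitri n F, ∃ σ, ∃ b ∈ borel n F,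
    g = u * permGL σ * b := by
  obtain ⟨c, hc, σ, b, hb, rfl⟩ := exists_bruhat g
  obtain ⟨u, hu, t, ht, rfl⟩ := exists_unitri_mul_diagonal hc
  exact ⟨u, hu, σ, _, mul_mem (diagonal_conj_mem_borel ht σ) hb, by group⟩

/-- The Bruhat cell of a permutation. -/
def bruhatCell (F : Type*) [Field F] (σ : Equiv.Perm (Fin n)) : Set (GL (Fin n) F) :=
  {g | ∃ u ∈ unitri n F, ∃ b ∈ borel n F, g = u * permGL σ * b}

lemma bruhatCell_unique {σ τ : Equiv.Perm (Fin n)} {g : GL (Fin n) F}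
    (hσ : g ∈ bruhatCell F σ) (hτ : g ∈ bruhatCell F τ) : σ = τ := by
  obtain ⟨u, hu, b, hb, rfl⟩ := hσ
  obtain ⟨v, hv, c, hc, h⟩ := hτ
  refine perm_eq_of_inv_mul_mem_borel (g := v⁻¹ * u) (mul_mem (inv_mem hv.1) hu.1) ?_
  have : (permGL τ)⁻¹ * (v⁻¹ * u) * permGL σ = c * b⁻¹ := by
    have h2 : v⁻¹ * (u * permGL σ * b) * b⁻¹ = v⁻¹ * (v * permGL τ * c) * b⁻¹ := by rw [h]
    have h3 : v⁻¹ * u * permGL σ = permGL τ * c * b⁻¹ := by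
      simpa [mul_assoc] using h2
    rw [mul_assoc, h3]; group
  rw [this]
  exact mul_mem hc (inv_mem hb)

/-- The product map from `U × B` onto the cell has as fibres the orbits of `unitriStab F σ`, where
`v` sends `(u, b)` to `(u v, (σ⁻¹ v σ)⁻¹ b)`. The section `s` makes this a bijection. -/
lemma card_bruhatCell_mul [Finite F] (σ : Equiv.Perm (Fin n)) :
    Nat.card (bruhatCell F σ) * Nat.card (unitriStab F σ) =
      Nat.card (unitri n F) * Nat.card (borel n F) := by
  have hle : unitriStab F σ ≤ unitri n F := fun _ h ↦ (mem_unitriStab.1 h).1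
  have hc : ∀ g : bruhatCell F σ, ∃ p : unitri n F × borel n F,
      g.1 = p.1.1 * permGL σ * p.2.1 := fun ⟨g, u, hu, b, hb, h⟩ ↦ ⟨(⟨u, hu⟩, ⟨b, hb⟩), h⟩
  choose s hs using hc
  rw [← Nat.card_prod, ← Nat.card_prod]
  refine Nat.card_congr (Equiv.ofBijective
    (fun p : bruhatCell F σ × unitriStab F σ ↦
      (((s p.1).1 * ⟨p.2.1, hle p.2.2⟩ : unitri n F),
        ((⟨_, (mem_unitriStab.1 p.2.2).2⟩ : borel n F)⁻¹ * (s p.1).2 : borel n F))) ⟨?_, ?_⟩)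
  · rintro ⟨g, v⟩ ⟨g', v'⟩ h
    simp only [Prod.mk.injEq, Subtype.ext_iff, Subgroup.coe_mul, Subgroup.coe_inv] at h
    have hg : g = g' := by
      apply Subtype.ext
      rw [hs g, hs g']
      have e1 : ∀ (g : bruhatCell F σ) (v : unitriStab F σ), (s g).1.1 * permGL σ * (s g).2.1 =
        ((s g).1.1 * v.1) * permGL σ *
          (((permGL σ)⁻¹ * v.1 * permGL σ)⁻¹ * (s g).2.1) := fun g v ↦ by group
      rw [e1 g v, e1 g' v', h.1, h.2]
    subst hg
    have := mul_left_cancel h.1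
    rw [Subtype.ext this]
  · rintro ⟨u, b⟩
    let g : bruhatCell F σ := ⟨u.1 * permGL σ * b.1, u.1, u.2, b.1, b.2, rfl⟩
    have hg : u.1 * permGL σ * b.1 = (s g).1.1 * permGL σ * (s g).2.1 := hs g
    have hv : (permGL σ)⁻¹ * ((s g).1.1⁻¹ * u.1) * permGL σ = (s g).2.1 * b.1⁻¹ := by
      rw [mul_assoc, inv_mul_eq_iff_eq_mul, mul_assoc, inv_mul_eq_iff_eq_mul,
        ← mul_assoc, ← mul_assoc, ← hg, mul_inv_cancel_right]
    refine ⟨(g, ⟨(s g).1.1⁻¹ * u.1, mem_unitriStab.2 ⟨mul_mem (inv_mem (s g).1.2) u.2, ?_⟩⟩), ?_⟩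
    · rw [hv]; exact mul_mem (s g).2.2 (inv_mem b.2)
    · simp only [Prod.mk.injEq, Subtype.ext_iff, Subgroup.coe_mul, Subgroup.coe_inv]
      refine ⟨by group, ?_⟩
      rw [hv]; group

lemma card_bruhatCell [Finite F] (σ : Equiv.Perm (Fin n)) :
    Nat.card (bruhatCell F σ) = Nat.card F ^ invNumber σ⁻¹ * Nat.card (borel n F) := by
  have h := card_bruhatCell_mul (F := F) σ
  have hq : 0 < Nat.card F := Nat.card_pos
  rw [card_unitri, card_unitriStab, ← coinv_add_invNumber σ⁻¹, pow_add] at h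
  have : 0 < Nat.card F ^ coinv σ⁻¹ := by positivity
  refine Nat.eq_of_mul_eq_mul_right this ?_
  rw [h]; ring

lemma permGL_mem_blockUpper {b : Fin n → ℕ} {σ : Equiv.Perm (Fin n)} :
    (permGL σ : GL (Fin n) F) ∈ blockUpper b ↔ BlockPres b σ := by
  rw [mem_blockUpper]
  constructor
  · intro h
    have h1 : ∀ j, b (σ j) ≤ b j := fun j ↦ by
      by_contra h2
      have := h (σ j) j (not_le.1 h2)
      rw [permGL_apply, if_pos rfl] at this
      exact one_ne_zero this
    -- The labels can only decrease under `σ`, but their sum is unchanged, so each label is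
    -- preserved.
    have h2 : ∑ j, b (σ j) = ∑ j, b j := Equiv.sum_comp σ b
    exact fun j ↦ (Finset.sum_eq_sum_iff_of_le fun i _ ↦ h1 i).1 h2 j (Finset.mem_univ _)
  · intro h i j hij
    rw [permGL_apply, if_neg]
    rintro rfl
    rw [h] at hij
    exact lt_irrefl _ hij

lemma mem_blockUpper_of_mem_bruhatCell {b : Fin n → ℕ} (hb : Monotone b) {σ : Equiv.Perm (Fin n)}
    {g : GL (Fin n) F} (hg : g ∈ bruhatCell F σ) : g ∈ blockUpper b ↔ BlockPres b σ := by
  obtain ⟨u, hu, c, hc, rfl⟩ := hg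
  rw [Subgroup.mul_mem_cancel_right _ (borel_le_blockUpper hb hc),
    Subgroup.mul_mem_cancel_left _ (borel_le_blockUpper hb hu.1), permGL_mem_blockUpper]

open Classical in
lemma card_blockUpper [Finite F] {b : Fin n → ℕ} (hb : Monotone b) :
    Nat.card (blockUpper b : Subgroup (GL (Fin n) F)) =
      (∑ x ∈ Finset.univ.filter (BlockPres b), Nat.card F ^ invNumber x) *
        Nat.card (borel n F) := by
  have e : (blockUpper b : Subgroup (GL (Fin n) F)) ≃
      Σ x : {x : Equiv.Perm (Fin n) // BlockPres b x}, bruhatCell F x.1 := by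
    refine (Equiv.ofBijective (fun p : Σ x : {x : Equiv.Perm (Fin n) // BlockPres b x},
      bruhatCell F x.1 ↦ (⟨p.2.1, (mem_blockUpper_of_mem_bruhatCell hb p.2.2).2 p.1.2⟩ :
        (blockUpper b : Subgroup (GL (Fin n) F)))) ⟨?_, ?_⟩).symm
    · rintro ⟨⟨x, hx⟩, g, hg⟩ ⟨⟨x', hx'⟩, g', hg'⟩ h
      simp only [Subtype.mk.injEq] at h
      subst h
      obtain rfl := bruhatCell_unique hg hg'
      rfl
    · rintro ⟨g, hg⟩
      obtain ⟨u, hu, σ, c, hc, h⟩ := exists_bruhat_unitri g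
      have hgc : g ∈ bruhatCell F σ := ⟨u, hu, c, hc, h⟩
      exact ⟨⟨⟨σ, (mem_blockUpper_of_mem_bruhatCell hb hgc).1 hg⟩, g, hgc⟩, rfl⟩
  rw [Nat.card_congr e, Nat.card_sigma, Finset.sum_mul]
  simp only [card_bruhatCell]
  rw [← Finset.sum_subtype (p := BlockPres b) (Finset.univ.filter (BlockPres b)) (by simp)
    (fun x ↦ Nat.card F ^ invNumber x⁻¹ * Nat.card (borel n F))]
  refine Finset.sum_bij' (fun x _ ↦ x⁻¹) (fun x _ ↦ x⁻¹) ?_ ?_ ?_ ?_ ?_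
  · simp only [Finset.mem_filter, Finset.mem_univ, true_and]; exact fun _ h ↦ h.inv
  · simp only [Finset.mem_filter, Finset.mem_univ, true_and]; exact fun _ h ↦ h.inv
  · simp
  · simp
  · simp

open Classical in
-- The cell count is applied to the parabolic and to `G` itself, which is the case of a constant
-- labelling; the Poincaré factorisation gives the quotient.
theorem sum_coinv_eq_index [Finite F] {b : Fin n → ℕ} (hb : Monotone b) :
    ∑ ρ ∈ Finset.univ.filter (BlockAnti b), Nat.card F ^ coinv ρ =
      (blockUpper b : Subgroup (GL (Fin n) F)).index := by
  have h0 : (blockUpper (fun _ ↦ 0 : Fin n → ℕ) : Subgroup (GL (Fin n) F)) = ⊤ := by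
    rw [eq_top_iff]
    exact fun g _ ↦ mem_blockUpper.2 fun i j h ↦ absurd h (lt_irrefl _)
  have h1 := card_blockUpper (F := F) (n := n) (b := fun _ ↦ 0) monotone_const
  rw [h0, Subgroup.card_top, Finset.filter_true_of_mem (fun _ _ _ ↦ rfl),
    ← sum_coinv_mul_sum_invNumber hb, mul_assoc, ← card_blockUpper hb] at h1
  have h2 := Subgroup.index_mul_card (blockUpper b : Subgroup (GL (Fin n) F))
  rw [h1] at h2
  exact (Nat.eq_of_mul_eq_mul_right Nat.card_pos h2).symm

end Counting

/-! ### Linear characters of the unitriangular group -/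

section SuperSum

variable {n : ℕ} {F : Type*} [Field F]

/-- The sum of the entries `(i, i + 1)` with `b i = b (i + 1)`. -/
def superSum (b : Fin n → ℕ) (g : GL (Fin n) F) : F :=
  ∑ i : Fin n, ∑ j : Fin n, if (j : ℕ) = i + 1 ∧ b i = b j then g.val i j else 0

lemma superSum_mul (b : Fin n → ℕ) {g h : GL (Fin n) F} (hg : g ∈ unitri n F)
    (hh : h ∈ unitri n F) : superSum b (g * h) = superSum b g + superSum b h := by
  simp only [superSum, ← Finset.sum_add_distrib]
  refine Finset.sum_congr rfl fun i _ ↦ Finset.sum_congr rfl fun j _ ↦ ?_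
  split_ifs with hij
  · rw [borel_mul_apply_succ hg.1 hh.1 hij.1, hg.2, hh.2]; ring
  · simp

lemma superSum_one (b : Fin n → ℕ) : superSum b (1 : GL (Fin n) F) = 0 := by
  have := superSum_mul b (one_mem (unitri n F)) (one_mem (unitri n F))
  simpa using this

lemma superSum_inv (b : Fin n → ℕ) {g : GL (Fin n) F} (hg : g ∈ unitri n F) :
    superSum b g⁻¹ = -superSum b g := by
  have := superSum_mul b hg (inv_mem hg)
  rw [mul_inv_cancel, superSum_one] at this
  exact (neg_eq_of_add_eq_zero_right this.symm).symm

lemma superSum_elemGL (b : Fin n → ℕ) {i j : Fin n} (hij : (j : ℕ) = i + 1) (hne : i ≠ j)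
    (hb : b i = b j) (t : F) : superSum b (elemGL i j hne t) = t := by
  simp only [superSum, elemGL_apply]
  rw [Finset.sum_eq_single i, Finset.sum_eq_single j]
  · simp [hij, hb, hne]
  · intro l _ hl
    rw [if_neg]
    rintro ⟨h, _⟩
    exact hl (Fin.ext (by omega))
  · simp
  · intro k _ hk
    refine Finset.sum_eq_zero fun l _ ↦ ?_
    split_ifs with h h1 h2 h2
    · subst h1; omega
    · subst h1; omega
    · exact absurd h2.1 hk
    · simp
    · rfl
  · simp

end SuperSum

/-! ### Left translation and the form on the group algebra -/

section Translate

variable {n : ℕ} {F R : Type*} [Field F] [CommRing R]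

/-- Left translation by a group element in the group algebra. -/
def translate (g : GL (Fin n) F) :
    MonoidAlgebra R (GL (Fin n) F) →ₗ[R] MonoidAlgebra R (GL (Fin n) F) :=
  LinearMap.mulLeft R (MonoidAlgebra.single g 1)

lemma translate_apply (g : GL (Fin n) F) (x : MonoidAlgebra R (GL (Fin n) F)) :
    translate g x = MonoidAlgebra.single g 1 * x := rfl

lemma translate_one (x : MonoidAlgebra R (GL (Fin n) F)) : translate 1 x = x := by
  rw [translate_apply, ← MonoidAlgebra.one_def, one_mul]

lemma translate_mul (g h : GL (Fin n) F) (x : MonoidAlgebra R (GL (Fin n) F)) :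
    translate (g * h) x = translate g (translate h x) := by
  rw [translate_apply, translate_apply, translate_apply, ← mul_assoc,
    MonoidAlgebra.single_mul_single, one_mul]

lemma coeff_translate (g h : GL (Fin n) F) (x : MonoidAlgebra R (GL (Fin n) F)) :
    (translate g x).coeff h = x.coeff (g⁻¹ * h) := by
  rw [translate_apply, MonoidAlgebra.coeff_single_mul_apply, one_mul]

lemma translate_mem (N : Submodule (MonoidAlgebra R (GL (Fin n) F))
    (MonoidAlgebra R (GL (Fin n) F))) (g : GL (Fin n) F) {x : MonoidAlgebra R (GL (Fin n) F)}
    (hx : x ∈ N) : translate g x ∈ N := N.smul_mem _ hx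

lemma groupForm_eq_sum {G : Type*} [Fintype G] (x y : MonoidAlgebra R G) :
    groupForm x y = ∑ g, x.coeff g * y.coeff g := by
  unfold groupForm
  rw [Finsupp.sum_fintype]
  simp

lemma groupForm_comm {G : Type*} [Finite G] (x y : MonoidAlgebra R G) :
    groupForm x y = groupForm y x := by
  have := Fintype.ofFinite G
  simp only [groupForm_eq_sum, mul_comm]

lemma groupForm_smul_left {G : Type*} [Finite G] (r : R) (x y : MonoidAlgebra R G) :
    groupForm (r • x) y = r * groupForm x y := by
  have := Fintype.ofFinite G
  simp only [groupForm_eq_sum, Finset.mul_sum, MonoidAlgebra.coeff_smul_apply, smul_eq_mul,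
    mul_assoc]

lemma groupForm_smul_right {G : Type*} [Finite G] (r : R) (x y : MonoidAlgebra R G) :
    groupForm x (r • y) = r * groupForm x y := by
  rw [groupForm_comm, groupForm_smul_left, groupForm_comm]

lemma groupForm_sum_left {G ι : Type*} (s : Finset ι) (x : ι → MonoidAlgebra R G)
    (y : MonoidAlgebra R G) : groupForm (∑ i ∈ s, x i) y = ∑ i ∈ s, groupForm (x i) y := by
  classical
  induction s using Finset.induction_on with
  | empty => simp [groupForm_zero_left]
  | insert a s ha ih => rw [Finset.sum_insert ha, Finset.sum_insert ha, groupForm_add_left, ih]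

lemma groupForm_sum_right {G ι : Type*} [Finite G] (s : Finset ι) (x : ι → MonoidAlgebra R G)
    (y : MonoidAlgebra R G) : groupForm y (∑ i ∈ s, x i) = ∑ i ∈ s, groupForm y (x i) := by
  rw [groupForm_comm, groupForm_sum_left]
  exact Finset.sum_congr rfl fun i _ ↦ groupForm_comm _ _

lemma groupForm_translate_left (g : GL (Fin n) F) (x y : MonoidAlgebra R (GL (Fin n) F)) :
    groupForm (translate g x) y = groupForm x (translate g⁻¹ y) := by
  rw [translate_apply, groupForm_single_mul, one_mul, translate_apply]

end Translate

/-! ### The Steinberg element and the span of its unitriangular translates -/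

section SteinbergElement

variable {n : ℕ} {F R : Type*} [Field F] [CommRing R] [Finite F]

instance unitriFintype : Fintype (unitri n F) := Fintype.ofFinite _

variable (R) in
/-- The sum in the group algebra of the elements of the coset `g B`. -/
def chamber (g : GL (Fin n) F) : MonoidAlgebra R (GL (Fin n) F) :=
  translate g (hatSum (borel n F : Set (GL (Fin n) F)))

open Classical in
lemma coeff_chamber (g h : GL (Fin n) F) :
    (chamber R g).coeff h = if g⁻¹ * h ∈ borel n F then 1 else 0 := by
  rw [chamber, coeff_translate, hatSum, MonoidAlgebra.coeff_sum, Finsupp.finsetSum_apply]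
  simp [MonoidAlgebra.coeff_single, Finsupp.single_apply]

lemma chamber_mul {g b : GL (Fin n) F} (hb : b ∈ borel n F) :
    chamber R (g * b) = chamber R g := by
  classical
  apply MonoidAlgebra.coeff_injective
  ext h
  rw [coeff_chamber, coeff_chamber, _root_.mul_inv_rev, mul_assoc,
    Subgroup.mul_mem_cancel_left _ (inv_mem hb)]

lemma translate_chamber (g h : GL (Fin n) F) :
    translate g (chamber R h) = chamber R (g * h) := by
  rw [chamber, chamber, translate_mul]

lemma steinbergElement_eq : steinbergElement n F R =
    ∑ σ : Equiv.Perm (Fin n), ((Equiv.Perm.sign σ : ℤ) : R) • chamber R (permGL σ) := by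
  refine Finset.sum_congr rfl fun σ _ ↦ ?_
  rw [chamber, translate_apply, ← smul_mul_assoc, MonoidAlgebra.smul_single, smul_eq_mul, mul_one]

lemma sign_mul_sign_self (σ : Equiv.Perm (Fin n)) :
    ((Equiv.Perm.sign σ : ℤ) : R) * ((Equiv.Perm.sign σ : ℤ) : R) = 1 := by
  rcases Int.units_eq_one_or (Equiv.Perm.sign σ) with h | h <;> simp [h]

lemma translate_permGL_steinbergElement (σ : Equiv.Perm (Fin n)) :
    translate (permGL σ) (steinbergElement n F R) =
      ((Equiv.Perm.sign σ : ℤ) : R) • steinbergElement n F R := by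
  rw [steinbergElement_eq, map_sum, Finset.smul_sum]
  refine Fintype.sum_equiv (Equiv.mulLeft σ) _ _ fun τ ↦ ?_
  rw [map_smul, translate_chamber, ← map_mul, smul_smul, Equiv.coe_mulLeft, Equiv.Perm.sign_mul]
  congr 1
  push_cast
  rw [← mul_assoc, sign_mul_sign_self, one_mul]

lemma translate_diagonal_steinbergElement {t : GL (Fin n) F}
    (ht : ∀ i j, i ≠ j → t.val i j = 0) :
    translate t (steinbergElement n F R) = steinbergElement n F R := by
  rw [steinbergElement_eq, map_sum]
  refine Finset.sum_congr rfl fun σ _ ↦ ?_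
  rw [map_smul, translate_chamber]
  congr 1
  rw [← chamber_mul (diagonal_conj_mem_borel ht σ) (g := permGL σ)]
  congr 1
  group

lemma chamber_swap_mul_elemGL {i j : Fin n} (hne : i ≠ j) (t : F) {σ : Equiv.Perm (Fin n)}
    (h : σ⁻¹ i < σ⁻¹ j) (g : GL (Fin n) F) :
    chamber R (g * elemGL i j hne t * permGL σ) = chamber R (g * permGL σ) := by
  rw [← chamber_mul (inv_mul_elemGL_mul_mem_borel hne t h) (g := g * permGL σ)]
  congr 1
  group

/-- In the alternating sum the terms of `σ` and `s σ` are paired. One of the two permutations has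
`σ⁻¹ i < σ⁻¹ j`, where root elements are absorbed into `B`; for the other the rank-one identity
applies. The remaining terms cancel by sign. -/
lemma translate_swap_elemGL_steinbergElement {i j : Fin n} (hne : i ≠ j) {t : F} (ht : t ≠ 0) :
    translate (permGL (Equiv.swap i j) * elemGL i j hne t) (steinbergElement n F R) =
      translate (elemGL i j hne t⁻¹) (steinbergElement n F R) - steinbergElement n F R := by
  rw [eq_sub_iff_add_eq, ← sub_eq_zero, steinbergElement_eq, map_sum, map_sum,
    ← Finset.sum_add_distrib, ← Finset.sum_sub_distrib]
  set s : Equiv.Perm (Fin n) := Equiv.swap i j with hs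
  set f : Equiv.Perm (Fin n) → MonoidAlgebra R (GL (Fin n) F) := fun σ ↦
    (translate (permGL s * elemGL i j hne t))
        (((Equiv.Perm.sign σ : ℤ) : R) • chamber R (permGL σ)) +
      ((Equiv.Perm.sign σ : ℤ) : R) • chamber R (permGL σ) -
      (translate (elemGL i j hne t⁻¹)) (((Equiv.Perm.sign σ : ℤ) : R) • chamber R (permGL σ))
    with hf
  have hpos : ∀ σ : Equiv.Perm (Fin n), σ⁻¹ i < σ⁻¹ j →
      f σ = ((Equiv.Perm.sign σ : ℤ) : R) • chamber R (permGL (s * σ)) := fun σ h ↦ by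
    simp only [hf, map_smul, translate_chamber]
    have e1 := chamber_swap_mul_elemGL (R := R) hne t h (permGL s)
    have e2 := chamber_swap_mul_elemGL (R := R) hne t⁻¹ h 1
    rw [one_mul, one_mul] at e2
    rw [e1, e2, add_sub_cancel_right, map_mul]
  have hneg : ∀ σ : Equiv.Perm (Fin n), σ⁻¹ j < σ⁻¹ i →
      f σ = ((Equiv.Perm.sign σ : ℤ) : R) • chamber R (permGL σ) := fun σ h ↦ by
    obtain ⟨b, hb, h1⟩ := swap_mul_elemGL_mul hne ht h
    simp only [hf, map_smul, translate_chamber]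
    rw [hs, h1, chamber_mul hb, add_sub_cancel_left]
  have hflip : ∀ σ : Equiv.Perm (Fin n), (s * σ)⁻¹ i = σ⁻¹ j ∧ (s * σ)⁻¹ j = σ⁻¹ i := fun σ ↦ by
    simp [hs, Equiv.Perm.mul_apply]
  have hsum : ∀ σ : Equiv.Perm (Fin n), σ⁻¹ i < σ⁻¹ j → f σ + f (s * σ) = 0 := fun σ h ↦ by
    rw [hpos σ h, hneg (s * σ) (by rw [(hflip σ).1, (hflip σ).2]; exact h), ← add_smul,
      Equiv.Perm.sign_mul, hs, Equiv.Perm.sign_swap hne]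
    simp
  have hss : ∀ σ, s * (s * σ) = σ := fun σ ↦ by
    rw [← mul_assoc, hs, Equiv.swap_mul_self, one_mul]
  refine Finset.sum_involution (fun σ _ ↦ s * σ) ?_ ?_ (fun _ _ ↦ Finset.mem_univ _) ?_
  · intro σ _
    rcases lt_or_gt_of_ne (σ⁻¹.injective.ne hne) with h | h
    · exact hsum σ h
    · have := hsum (s * σ) (by rw [(hflip σ).1, (hflip σ).2]; exact h)
      rwa [hss, add_comm] at this
  · intro σ _ _ h
    have : s = 1 := by simpa using h
    rw [hs, Equiv.swap_eq_one_iff] at this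
    exact hne this
  · intro σ _
    exact hss σ

lemma translate_borel_steinbergElement {b : GL (Fin n) F} (hb : b ∈ borel n F) :
    ∃ u ∈ unitri n F, translate b (steinbergElement n F R) =
      translate u (steinbergElement n F R) := by
  obtain ⟨u, hu, t, ht, rfl⟩ := exists_unitri_mul_diagonal hb
  exact ⟨u, hu, by rw [translate_mul, translate_diagonal_steinbergElement ht]⟩

/-- It suffices that the span of the `U`-translates is stable under `B` and the adjacent
transpositions. Diagonal matrices fix the Steinberg element, and for a transposition the simple root
factor is split off and the rank-one relation for the element is used. -/
lemma translate_steinbergElement_mem_span (g : GL (Fin n) F) :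
    translate g (steinbergElement n F R) ∈ Submodule.span R
      (Set.range fun u : unitri n F ↦ translate u.1 (steinbergElement n F R)) := by
  set W := Submodule.span R
    (Set.range fun u : unitri n F ↦ translate u.1 (steinbergElement n F R)) with hW
  have hu : ∀ u ∈ unitri n F, translate u (steinbergElement n F R) ∈ W := fun u hu ↦
    Submodule.subset_span ⟨⟨u, hu⟩, rfl⟩
  have hgen : ∀ g : GL (Fin n) F, (∀ u ∈ unitri n F,
      translate g (translate u (steinbergElement n F R)) ∈ W) → ∀ x ∈ W, translate g x ∈ W := by
    intro g hg x hx
    induction hx using Submodule.span_induction with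
    | mem x h => obtain ⟨u, rfl⟩ := h; exact hg _ u.2
    | zero => rw [map_zero]; exact zero_mem _
    | add x y _ _ hx hy => rw [map_add]; exact add_mem hx hy
    | smul r x _ hx => rw [map_smul]; exact Submodule.smul_mem _ _ hx
  let S : Submonoid (GL (Fin n) F) :=
    { carrier := {g | ∀ x ∈ W, translate g x ∈ W}
      one_mem' := fun x hx ↦ by rwa [translate_one]
      mul_mem' := fun {a b} ha hb x hx ↦ by rw [translate_mul]; exact ha _ (hb _ hx) }
  have hS := borel_swap_induction S ?_ ?_ g
  · have := hS _ (hu 1 (one_mem _))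
    rwa [translate_one] at this
  · intro b hb
    refine hgen b fun u hu' ↦ ?_
    rw [← translate_mul]
    obtain ⟨v, hv, h⟩ := translate_borel_steinbergElement (R := R) (mul_mem hb hu'.1)
    rw [h]
    exact hu v hv
  · intro i j hij
    have hne : i ≠ j := by rintro rfl; omega
    have hlt : i < j := by rw [Fin.lt_def]; omega
    refine hgen _ fun u hu' ↦ ?_
    obtain ⟨c, t, hc, h0, rfl, hcu⟩ := borel_eq_mul_elemGL hu'.1 hij hne
    have hcs := swap_conj_mem_unitri (hcu hu') hij h0
    set s : GL (Fin n) F := permGL (Equiv.swap i j) with hs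
    have hss : s * s = 1 := by rw [hs, ← map_mul, Equiv.swap_mul_self, map_one]
    have e1 : s * (c * elemGL i j hne t) = (s * c * s) * (s * elemGL i j hne t) := by
      simp only [mul_assoc]
      rw [← mul_assoc s s, hss, one_mul]
    rw [← translate_mul, e1, translate_mul]
    by_cases ht : t = 0
    · rw [ht, elemGL_zero, mul_one, hs, translate_permGL_steinbergElement, map_smul]
      exact Submodule.smul_mem _ _ (hu _ hcs)
    · rw [hs, translate_swap_elemGL_steinbergElement hne ht, map_sub, ← translate_mul]
      exact sub_mem (hu _ (mul_mem hcs (elemGL_mem_unitri hlt _))) (hu _ hcs)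

lemma lattice_le_span {x : MonoidAlgebra R (GL (Fin n) F)} (hx : x ∈ lattice n F R) :
    x ∈ Submodule.span R
      (Set.range fun u : unitri n F ↦ translate u.1 (steinbergElement n F R)) := by
  obtain ⟨a, rfl⟩ := Submodule.mem_span_singleton.1 hx
  induction a using MonoidAlgebra.induction_linear with
  | zero => rw [zero_smul]; exact zero_mem _
  | add a b ha hb =>
    rw [add_smul]
    exact add_mem (ha (Submodule.smul_mem _ _ (Submodule.mem_span_singleton_self _)))
      (hb (Submodule.smul_mem _ _ (Submodule.mem_span_singleton_self _)))
  | single g r =>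
    have : MonoidAlgebra.single g r • steinbergElement n F R =
        r • translate g (steinbergElement n F R) := by
      rw [translate_apply, ← smul_mul_assoc, MonoidAlgebra.smul_single, smul_eq_mul, smul_eq_mul,
        mul_one]
    rw [this]
    exact Submodule.smul_mem _ _ (translate_steinbergElement_mem_span g)

lemma coeff_mul_of_mem_lattice {x : MonoidAlgebra R (GL (Fin n) F)} (hx : x ∈ lattice n F R)
    (g : GL (Fin n) F) {b : GL (Fin n) F} (hb : b ∈ borel n F) :
    x.coeff (g * b) = x.coeff g := by
  classical
  replace hx := lattice_le_span hx
  induction hx using Submodule.span_induction with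
  | mem x h =>
    obtain ⟨u, rfl⟩ := h
    simp only
    rw [coeff_translate, coeff_translate, steinbergElement_eq]
    simp only [MonoidAlgebra.coeff_sum, Finsupp.finsetSum_apply, MonoidAlgebra.coeff_smul_apply,
      coeff_chamber]
    refine Finset.sum_congr rfl fun σ _ ↦ ?_
    rw [← mul_assoc, ← mul_assoc, ← mul_assoc, Subgroup.mul_mem_cancel_right _ hb]
  | zero => simp
  | add x y _ _ hx hy => simp [MonoidAlgebra.coeff_add, hx, hy]
  | smul r x _ hx => simp [hx]

/-- Elements of the lattice are constant on the cosets `g B`, so each chamber contributes `|B|`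
times a single coefficient. -/
lemma groupForm_steinbergElement {x : MonoidAlgebra R (GL (Fin n) F)} (hx : x ∈ lattice n F R) :
    groupForm x (steinbergElement n F R) = Nat.card (borel n F) *
      ∑ σ : Equiv.Perm (Fin n), ((Equiv.Perm.sign σ : ℤ) : R) * x.coeff (permGL σ) := by
  classical
  have := Fintype.ofFinite (GL (Fin n) F)
  rw [steinbergElement_eq, groupForm_sum_right, Finset.mul_sum]
  refine Finset.sum_congr rfl fun σ _ ↦ ?_
  rw [groupForm_smul_right, groupForm_eq_sum]
  simp only [coeff_chamber, mul_ite, mul_one, mul_zero]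
  rw [← Equiv.sum_comp (Equiv.mulLeft (permGL σ : GL (Fin n) F))]
  simp only [Equiv.coe_mulLeft, inv_mul_cancel_left]
  rw [← Finset.sum_filter, Finset.sum_congr rfl (g := fun _ ↦ x.coeff (permGL σ)), Finset.sum_const,
    nsmul_eq_mul]
  · rw [mul_left_comm]
    congr 3
    rw [Nat.card_eq_fintype_card, Fintype.card_subtype]
  · intro b hb
    exact coeff_mul_of_mem_lattice hx _ (Finset.mem_filter.1 hb).2

end SteinbergElement

/-! ### Eigenvectors of the linear characters of `U` and their pairing -/

section Whittaker

variable {n : ℕ} {F R : Type*} [Field F] [CommRing R] [Finite F]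

/-- The projection, up to the scalar `|U|`, to the eigenspace of a linear character of `U`. -/
def charProj (ψ : AddChar F R) (b : Fin n → ℕ) :
    MonoidAlgebra R (GL (Fin n) F) →ₗ[R] MonoidAlgebra R (GL (Fin n) F) :=
  ∑ u : unitri n F, ψ (-superSum b u.1) • translate u.1

lemma charProj_apply (ψ : AddChar F R) (b : Fin n → ℕ) (x : MonoidAlgebra R (GL (Fin n) F)) :
    charProj ψ b x = ∑ u : unitri n F, ψ (-superSum b u.1) • translate u.1 x := by
  simp [charProj]

lemma charProj_mem (N : Submodule (MonoidAlgebra R (GL (Fin n) F))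
    (MonoidAlgebra R (GL (Fin n) F))) (ψ : AddChar F R) (b : Fin n → ℕ)
    {x : MonoidAlgebra R (GL (Fin n) F)} (hx : x ∈ N) : charProj ψ b x ∈ N := by
  rw [charProj_apply]
  exact sum_mem fun u _ ↦ Submodule.smul_of_tower_mem _ _ (translate_mem N _ hx)

lemma charProj_translate (ψ : AddChar F R) (b : Fin n → ℕ) {v : GL (Fin n) F}
    (hv : v ∈ unitri n F) (x : MonoidAlgebra R (GL (Fin n) F)) :
    charProj ψ b (translate v x) = ψ (superSum b v) • charProj ψ b x := by
  rw [charProj_apply, charProj_apply, Finset.smul_sum]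
  refine Fintype.sum_equiv (Equiv.mulRight ⟨v, hv⟩) _ _ fun u ↦ ?_
  rw [Equiv.coe_mulRight, Subgroup.coe_mul, smul_smul, ← AddChar.map_add_eq_mul,
    superSum_mul b u.2 hv, translate_mul]
  congr 2
  ring

lemma translate_charProj (ψ : AddChar F R) (b : Fin n → ℕ) {v : GL (Fin n) F}
    (hv : v ∈ unitri n F) (x : MonoidAlgebra R (GL (Fin n) F)) :
    translate v (charProj ψ b x) = ψ (superSum b v) • charProj ψ b x := by
  rw [charProj_apply, map_sum, Finset.smul_sum]
  refine Fintype.sum_equiv (Equiv.mulLeft ⟨v, hv⟩) _ _ fun u ↦ ?_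
  rw [Equiv.coe_mulLeft, Subgroup.coe_mul, smul_smul, ← AddChar.map_add_eq_mul,
    superSum_mul b hv u.2, translate_mul, map_smul]
  congr 2
  ring

lemma charProj_charProj (ψ : AddChar F R) (b : Fin n → ℕ) (x : MonoidAlgebra R (GL (Fin n) F)) :
    charProj ψ b (charProj ψ b x) = (Nat.card (unitri n F) : R) • charProj ψ b x := by
  rw [charProj_apply]
  have : ∀ u : unitri n F, ψ (-superSum b u.1) • translate u.1 (charProj ψ b x) =
      charProj ψ b x := fun u ↦ by
    rw [translate_charProj ψ b u.2, smul_smul, ← AddChar.map_add_eq_mul, neg_add_cancel,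
      AddChar.map_zero_eq_one, one_smul]
  simp only [this, Finset.sum_const, Finset.card_univ, Nat.card_eq_fintype_card]
  rw [Nat.cast_smul_eq_nsmul]

lemma groupForm_charProj_left (ψ : AddChar F R) (b : Fin n → ℕ)
    (x y : MonoidAlgebra R (GL (Fin n) F)) :
    groupForm (charProj ψ b x) y = groupForm x (charProj ψ⁻¹ b y) := by
  rw [charProj_apply, charProj_apply, groupForm_sum_left, groupForm_sum_right]
  refine Fintype.sum_equiv (Equiv.inv (unitri n F)) _ _ fun u ↦ ?_
  rw [groupForm_smul_left, groupForm_smul_right, groupForm_translate_left, Equiv.inv_apply,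
    Subgroup.coe_inv, superSum_inv b u.2, AddChar.inv_apply, neg_neg]

/-- The eigenvector in the Steinberg lattice of a linear character of `U`. -/
def whittaker (ψ : AddChar F R) (b : Fin n → ℕ) : MonoidAlgebra R (GL (Fin n) F) :=
  charProj ψ b (steinbergElement n F R)

lemma whittaker_mem (ψ : AddChar F R) (b : Fin n → ℕ) : whittaker ψ b ∈ lattice n F R :=
  charProj_mem _ ψ b (Submodule.mem_span_singleton_self _)

/-- Multiplicity one: the lattice is spanned by `U`-translates of one vector, and `charProj` turns
such a translation into a scalar. -/
lemma exists_charProj_eq_smul (ψ : AddChar F R) (b : Fin n → ℕ)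
    {x : MonoidAlgebra R (GL (Fin n) F)} (hx : x ∈ lattice n F R) :
    ∃ r : R, charProj ψ b x = r • whittaker ψ b := by
  replace hx := lattice_le_span hx
  induction hx using Submodule.span_induction with
  | mem x h =>
    obtain ⟨u, rfl⟩ := h
    exact ⟨_, charProj_translate ψ b u.2 _⟩
  | zero => exact ⟨0, by simp⟩
  | add x y _ _ hx hy =>
    obtain ⟨r, hr⟩ := hx
    obtain ⟨s, hs⟩ := hy
    exact ⟨r + s, by rw [map_add, hr, hs, add_smul]⟩
  | smul r x _ hx =>
    obtain ⟨s, hs⟩ := hx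
    exact ⟨r * s, by rw [map_smul, hs, smul_smul]⟩

open Classical in
lemma coeff_steinbergElement_inv_mul {u : GL (Fin n) F} (hu : u ∈ unitri n F)
    (σ : Equiv.Perm (Fin n)) : (steinbergElement n F R).coeff (u⁻¹ * permGL σ) =
      if u ∈ unitriStab F σ then ((Equiv.Perm.sign σ : ℤ) : R) else 0 := by
  rw [steinbergElement_eq]
  simp only [MonoidAlgebra.coeff_sum, Finsupp.finsetSum_apply, MonoidAlgebra.coeff_smul_apply,
    coeff_chamber]
  rw [Finset.sum_eq_single σ]
  · have : u ∈ unitriStab F σ ↔ (permGL σ)⁻¹ * (u⁻¹ * permGL σ) ∈ borel n F := by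
      rw [mem_unitriStab, ← inv_mem_iff (x := (permGL σ)⁻¹ * (u⁻¹ * permGL σ))]
      simp only [hu, true_and, _root_.mul_inv_rev, inv_inv, mul_assoc]
    simp [this]
  · intro τ _ hτ
    rw [if_neg, smul_zero]
    rw [← mul_assoc]
    exact fun h ↦ hτ (perm_eq_of_inv_mul_mem_borel (inv_mem hu.1) h).symm
  · simp

open Classical in
lemma coeff_whittaker_permGL (ψ : AddChar F R) (b : Fin n → ℕ) (σ : Equiv.Perm (Fin n)) :
    (whittaker ψ b).coeff (permGL σ) = ((Equiv.Perm.sign σ : ℤ) : R) *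
      ∑ u : unitri n F, if u.1 ∈ unitriStab F σ then ψ (-superSum b u.1) else 0 := by
  rw [whittaker, charProj_apply]
  simp only [MonoidAlgebra.coeff_sum, Finsupp.finsetSum_apply, MonoidAlgebra.coeff_smul_apply,
    coeff_translate]
  rw [Finset.mul_sum]
  refine Finset.sum_congr rfl fun u _ ↦ ?_
  rw [coeff_steinbergElement_inv_mul u.2]
  split_ifs <;> simp [mul_comm]

/-- `σ⁻¹` reverses the order of neighbours in a block of `b`. -/
def GoodPerm (b : Fin n → ℕ) (σ : Equiv.Perm (Fin n)) : Prop :=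
  ∀ i j : Fin n, (j : ℕ) = i + 1 → b i = b j → σ⁻¹ j < σ⁻¹ i

lemma goodPerm_iff {b : Fin n → ℕ} (hb : Monotone b) {σ : Equiv.Perm (Fin n)} :
    GoodPerm b σ ↔ BlockAnti b σ⁻¹ := by
  constructor
  · intro h i
    have key : ∀ m : ℕ, ∀ j : Fin n, (j : ℕ) = i + m + 1 → b i = b j → σ⁻¹ j < σ⁻¹ i := by
      intro m
      induction m with
      | zero => exact fun j hj hij ↦ h i j hj hij
      | succ m ih =>
        intro j hj hij
        let k : Fin n := ⟨i + m + 1, by omega⟩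
        have hik : b i ≤ b k := hb (by rw [Fin.le_def]; simp only [k]; omega)
        have hkj : b k ≤ b j := hb (by rw [Fin.le_def]; simp only [k]; omega)
        exact (h k j (by simp only [k]; omega) (by omega)).trans (ih k rfl (by omega))
    intro j hij hbij
    rw [Fin.lt_def] at hij
    exact key (j - i - 1) j (by omega) hbij
  · intro h i j hij hb'
    exact h i j (by rw [Fin.lt_def]; omega) hb'

omit [Finite F] in
lemma superSum_eq_zero_of_goodPerm {b : Fin n → ℕ} {σ : Equiv.Perm (Fin n)} (h : GoodPerm b σ)
    {u : GL (Fin n) F} (hu : u ∈ unitriStab F σ) : superSum b u = 0 := by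
  refine Finset.sum_eq_zero fun i _ ↦ Finset.sum_eq_zero fun j _ ↦ ?_
  split_ifs with hij
  · exact (mem_unitriStab_iff.1 hu).2 i j (by rw [Fin.lt_def]; omega) (h i j hij.1 hij.2)
  · rfl

lemma coeff_whittaker_of_goodPerm (ψ : AddChar F R) {b : Fin n → ℕ} {σ : Equiv.Perm (Fin n)}
    (h : GoodPerm b σ) : (whittaker ψ b).coeff (permGL σ) =
      ((Equiv.Perm.sign σ : ℤ) : R) * (Nat.card F : R) ^ coinv σ⁻¹ := by
  classical
  have hle : unitriStab F σ ≤ unitri n F := fun _ h ↦ (mem_unitriStab.1 h).1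
  rw [coeff_whittaker_permGL, ← Nat.cast_pow, ← card_unitriStab, ← Finset.sum_filter,
    Finset.sum_congr rfl (g := fun _ ↦ 1), Finset.sum_const, nsmul_eq_mul, mul_one]
  · congr 2
    rw [← Nat.card_congr (Subgroup.subgroupOfEquivOfLe hle).toEquiv, Nat.card_eq_fintype_card,
      Fintype.card_subtype]
    rfl
  · intro u hu
    rw [superSum_eq_zero_of_goodPerm h (Finset.mem_filter.1 hu).2, neg_zero,
      AddChar.map_zero_eq_one]

/-- Some simple root subgroup on which the character is nontrivial lies in `unitriStab F σ`, so the
character sum over that group vanishes. -/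
lemma coeff_whittaker_of_not_goodPerm [IsDomain R] {ψ : AddChar F R} (hψ : ψ ≠ 1)
    {b : Fin n → ℕ} {σ : Equiv.Perm (Fin n)} (h : ¬ GoodPerm b σ) :
    (whittaker ψ b).coeff (permGL σ) = 0 := by
  classical
  unfold GoodPerm at h
  push Not at h
  obtain ⟨i, j, hij, hbij, hle⟩ := h
  have hne : i ≠ j := by rintro rfl; omega
  have hlt : i < j := by rw [Fin.lt_def]; omega
  obtain ⟨t, ht⟩ := AddChar.ne_one_iff.1 hψ
  rw [coeff_whittaker_permGL]
  refine mul_eq_zero_of_right _ ?_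
  have hx : elemGL i j hne (-t) ∈ unitriStab F σ := mem_unitriStab.2 ⟨elemGL_mem_unitri hlt _,
    inv_mul_elemGL_mul_mem_borel hne _ (lt_of_le_of_ne hle (σ⁻¹.injective.ne hne))⟩
  set x : unitri n F := ⟨elemGL i j hne (-t), elemGL_mem_unitri hlt _⟩ with hxd
  set S := ∑ u : unitri n F, if u.1 ∈ unitriStab F σ then ψ (-superSum b u.1) else 0 with hS
  have h1 : S = ψ t * S := by
    rw [hS, Finset.mul_sum, ← Equiv.sum_comp (Equiv.mulLeft x)]
    refine Finset.sum_congr rfl fun u _ ↦ ?_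
    rw [Equiv.coe_mulLeft, Subgroup.coe_mul, superSum_mul b x.2 u.2,
      Subgroup.mul_mem_cancel_left _ hx, hxd, superSum_elemGL b hij hne hbij, mul_ite, mul_zero,
      ← AddChar.map_add_eq_mul]
    congr 2
    ring
  have h2 : (ψ t - 1) * S = 0 := by rw [sub_mul, ← h1, one_mul, sub_self]
  exact (mul_eq_zero.1 h2).resolve_left (sub_ne_zero.2 ht)

/-- The surviving permutations are those whose inverse decreases on blocks. The two signs cancel,
and what remains is the sum of `q ^ coinv` that computes the index. -/
lemma groupForm_whittaker_steinbergElement [IsDomain R] {ψ : AddChar F R} (hψ : ψ ≠ 1)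
    {b : Fin n → ℕ} (hb : Monotone b) :
    groupForm (whittaker ψ b) (steinbergElement n F R) = Nat.card (borel n F) *
      ((blockUpper b : Subgroup (GL (Fin n) F)).index : R) := by
  classical
  rw [groupForm_steinbergElement (whittaker_mem ψ b), ← sum_coinv_eq_index hb]
  congr 1
  push_cast
  rw [Finset.sum_filter, ← Equiv.sum_comp (Equiv.inv (Equiv.Perm (Fin n)))]
  refine Finset.sum_congr rfl fun σ _ ↦ ?_
  split_ifs with h
  · rw [coeff_whittaker_of_goodPerm ψ ((goodPerm_iff hb).2 (by simpa using h)), ← mul_assoc,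
      sign_mul_sign_self, one_mul]
    simp
  · rw [coeff_whittaker_of_not_goodPerm hψ (fun h' ↦ h (by simpa using (goodPerm_iff hb).1 h')),
      mul_zero]

/-- Since `charProj` is `|U|` times a projection and its adjoint uses `ψ⁻¹`, pairing with `y` only
sees the multiple `r` in `charProj ψ⁻¹ b y`. -/
lemma groupForm_whittaker [IsDomain R] [CharZero R] {ψ : AddChar F R} (hψ : ψ ≠ 1)
    {b : Fin n → ℕ} (hb : Monotone b) {y : MonoidAlgebra R (GL (Fin n) F)} {r : R}
    (hr : charProj ψ⁻¹ b y = r • whittaker ψ⁻¹ b) :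
    groupForm (whittaker ψ b) y = r * (Nat.card (borel n F) *
      ((blockUpper b : Subgroup (GL (Fin n) F)).index : R)) := by
  have h0 : (Nat.card (unitri n F) : R) ≠ 0 := Nat.cast_ne_zero.2 Nat.card_pos.ne'
  apply mul_left_cancel₀ h0
  have h1 : ∀ z, (Nat.card (unitri n F) : R) * groupForm (whittaker ψ b) z =
      groupForm (whittaker ψ b) (charProj ψ⁻¹ b z) := fun z ↦ by
    rw [← groupForm_charProj_left, whittaker, charProj_charProj, groupForm_smul_left]
  rw [h1, hr, groupForm_smul_right, ← groupForm_whittaker_steinbergElement hψ hb, mul_left_comm,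
    h1]
  rfl

end Whittaker

/-! ### Comparison of the eigenvectors of two compositions -/

section BlockMove

variable {n : ℕ} {F R : Type*} [Field F] [CommRing R]

/-- `τ` translates the blocks of `b` into blocks of `a`, in such a way that neighbours in a block
of `a` come from neighbours in a block of `b` or from blocks of `b` in the reverse order. -/
structure BlockMove (b a : Fin n → ℕ) (τ : Equiv.Perm (Fin n)) : Prop where
  mono_left : Monotone b
  mono_right : Monotone a
  map_succ : ∀ p p' : Fin n, (p' : ℕ) = p + 1 → b p = b p' →
    (τ p' : ℕ) = τ p + 1 ∧ a (τ p) = a (τ p')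
  of_map_succ : ∀ p p' : Fin n, (τ p' : ℕ) = τ p + 1 → a (τ p) = a (τ p') →
    b p' < b p ∨ (p' : ℕ) = p + 1 ∧ b p = b p'

variable {b a : Fin n → ℕ} {τ : Equiv.Perm (Fin n)}

lemma BlockMove.lt (h : BlockMove b a τ) {p p' : Fin n} (hp : p < p') (hb : b p = b p') :
    τ p < τ p' := by
  -- Reversal turns increase at neighbours into the descent condition of `GoodPerm`, which is known
  -- to propagate to whole blocks.
  have h1 : GoodPerm b (Fin.revPerm * τ)⁻¹ := fun i j hij hbij ↦ by
    have := (h.map_succ i j hij hbij).1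
    simp only [inv_inv, Equiv.Perm.mul_apply, Fin.revPerm_apply, Fin.rev_lt_rev]
    rw [Fin.lt_def]
    omega
  have h2 := (goodPerm_iff h.mono_left).1 h1 p p' hp hb
  simpa only [inv_inv, Equiv.Perm.mul_apply, Fin.revPerm_apply, Fin.rev_lt_rev] using h2

/-- The block diagonal part of a unitriangular matrix. -/
lemma exists_blockDiagonal_part (hb : Monotone b) {w : GL (Fin n) F} (hw : w ∈ unitri n F) :
    ∃ m ∈ unitri n F, (∀ i j, m.val i j = if b i = b j then w.val i j else 0) ∧
      ∀ i j, i ≠ j → b j ≤ b i → (m⁻¹ * w).val i j = 0 := by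
  let D : Matrix (Fin n) (Fin n) F := Matrix.of fun i j ↦ if b i = b j then w.val i j else 0
  have hD : D.IsUpperTriangular := fun i j hij ↦ by
    have : w.val i j = 0 := mem_borel.1 hw.1 i j hij
    simp [D, this]
  have hdet : D.det ≠ 0 := by
    rw [Matrix.det_of_isUpperTriangular hD]
    simp [D, hw.2]
  set m := Matrix.GeneralLinearGroup.mkOfDetNeZero D hdet with hm
  have hme : ∀ i j, m.val i j = if b i = b j then w.val i j else 0 := fun i j ↦ rfl
  have hmU : m ∈ unitri n F := ⟨mem_borel.2 fun i j hij ↦ hD hij, fun i ↦ by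
    rw [hme, if_pos rfl, hw.2]⟩
  refine ⟨m, hmU, hme, fun i j hij hbij ↦ ?_⟩
  have hm1 : m ∈ (blockUpper b : Subgroup (GL (Fin n) F)) :=
    mem_blockUpper.2 fun i j h ↦ by rw [hme, if_neg h.ne']
  have hm2 : m ∈ (blockUpper (OrderDual.toDual ∘ b) : Subgroup (GL (Fin n) F)) :=
    mem_blockUpper.2 fun i j h ↦ by
      rw [hme, if_neg]; intro h'; simp [h'] at h
  have hz : ∀ k, b i ≠ b k → m⁻¹.val i k = 0 := fun k hk ↦ by
    rcases lt_or_gt_of_ne hk with h | h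
    · exact mem_blockUpper.1 (inv_mem hm2) i k h
    · exact mem_blockUpper.1 (inv_mem hm1) i k h
  rw [Units.val_mul, Matrix.mul_apply]
  rcases hbij.lt_or_eq with h | h
  · refine Finset.sum_eq_zero fun k _ ↦ ?_
    by_cases hk : b i = b k
    · rw [mem_borel.1 hw.1 k j (hb.reflect_lt (hk ▸ h)), mul_zero]
    · rw [hz k hk, zero_mul]
  · have h1 : (m⁻¹ * m).val i j = 0 := by
      rw [inv_mul_cancel, Units.val_one, Matrix.one_apply_ne hij]
    rw [← h1, Units.val_mul, Matrix.mul_apply]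
    refine Finset.sum_congr rfl fun k _ ↦ ?_
    by_cases hk : b i = b k
    · rw [hme, if_pos (by rw [← hk, h])]
    · rw [hz k hk, zero_mul, zero_mul]

/-- Write `w = m y` with `m` block diagonal and `y` supported, off the diagonal, above the blocks.
As `τ` increases on blocks, `τ m τ⁻¹` is unitriangular; as `κ` preserves blocks, `κ⁻¹ y κ` is upper
triangular. A junction in a block of `a` that is new comes from two different blocks of `b`, where
`m` vanishes, so the character value is unchanged. -/
lemma BlockMove.exists_conj (h : BlockMove b a τ) {κ : Equiv.Perm (Fin n)} (hκ : BlockPres b κ)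
    {w : GL (Fin n) F} (hw : w ∈ unitri n F) : ∃ u ∈ unitri n F, ∃ c ∈ borel n F,
      superSum a u = superSum b w ∧
      permGL τ * w * permGL κ = u * (permGL τ * permGL κ) * c := by
  obtain ⟨m, hm, hme, hy⟩ := exists_blockDiagonal_part h.mono_left hw
  have hconj : ∀ i j, (permGL τ * m * (permGL τ)⁻¹).val i j = m.val (τ⁻¹ i) (τ⁻¹ j) :=
    fun i j ↦ by rw [← map_inv, mul_permGL_apply, permGL_mul_apply]
  refine ⟨permGL τ * m * (permGL τ)⁻¹, ⟨mem_borel.2 fun i j hij ↦ ?_, fun i ↦ ?_⟩,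
    (permGL κ)⁻¹ * (m⁻¹ * w) * permGL κ, mem_borel.2 fun k l hkl ↦ ?_, ?_, by group⟩
  · rw [hconj]
    by_contra hne
    have h1 : τ⁻¹ i ≠ τ⁻¹ j := τ⁻¹.injective.ne hij.ne'
    have h2 : b (τ⁻¹ i) = b (τ⁻¹ j) := by
      by_contra h2
      exact hne (by rw [hme, if_neg h2])
    rcases lt_or_gt_of_ne h1 with h3 | h3
    · have := h.lt h3 h2
      simp only [Equiv.Perm.inv_def, Equiv.apply_symm_apply] at this
      exact absurd hij this.asymm
    · exact hne (mem_borel.1 hm.1 _ _ h3)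
  · rw [hconj, hm.2]
  · rw [permGL_inv_mul_apply]
    refine hy _ _ (κ.injective.ne hkl.ne') ?_
    rw [hκ, hκ]
    exact h.mono_left hkl.le
  · unfold superSum
    rw [← Equiv.sum_comp τ]
    refine Finset.sum_congr rfl fun p _ ↦ ?_
    rw [← Equiv.sum_comp τ]
    refine Finset.sum_congr rfl fun p' _ ↦ ?_
    rw [hconj]
    simp only [Equiv.Perm.inv_def, Equiv.symm_apply_apply]
    by_cases h1 : (p' : ℕ) = p + 1 ∧ b p = b p'
    · rw [if_pos h1, if_pos (h.map_succ p p' h1.1 h1.2), hme, if_pos h1.2]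
    · rw [if_neg h1]
      split_ifs with h2
      · rcases h.of_map_succ p p' h2.1 h2.2 with h3 | h3
        · rw [hme, if_neg h3.ne']
        · exact absurd h3 h1
      · rfl

variable [Finite F]

lemma coeff_whittaker_unitri_mul (ψ : AddChar F R) (a : Fin n → ℕ) {u : GL (Fin n) F}
    (hu : u ∈ unitri n F) (g : GL (Fin n) F) :
    (whittaker ψ a).coeff (u * g) = ψ (-superSum a u) * (whittaker ψ a).coeff g := by
  have h := translate_charProj ψ a (inv_mem hu) (steinbergElement n F R)
  have h1 := congrArg (fun x ↦ x.coeff g) h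
  simp only [coeff_translate, inv_inv, MonoidAlgebra.coeff_smul_apply, smul_eq_mul,
    superSum_inv a hu] at h1
  exact h1

lemma isUnit_sign (σ : Equiv.Perm (Fin n)) : IsUnit (((Equiv.Perm.sign σ : ℤ) : R)) :=
  IsUnit.of_mul_eq_one _ (sign_mul_sign_self σ)

/-- The scalar is read off from the coefficient at `κ`, the permutation that reverses every block of
`b`. All terms of the sum over `U` agree there, so the left side is `|U|` times the coefficient of
`whittaker ψ a` at `τ κ`. Because `τ κ` is good for `a` and `κ` for `b`, everything is a sign times
a power of `q`. -/
lemma BlockMove.exists_unit (h : BlockMove b a τ) (hq : IsUnit (Nat.card F : R))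
    (ψ : AddChar F R) : ∃ r : R, IsUnit r ∧
      charProj ψ b (translate (permGL τ)⁻¹ (whittaker ψ a)) = r • whittaker ψ b := by
  obtain ⟨r, hr⟩ := exists_charProj_eq_smul ψ b
    (translate_mem _ (permGL τ)⁻¹ (whittaker_mem ψ a))
  refine ⟨r, ?_, hr⟩
  obtain ⟨κ, hκ, hκ'⟩ := exists_blockPres_blockAnti h.mono_left 1
  rw [one_mul] at hκ'
  have hκi : ∀ p p' : Fin n, p < p' → b p = b p' → κ⁻¹ p' < κ⁻¹ p := fun p p' hp hbp ↦ by
    by_contra hlt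
    have h1 : κ⁻¹ p < κ⁻¹ p' := lt_of_le_of_ne (not_lt.1 hlt) (κ⁻¹.injective.ne hp.ne)
    have h2 := hκ' _ _ h1 (by rw [hκ.inv, hκ.inv, hbp])
    simp only [Equiv.Perm.inv_def, Equiv.apply_symm_apply] at h2
    exact absurd hp h2.asymm
  have hgb : GoodPerm b κ := (goodPerm_iff h.mono_left).2 hκi
  have hga : GoodPerm a (τ * κ) := fun i j hij haij ↦ by
    rw [_root_.mul_inv_rev, Equiv.Perm.mul_apply, Equiv.Perm.mul_apply]
    rcases h.of_map_succ (τ⁻¹ i) (τ⁻¹ j) (by simpa using hij) (by simpa using haij) with h1 | h1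
    · rw [← hκ.inv, ← hκ.inv (τ⁻¹ i)] at h1
      exact h.mono_left.reflect_lt h1
    · exact hκi _ _ (by rw [Fin.lt_def]; omega) h1.2
  have hw : ∀ v ∈ unitri n F, (whittaker ψ a).coeff (permGL τ * v * permGL κ) =
      ψ (-superSum b v) * (whittaker ψ a).coeff (permGL (τ * κ)) := fun v hv ↦ by
    obtain ⟨u, hu, c, hc, hs, he⟩ := h.exists_conj hκ hv
    rw [he, coeff_mul_of_mem_lattice (whittaker_mem ψ a) _ hc, coeff_whittaker_unitri_mul ψ a hu,
      hs, map_mul permGL]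
  have hval := congrArg (fun x ↦ x.coeff (permGL κ)) hr
  rw [charProj_apply] at hval
  simp only [MonoidAlgebra.coeff_sum, Finsupp.finsetSum_apply, MonoidAlgebra.coeff_smul_apply,
    coeff_translate, inv_inv] at hval
  have hterm : ∀ u : unitri n F, ψ (-superSum b u.1) •
      (whittaker ψ a).coeff (permGL τ * (u.1⁻¹ * permGL κ)) =
        (whittaker ψ a).coeff (permGL (τ * κ)) := fun u ↦ by
    rw [← mul_assoc, hw _ (inv_mem u.2), smul_eq_mul, ← mul_assoc, ← AddChar.map_add_eq_mul,
      superSum_inv b u.2, neg_neg, neg_add_cancel, AddChar.map_zero_eq_one, one_mul]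
  simp only [hterm, Finset.sum_const, Finset.card_univ] at hval
  rw [coeff_whittaker_of_goodPerm ψ hga, coeff_whittaker_of_goodPerm ψ hgb,
    ← Nat.card_eq_fintype_card, card_unitri, nsmul_eq_mul, Nat.cast_pow, smul_eq_mul] at hval
  have : IsUnit (r * (((Equiv.Perm.sign κ : ℤ) : R) * (Nat.card F : R) ^ coinv κ⁻¹)) := by
    rw [← hval]
    exact (hq.pow _).mul ((isUnit_sign _).mul (hq.pow _))
  exact isUnit_of_mul_isUnit_left this

omit [Finite F] in
lemma smul_mem_iff_of_isUnit (N : Submodule (MonoidAlgebra R (GL (Fin n) F))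
    (MonoidAlgebra R (GL (Fin n) F))) {r : R} (hr : IsUnit r)
    {x : MonoidAlgebra R (GL (Fin n) F)} : r • x ∈ N ↔ x ∈ N := by
  refine ⟨fun h ↦ ?_, fun h ↦ Submodule.smul_of_tower_mem _ _ h⟩
  obtain ⟨s, rfl⟩ := hr
  have := Submodule.smul_of_tower_mem N (↑s⁻¹ : R) h
  rwa [smul_smul, Units.inv_mul, one_smul] at this

lemma BlockMove.whittaker_mem_left (h : BlockMove b a τ) (hq : IsUnit (Nat.card F : R))
    (ψ : AddChar F R) {N : Submodule (MonoidAlgebra R (GL (Fin n) F))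
      (MonoidAlgebra R (GL (Fin n) F))} (ha : whittaker ψ a ∈ N) : whittaker ψ b ∈ N := by
  obtain ⟨r, hr, he⟩ := h.exists_unit hq ψ
  rw [← smul_mem_iff_of_isUnit N hr, ← he]
  exact charProj_mem N _ _ (translate_mem N _ ha)

/-- The scalars of the two opposite transitions are linked by adjointness: `r' [G : P_a] = r [G :
P_b]`, whence `r' = r k`, a unit when `k` is one. -/
lemma BlockMove.whittaker_mem_right [IsDomain R] [CharZero R] (h : BlockMove b a τ)
    (hq : IsUnit (Nat.card F : R)) {ψ : AddChar F R} (hψ : ψ ≠ 1) {k : ℕ} (hk : IsUnit (k : R))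
    (hidx : (blockUpper b : Subgroup (GL (Fin n) F)).index =
      k * (blockUpper a : Subgroup (GL (Fin n) F)).index)
    {N : Submodule (MonoidAlgebra R (GL (Fin n) F))
      (MonoidAlgebra R (GL (Fin n) F))} (hb : whittaker ψ b ∈ N) : whittaker ψ a ∈ N := by
  obtain ⟨r, hr, he⟩ := h.exists_unit hq ψ⁻¹
  obtain ⟨r', hr'⟩ := exists_charProj_eq_smul ψ a
    (translate_mem _ (permGL τ) (whittaker_mem ψ b))
  have h1 := groupForm_whittaker hψ h.mono_left he
  rw [← inv_inv (permGL τ)] at hr'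
  have h2 : groupForm (charProj ψ a (translate (permGL τ)⁻¹⁻¹ (whittaker ψ b)))
      (steinbergElement n F R) =
      groupForm (whittaker ψ b) (translate (permGL τ)⁻¹ (whittaker ψ⁻¹ a)) := by
    rw [groupForm_charProj_left, groupForm_translate_left, inv_inv]
    rfl
  rw [h1, hr', groupForm_smul_left, groupForm_whittaker_steinbergElement hψ h.mono_right,
    hidx] at h2
  have hB : (Nat.card (borel n F) : R) ≠ 0 := Nat.cast_ne_zero.2 Nat.card_pos.ne'
  have hi : ((blockUpper a : Subgroup (GL (Fin n) F)).index : R) ≠ 0 :=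
    Nat.cast_ne_zero.2 Subgroup.index_ne_zero_of_finite
  have h3 : r' = r * k := by
    apply mul_right_cancel₀ (mul_ne_zero hB hi)
    rw [h2]
    push_cast
    ring
  rw [← smul_mem_iff_of_isUnit N (h3 ▸ hr.mul hk : IsUnit r'), ← hr']
  exact charProj_mem N _ _ (translate_mem N _ hb)

end BlockMove

/-! ### Block labellings from lists, and moves that merge or exchange blocks -/

section Labels

/-- The index of the block that contains `i`, for consecutive blocks of the sizes in a list. -/
def blockIndex : List ℕ → ℕ → ℕ
  | [], _ => 0
  | x :: l, i => if i < x then 0 else blockIndex l (i - x) + 1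

lemma blockIndex_mono (l : List ℕ) : Monotone (blockIndex l) := by
  induction l with
  | nil => exact monotone_const
  | cons x l ih =>
    intro i j hij
    have := ih (show i - x ≤ j - x by omega)
    simp only [blockIndex]
    split_ifs <;> omega

lemma blockIndex_lt_length (l : List ℕ) {i : ℕ} (hi : i < l.sum) :
    blockIndex l i < l.length := by
  induction l generalizing i with
  | nil => simp at hi
  | cons x l ih =>
    simp only [blockIndex, List.length_cons]
    rw [List.sum_cons] at hi
    split_ifs with h
    · omega
    · have := ih (show i - x < l.sum by omega)
      omega

lemma blockIndex_append (l l' : List ℕ) (i : ℕ) : blockIndex (l ++ l') i =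
    if i < l.sum then blockIndex l i else l.length + blockIndex l' (i - l.sum) := by
  induction l generalizing i with
  | nil => simp
  | cons x l ih =>
    rw [List.sum_cons, List.cons_append, blockIndex, blockIndex, List.length_cons, ih]
    by_cases h : i < x
    · rw [if_pos h, if_pos (by omega), if_pos h]
    · rw [if_neg h, if_neg h]
      by_cases h2 : i - x < l.sum
      · rw [if_pos h2, if_pos (by omega)]
      · rw [if_neg h2, if_neg (by omega), Nat.sub_sub]
        omega

/-- The labelling of `Fin n` by the blocks of the sizes in a list. -/
def blockLabel (n : ℕ) (l : List ℕ) (i : Fin n) : ℕ := blockIndex l i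

lemma blockLabel_mono (n : ℕ) (l : List ℕ) : Monotone (blockLabel n l) :=
  fun _ _ h ↦ blockIndex_mono l h

/-- The permutation that exchanges two neighbouring intervals. -/
lemma exists_blockSwap {n p r s : ℕ} (h : p + r + s ≤ n) : ∃ τ : Equiv.Perm (Fin n), ∀ i : Fin n,
    (τ i : ℕ) = if (i : ℕ) < p then (i : ℕ) else if (i : ℕ) < p + r then i + s else
      if (i : ℕ) < p + r + s then i - r else i := by
  let f : Fin n → Fin n := fun i ↦ ⟨if (i : ℕ) < p then (i : ℕ) else if (i : ℕ) < p + r then i + s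
    else if (i : ℕ) < p + r + s then i - r else i, by split_ifs <;> omega⟩
  have hf : Function.Injective f := fun i j hij ↦ by
    simp only [f, Fin.mk.injEq] at hij
    apply Fin.ext
    split_ifs at hij <;> omega
  exact ⟨Equiv.ofBijective f (Finite.injective_iff_bijective.1 hf), fun i ↦ rfl⟩

lemma blockIndex_append_cons_cons (l₁ l₂ : List ℕ) (r s i : ℕ) :
    (i < l₁.sum ∧ blockIndex (l₁ ++ r :: s :: l₂) i = blockIndex l₁ i ∧
      blockIndex l₁ i < l₁.length) ∨
    (l₁.sum ≤ i ∧ i < l₁.sum + r ∧ blockIndex (l₁ ++ r :: s :: l₂) i = l₁.length) ∨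
    (l₁.sum + r ≤ i ∧ i < l₁.sum + r + s ∧
      blockIndex (l₁ ++ r :: s :: l₂) i = l₁.length + 1) ∨
    (l₁.sum + r + s ≤ i ∧ blockIndex (l₁ ++ r :: s :: l₂) i =
      l₁.length + 2 + blockIndex l₂ (i - (l₁.sum + r + s))) := by
  rw [blockIndex_append, blockIndex, blockIndex]
  have h := fun h ↦ blockIndex_lt_length l₁ (i := i) h
  have e : i - l₁.sum - r - s = i - (l₁.sum + r + s) := by omega
  rw [e]
  split_ifs with h1 h2 h3
  · exact Or.inl ⟨h1, rfl, h h1⟩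
  · exact Or.inr (Or.inl ⟨by omega, by omega, rfl⟩)
  · exact Or.inr (Or.inr (Or.inl ⟨by omega, by omega, rfl⟩))
  · exact Or.inr (Or.inr (Or.inr ⟨by omega, by omega⟩))

lemma blockIndex_append_cons (l₁ l₂ : List ℕ) (r s i : ℕ) :
    (i < l₁.sum ∧ blockIndex (l₁ ++ (r + s) :: l₂) i = blockIndex l₁ i) ∨
    (l₁.sum ≤ i ∧ i < l₁.sum + r + s ∧ blockIndex (l₁ ++ (r + s) :: l₂) i = l₁.length) ∨
    (l₁.sum + r + s ≤ i ∧ blockIndex (l₁ ++ (r + s) :: l₂) i =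
      l₁.length + 1 + blockIndex l₂ (i - (l₁.sum + r + s))) := by
  rw [blockIndex_append, blockIndex]
  have e : i - l₁.sum - (r + s) = i - (l₁.sum + r + s) := by omega
  rw [e]
  split_ifs with h1 h2
  · exact Or.inl ⟨h1, rfl⟩
  · exact Or.inr (Or.inl ⟨by omega, by omega, rfl⟩)
  · exact Or.inr (Or.inr ⟨by omega, by omega⟩)

/-- The two intervals are exchanged instead of staying in place: the junction created inside the
merged block then comes from two blocks in the reverse order, as `of_map_succ` demands. -/
lemma blockMove_merge {n : ℕ} (l₁ l₂ : List ℕ) (r s : ℕ) (h : (l₁ ++ r :: s :: l₂).sum = n) :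
    ∃ τ, BlockMove (blockLabel n (l₁ ++ r :: s :: l₂)) (blockLabel n (l₁ ++ (r + s) :: l₂)) τ := by
  simp only [List.sum_append, List.sum_cons] at h
  obtain ⟨τ, hτ⟩ := exists_blockSwap (show l₁.sum + r + s ≤ n by omega)
  have key : ∀ i : Fin n,
      ((i : ℕ) < l₁.sum ∧ (τ i : ℕ) = i ∧ blockIndex (l₁ ++ r :: s :: l₂) i = blockIndex l₁ i ∧
        blockIndex l₁ i < l₁.length ∧
        blockIndex (l₁ ++ (r + s) :: l₂) (τ i) = blockIndex l₁ i) ∨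
      (l₁.sum ≤ i ∧ (i : ℕ) < l₁.sum + r ∧ (τ i : ℕ) = i + s ∧
        blockIndex (l₁ ++ r :: s :: l₂) i = l₁.length ∧
        blockIndex (l₁ ++ (r + s) :: l₂) (τ i) = l₁.length) ∨
      (l₁.sum + r ≤ i ∧ (i : ℕ) < l₁.sum + r + s ∧ (τ i : ℕ) = i - r ∧
        blockIndex (l₁ ++ r :: s :: l₂) i = l₁.length + 1 ∧
        blockIndex (l₁ ++ (r + s) :: l₂) (τ i) = l₁.length) ∨
      (l₁.sum + r + s ≤ i ∧ (τ i : ℕ) = i ∧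
        blockIndex (l₁ ++ r :: s :: l₂) i = l₁.length + 2 + blockIndex l₂ (i - (l₁.sum + r + s)) ∧
        blockIndex (l₁ ++ (r + s) :: l₂) (τ i) =
          l₁.length + 1 + blockIndex l₂ (i - (l₁.sum + r + s))) := fun i ↦ by
    have hti := hτ i
    have ha := blockIndex_append_cons l₁ l₂ r s (τ i)
    rcases blockIndex_append_cons_cons l₁ l₂ r s i with hb | hb | hb | hb
    · have ht : (τ i : ℕ) = i := by split_ifs at hti <;> omega
      rw [ht] at ha ⊢
      exact Or.inl ⟨by omega, rfl, by omega, by omega, by omega⟩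
    · have ht : (τ i : ℕ) = i + s := by split_ifs at hti <;> omega
      exact Or.inr (Or.inl ⟨by omega, by omega, ht, by omega, by omega⟩)
    · have ht : (τ i : ℕ) = i - r := by split_ifs at hti <;> omega
      exact Or.inr (Or.inr (Or.inl ⟨by omega, by omega, ht, by omega, by omega⟩))
    · have ht : (τ i : ℕ) = i := by split_ifs at hti <;> omega
      rw [ht] at ha ⊢
      exact Or.inr (Or.inr (Or.inr ⟨by omega, rfl, by omega, by omega⟩))
  refine ⟨τ, blockLabel_mono _ _, blockLabel_mono _ _, fun p p' h1 h2 => ?_,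
    fun p p' h1 h2 => ?_⟩
  · change blockIndex (l₁ ++ r :: s :: l₂) p = blockIndex (l₁ ++ r :: s :: l₂) p' at h2
    change _ ∧ blockIndex (l₁ ++ (r + s) :: l₂) (τ p) = blockIndex (l₁ ++ (r + s) :: l₂) (τ p')
    rcases key p with h3 | h3 | h3 | h3 <;> rcases key p' with h4 | h4 | h4 | h4 <;>
      constructor <;> omega
  · change blockIndex (l₁ ++ (r + s) :: l₂) (τ p) = blockIndex (l₁ ++ (r + s) :: l₂) (τ p') at h2
    change blockIndex (l₁ ++ r :: s :: l₂) p' < blockIndex (l₁ ++ r :: s :: l₂) p ∨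
      _ ∧ blockIndex (l₁ ++ r :: s :: l₂) p = blockIndex (l₁ ++ r :: s :: l₂) p'
    rcases key p with h3 | h3 | h3 | h3 <;> rcases key p' with h4 | h4 | h4 | h4 <;> omega

lemma blockMove_swap {n : ℕ} (l₁ l₂ : List ℕ) (r s : ℕ) (h : (l₁ ++ r :: s :: l₂).sum = n) :
    ∃ τ, BlockMove (blockLabel n (l₁ ++ r :: s :: l₂)) (blockLabel n (l₁ ++ s :: r :: l₂)) τ := by
  simp only [List.sum_append, List.sum_cons] at h
  obtain ⟨τ, hτ⟩ := exists_blockSwap (show l₁.sum + r + s ≤ n by omega)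
  have hrs : l₁.sum + s + r = l₁.sum + r + s := by omega
  have key : ∀ i : Fin n,
      ((i : ℕ) < l₁.sum ∧ (τ i : ℕ) = i ∧ blockIndex (l₁ ++ r :: s :: l₂) i = blockIndex l₁ i ∧
        blockIndex l₁ i < l₁.length ∧
        blockIndex (l₁ ++ s :: r :: l₂) (τ i) = blockIndex l₁ i) ∨
      (l₁.sum ≤ i ∧ (i : ℕ) < l₁.sum + r ∧ (τ i : ℕ) = i + s ∧
        blockIndex (l₁ ++ r :: s :: l₂) i = l₁.length ∧
        blockIndex (l₁ ++ s :: r :: l₂) (τ i) = l₁.length + 1) ∨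
      (l₁.sum + r ≤ i ∧ (i : ℕ) < l₁.sum + r + s ∧ (τ i : ℕ) = i - r ∧
        blockIndex (l₁ ++ r :: s :: l₂) i = l₁.length + 1 ∧
        blockIndex (l₁ ++ s :: r :: l₂) (τ i) = l₁.length) ∨
      (l₁.sum + r + s ≤ i ∧ (τ i : ℕ) = i ∧
        blockIndex (l₁ ++ r :: s :: l₂) i = l₁.length + 2 + blockIndex l₂ (i - (l₁.sum + r + s)) ∧
        blockIndex (l₁ ++ s :: r :: l₂) (τ i) =
          l₁.length + 2 + blockIndex l₂ (i - (l₁.sum + r + s))) := fun i ↦ by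
    have hti := hτ i
    have ha := blockIndex_append_cons_cons l₁ l₂ s r (τ i)
    rw [hrs] at ha
    rcases blockIndex_append_cons_cons l₁ l₂ r s i with hb | hb | hb | hb
    · have ht : (τ i : ℕ) = i := by split_ifs at hti <;> omega
      rw [ht] at ha ⊢
      exact Or.inl ⟨by omega, rfl, by omega, by omega, by omega⟩
    · have ht : (τ i : ℕ) = i + s := by split_ifs at hti <;> omega
      exact Or.inr (Or.inl ⟨by omega, by omega, ht, by omega, by omega⟩)
    · have ht : (τ i : ℕ) = i - r := by split_ifs at hti <;> omega
      exact Or.inr (Or.inr (Or.inl ⟨by omega, by omega, ht, by omega, by omega⟩))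
    · have ht : (τ i : ℕ) = i := by split_ifs at hti <;> omega
      rw [ht] at ha ⊢
      exact Or.inr (Or.inr (Or.inr ⟨by omega, rfl, by omega, by omega⟩))
  refine ⟨τ, blockLabel_mono _ _, blockLabel_mono _ _, fun p p' h1 h2 => ?_,
    fun p p' h1 h2 => ?_⟩
  · change blockIndex (l₁ ++ r :: s :: l₂) p = blockIndex (l₁ ++ r :: s :: l₂) p' at h2
    change _ ∧ blockIndex (l₁ ++ s :: r :: l₂) (τ p) = blockIndex (l₁ ++ s :: r :: l₂) (τ p')
    rcases key p with h3 | h3 | h3 | h3 <;> rcases key p' with h4 | h4 | h4 | h4 <;>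
      constructor <;> omega
  · change blockIndex (l₁ ++ s :: r :: l₂) (τ p) = blockIndex (l₁ ++ s :: r :: l₂) (τ p') at h2
    change blockIndex (l₁ ++ r :: s :: l₂) p' < blockIndex (l₁ ++ r :: s :: l₂) p ∨
      _ ∧ blockIndex (l₁ ++ r :: s :: l₂) p = blockIndex (l₁ ++ r :: s :: l₂) p'
    rcases key p with h3 | h3 | h3 | h3 <;> rcases key p' with h4 | h4 | h4 | h4 <;> omega

end Labels

/-! ### Mirabolic subgroups and column subgroups -/

section Mirabolic

variable {n : ℕ} {F : Type*} [Field F]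

open Classical in
/-- The sum of the entries `(i, i + 1)` with `i` in a given set. -/
def supportSum (J : ℕ → Prop) (g : GL (Fin n) F) : F :=
  ∑ i : Fin n, ∑ j : Fin n, if (j : ℕ) = i + 1 ∧ J i then g.val i j else 0

lemma supportSum_mul (J : ℕ → Prop) {g h : GL (Fin n) F} (hg : g ∈ unitri n F)
    (hh : h ∈ unitri n F) : supportSum J (g * h) = supportSum J g + supportSum J h := by
  simp only [supportSum, ← Finset.sum_add_distrib]
  refine Finset.sum_congr rfl fun i _ ↦ Finset.sum_congr rfl fun j _ ↦ ?_
  split_ifs with hij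
  · rw [borel_mul_apply_succ hg.1 hh.1 hij.1, hg.2, hh.2]; ring
  · simp

variable (n F) in
/-- The unitriangular matrices whose columns before the `k`-th are trivial. -/
def IsLateUnitri (k : ℕ) (u : GL (Fin n) F) : Prop :=
  u ∈ unitri n F ∧ ∀ i j : Fin n, (j : ℕ) < k → i ≠ j → u.val i j = 0

/-- The elements of the mirabolic subgroup of the upper left `GL_(k+1)`. -/
def IsMirabolic (k : ℕ) (g : GL (Fin n) F) : Prop :=
  (∀ i j : Fin n, k ≤ (i : ℕ) → g.val i j = if i = j then 1 else 0) ∧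
    ∀ i j : Fin n, k < (j : ℕ) → g.val i j = if i = j then 1 else 0

lemma inv_row_of_row {k : ℕ} {g : GL (Fin n) F}
    (hg : ∀ i j : Fin n, k ≤ (i : ℕ) → g.val i j = if i = j then 1 else 0) (i j : Fin n)
    (hi : k ≤ (i : ℕ)) : g⁻¹.val i j = if i = j then 1 else 0 := by
  have h : (g * g⁻¹).val i j = if i = j then 1 else 0 := by
    rw [mul_inv_cancel, Units.val_one, Matrix.one_apply]
  rw [Units.val_mul, Matrix.mul_apply, Finset.sum_eq_single i] at h
  · rwa [hg i i hi, if_pos rfl, one_mul] at h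
  · intro l _ hl
    rw [hg i l hi, if_neg hl.symm, zero_mul]
  · simp

/-- The matrix `N = u - 1` lives in the columns after `k`, where `g` acts trivially on the right, so
the conjugate is `1 + g⁻¹ N`. This has the same rows as `u` from the `k`-th on, and every
superdiagonal entry in a column after `k` is in such a row. -/
lemma IsMirabolic.conj {k : ℕ} {g u : GL (Fin n) F} (hg : IsMirabolic k g)
    (hu : IsLateUnitri n F (k + 1) u) (J : ℕ → Prop) :
    IsLateUnitri n F (k + 1) (g⁻¹ * u * g) ∧ supportSum J (g⁻¹ * u * g) = supportSum J u := by
  have hcol : ∀ i j : Fin n, (j : ℕ) ≤ k → u.val i j = if i = j then 1 else 0 := fun i j hj ↦ by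
    split_ifs with h
    · rw [h, hu.1.2]
    · exact hu.2 i j (by omega) h
  let N : Matrix (Fin n) (Fin n) F := u.val - 1
  have hN : ∀ i j : Fin n, (j : ℕ) ≤ k → N i j = 0 := fun i j hj ↦ by
    simp only [N, Matrix.sub_apply, hcol i j hj, Matrix.one_apply, sub_self]
  have hNg : N * g.val = N := by
    ext i j
    rw [Matrix.mul_apply]
    by_cases hj : k < (j : ℕ)
    · simp only [hg.2 _ j hj, mul_ite, mul_one, mul_zero, Finset.sum_ite_eq', Finset.mem_univ,
        if_true]
    · rw [hN i j (by omega)]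
      refine Finset.sum_eq_zero fun l _ ↦ ?_
      by_cases hl : (l : ℕ) ≤ k
      · rw [hN i l hl, zero_mul]
      · rw [hg.1 l j (by omega), if_neg (by rintro rfl; omega), mul_zero]
  have hv : (g⁻¹ * u * g).val = 1 + g⁻¹.val * N := by
    have hu' : u.val = 1 + N := by simp [N]
    rw [Units.val_mul, Units.val_mul, hu', mul_assoc, Matrix.add_mul, Matrix.one_mul, hNg,
      Matrix.mul_add, ← Units.val_mul, inv_mul_cancel, Units.val_one]
  have hv1 : ∀ i j : Fin n, (j : ℕ) ≤ k → (g⁻¹ * u * g).val i j = if i = j then 1 else 0 :=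
    fun i j hj ↦ by
      rw [hv, Matrix.add_apply, Matrix.one_apply, Matrix.mul_apply, Finset.sum_eq_zero, add_zero]
      intro l _
      rw [hN l j hj, mul_zero]
  have hv2 : ∀ i j : Fin n, k ≤ (i : ℕ) → (g⁻¹ * u * g).val i j = u.val i j := fun i j hi ↦ by
    rw [hv, Matrix.add_apply, Matrix.one_apply, Matrix.mul_apply, Finset.sum_eq_single i]
    · rw [inv_row_of_row hg.1 i i hi, if_pos rfl, one_mul]
      simp [N, Matrix.one_apply]
    · intro l _ hl
      rw [inv_row_of_row hg.1 i l hi, if_neg hl.symm, zero_mul]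
    · simp
  refine ⟨⟨⟨mem_borel.2 fun i j hij ↦ ?_, fun i ↦ ?_⟩, fun i j hj hij ↦ ?_⟩, ?_⟩
  · by_cases hj : (j : ℕ) ≤ k
    · rw [hv1 i j hj, if_neg hij.ne']
    · rw [Fin.lt_def] at hij
      rw [hv2 i j (by omega)]
      exact mem_borel.1 hu.1.1 i j hij
  · by_cases hi : (i : ℕ) ≤ k
    · rw [hv1 i i hi, if_pos rfl]
    · rw [hv2 i i (by omega), hu.1.2]
  · rw [hv1 i j (by omega), if_neg hij]
  · refine Finset.sum_congr rfl fun i _ ↦ Finset.sum_congr rfl fun j _ ↦ ?_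
    split_ifs with h
    · by_cases hj : (j : ℕ) ≤ k
      · rw [hv1 i j hj, hcol i j hj]
      · rw [hv2 i j (by omega)]
    · rfl

/-- The unitriangular matrix that differs from `1` in the column `k` only, with the entries of
`a` above the diagonal. -/
def columnGL (k : Fin n) (a : Fin n → F) : GL (Fin n) F :=
  Matrix.GeneralLinearGroup.mkOfDetNeZero
    (Matrix.of fun i j ↦ if j = k ∧ i < k then a i else if i = j then 1 else 0) (by
      rw [Matrix.det_of_isUpperTriangular]
      · refine Finset.prod_ne_zero_iff.2 fun i _ ↦ ?_
        rw [Matrix.of_apply, if_neg (by rintro ⟨rfl, h⟩; exact lt_irrefl _ h), if_pos rfl]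
        exact one_ne_zero
      · intro i j hij
        have hij : j < i := hij
        rw [Matrix.of_apply, if_neg (by rintro ⟨rfl, h⟩; exact absurd h hij.asymm),
          if_neg hij.ne'])

lemma columnGL_apply (k : Fin n) (a : Fin n → F) (i j : Fin n) :
    (columnGL k a).val i j = if j = k ∧ i < k then a i else if i = j then 1 else 0 := rfl

lemma mul_columnGL_apply (g : GL (Fin n) F) (k : Fin n) (a : Fin n → F) (i j : Fin n) :
    (g * columnGL k a).val i j =
      g.val i j + if j = k then ∑ l : Fin n, if l < k then g.val i l * a l else 0 else 0 := by
  rw [Units.val_mul, Matrix.mul_apply]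
  by_cases hj : j = k
  · subst hj
    rw [if_pos rfl, ← Finset.sum_erase_add _ _ (Finset.mem_univ j), columnGL_apply,
      if_neg (by simp), if_pos rfl, mul_one, add_comm,
      ← Finset.sum_erase_add (f := fun l ↦ if l < j then g.val i l * a l else 0) _
        (Finset.mem_univ j), if_neg (lt_irrefl _), add_zero]
    congr 1
    refine Finset.sum_congr rfl fun l hl ↦ ?_
    rw [columnGL_apply]
    simp only [true_and, if_neg (Finset.ne_of_mem_erase hl)]
    split_ifs <;> simp
  · simp [columnGL_apply, hj]

lemma columnGL_mul_apply (g : GL (Fin n) F) (k : Fin n) (a : Fin n → F) (i j : Fin n) :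
    (columnGL k a * g).val i j = g.val i j + if i < k then a i * g.val k j else 0 := by
  rw [Units.val_mul, Matrix.mul_apply]
  have : ∀ l, (columnGL k a).val i l = (if i = l then 1 else 0) +
      if l = k then (if i < k then a i else 0) else 0 := fun l ↦ by
    rw [columnGL_apply]
    by_cases h1 : l = k <;> by_cases h2 : i < k
    · subst h1; simp [h2, h2.ne]
    · simp [h1, h2]
    · simp [h1]
    · simp [h1]
  simp only [this, add_mul, Finset.sum_add_distrib]
  simp

lemma columnGL_mul_columnGL (k : Fin n) (a a' : Fin n → F) :
    columnGL k a * columnGL k a' = columnGL k (a + a') := by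
  ext i j
  rw [columnGL_mul_apply, columnGL_apply, columnGL_apply, columnGL_apply]
  by_cases h1 : j = k <;> by_cases h2 : i < k
  · subst h1; simp [h2, add_comm]
  · simp [h1, h2]
  · simp [h1, Ne.symm h1]
  · simp [h1, h2]

lemma columnGL_zero (k : Fin n) (a : Fin n → F) (ha : ∀ i < k, a i = 0) : columnGL k a = 1 := by
  ext i j
  rw [columnGL_apply, Units.val_one, Matrix.one_apply]
  split_ifs with h1 h2 h2
  · exact absurd (h2.trans h1.1) h1.2.ne
  · exact ha i h1.2
  · rfl
  · rfl

lemma isMirabolic_columnGL (k : Fin n) (a : Fin n → F) : IsMirabolic k (columnGL k a) := by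
  refine ⟨fun i j hi ↦ ?_, fun i j hj ↦ ?_⟩
  · rw [columnGL_apply, if_neg]
    rintro ⟨_, h⟩
    rw [Fin.lt_def] at h; omega
  · rw [columnGL_apply, if_neg]
    rintro ⟨h, _⟩
    rw [h] at hj; omega

lemma columnGL_mem_unitri (k : Fin n) (a : Fin n → F) : columnGL k a ∈ unitri n F := by
  refine ⟨mem_borel.2 fun i j hij ↦ ?_, fun i ↦ ?_⟩
  · rw [columnGL_apply, if_neg (by rintro ⟨rfl, h⟩; exact absurd h hij.asymm), if_neg hij.ne']
  · rw [columnGL_apply, if_neg (by rintro ⟨rfl, h⟩; exact lt_irrefl _ h), if_pos rfl]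

/-- An element of `GL_k` with a prescribed last row. -/
lemma exists_mirabolic_row (k : Fin n) {c : Fin n → F} {i₀ : Fin n} (hi₀ : i₀ < k)
    (hc : c i₀ ≠ 0) : ∃ g : GL (Fin n) F, IsMirabolic k g ∧
      ∀ i : Fin n, (i : ℕ) + 1 = k → ∀ j, g.val i j = if j < k then c j else 0 := by
  let c' : Fin n → F := fun j ↦ if j < k then c j else 0
  let D : Matrix (Fin n) (Fin n) F := (1 : Matrix (Fin n) (Fin n) F).updateRow i₀ c'
  have hD : D.det ≠ 0 := by
    -- By Cramer's rule for the identity matrix the determinant is `c' i₀`.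
    rw [← Matrix.cramer_transpose_apply, Matrix.transpose_one, Matrix.cramer_one]
    simpa [c', hi₀] using hc
  let m : Fin n := ⟨k - 1, by omega⟩
  rw [Fin.lt_def] at hi₀
  have hDe : ∀ i j, D i j = if i = i₀ then c' j else if i = j then 1 else 0 := fun i j ↦ by
    simp only [D, Matrix.updateRow_apply, Matrix.one_apply]
  have hge : ∀ i j, (permGL (Equiv.swap i₀ m) *
      Matrix.GeneralLinearGroup.mkOfDetNeZero D hD : GL (Fin n) F).val i j =
        D (Equiv.swap i₀ m i) j := fun i j ↦ by
    rw [permGL_mul_apply, Equiv.swap_inv]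
    rfl
  have hrow : ∀ i : Fin n, (k : ℕ) ≤ i → Equiv.swap i₀ m i = i := fun i hi ↦
    Equiv.swap_apply_of_ne_of_ne (by rintro rfl; omega) (by
      intro h; rw [h] at hi; simp only [m] at hi; omega)
  have hcol : ∀ i j : Fin n, (k : ℕ) ≤ j →
      D (Equiv.swap i₀ m i) j = if i = j then 1 else 0 := fun i j hj ↦ by
    rw [hDe]
    by_cases h1 : Equiv.swap i₀ m i = i₀
    · rw [if_pos h1, if_neg]
      · simp only [c']
        rw [if_neg (by rw [Fin.lt_def]; omega)]
      · intro h2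
        rw [h2, hrow j hj] at h1
        rw [h1] at hj; omega
    · rw [if_neg h1]
      refine if_congr ⟨fun h ↦ (Equiv.swap i₀ m).injective (h.trans (hrow j hj).symm), ?_⟩ rfl rfl
      rintro rfl
      exact hrow i hj
  refine ⟨permGL (Equiv.swap i₀ m) * Matrix.GeneralLinearGroup.mkOfDetNeZero D hD,
    ⟨fun i j hi ↦ ?_, fun i j hj ↦ ?_⟩, fun i hi j ↦ ?_⟩
  · rw [hge, hrow i hi, hDe, if_neg]
    rintro rfl; omega
  · rw [hge, hcol i j hj.le]
  · have : i = m := Fin.ext (by simp only [m]; omega)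
    rw [hge, this, Equiv.swap_apply_right, hDe, if_pos rfl]

/-- The action of a mirabolic element on the column group, with `a'` the image under `g⁻¹` of the
part of `a` above `k`. The second clause shows how characters transform: pairing `a'` with the row
`i` of `g` gives the coordinate `a i`. -/
lemma columnGL_mul_eq (k : Fin n) {g : GL (Fin n) F} (hg : IsMirabolic k g)
    (a : Fin n → F) :
    ∃ a' : Fin n → F, columnGL k a * g = g * columnGL k a' ∧
      ∀ i < k, ∑ l : Fin n, (if l < k then g.val i l * a' l else 0) = a i := by
  let a₀ : Fin n → F := fun i ↦ if i < k then a i else 0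
  let a' : Fin n → F := g⁻¹.val *ᵥ a₀
  have ha' : ∀ l, k ≤ l → a' l = 0 := fun l hl ↦ by
    simp only [a', Matrix.mulVec, dotProduct]
    refine Finset.sum_eq_zero fun j _ ↦ ?_
    rw [inv_row_of_row hg.1 l j hl]
    split_ifs with h
    · simp only [a₀]
      rw [if_neg (by rw [← h]; exact not_lt.2 hl), mul_zero]
    · rw [zero_mul]
  have hsum : ∀ i, ∑ l : Fin n, (if l < k then g.val i l * a' l else 0) = a₀ i := fun i ↦ by
    have h1 : g.val *ᵥ a' = a₀ := by
      simp only [a']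
      rw [Matrix.mulVec_mulVec, ← Units.val_mul, mul_inv_cancel, Units.val_one, Matrix.one_mulVec]
    rw [← h1, Matrix.mulVec, dotProduct]
    refine Finset.sum_congr rfl fun l _ ↦ ?_
    split_ifs with h
    · rfl
    · rw [ha' l (not_lt.1 h), mul_zero]
  refine ⟨a', ?_, fun i hi ↦ by rw [hsum]; exact if_pos hi⟩
  ext i j
  rw [columnGL_mul_apply, mul_columnGL_apply, hsum, hg.1 k j le_rfl]
  simp only [a₀]
  by_cases h1 : j = k <;> by_cases h2 : i < k <;> simp [h1, h2, eq_comm (a := k)]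

open Classical in
lemma supportSum_columnGL (J : ℕ → Prop) (k : Fin n) (a : Fin n → F) :
    supportSum J (columnGL k a) =
      ∑ i : Fin n, if (k : ℕ) = i + 1 ∧ J i then a i else 0 := by
  refine Finset.sum_congr rfl fun i _ ↦ ?_
  rw [Finset.sum_eq_single k]
  · rw [columnGL_apply]
    by_cases h1 : (k : ℕ) = i + 1 ∧ J i
    · rw [if_pos h1, if_pos h1, if_pos ⟨rfl, by rw [Fin.lt_def]; omega⟩]
    · rw [if_neg h1, if_neg h1]
  · intro j _ hj
    rw [columnGL_apply]
    split_ifs with h1 h2 h2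
    · exact absurd h2.1 hj
    · have := congrArg Fin.val h2; omega
    · rfl
    · rfl
  · simp

lemma IsLateUnitri.factor {k : Fin n} {u : GL (Fin n) F} (hu : IsLateUnitri n F k u) :
    IsLateUnitri n F (k + 1) (u * columnGL k (fun i ↦ -u.val i k)) := by
  refine ⟨mul_mem hu.1 (columnGL_mem_unitri _ _), fun i j hj hij ↦ ?_⟩
  rw [mul_columnGL_apply]
  by_cases h : j = k
  · rw [if_pos h, h]
    have : ∀ l : Fin n, (if l < k then u.val i l * -u.val l k else 0) =
        if l = i then (if i < k then -u.val i k else 0) else 0 := fun l ↦ by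
      by_cases hl : l = i
      · rw [hl, if_pos rfl, hu.1.2, one_mul]
      · rw [if_neg hl]
        split_ifs with h1
        · rw [hu.2 i l h1 (Ne.symm hl), zero_mul]
        · rfl
    simp only [this, Finset.sum_ite_eq', Finset.mem_univ, if_true]
    split_ifs with h1
    · ring
    · rw [add_zero]
      refine mem_borel.1 hu.1.1 i k (lt_of_le_of_ne (not_lt.1 h1) ?_)
      rw [← h]; exact hij.symm
  · rw [if_neg h, add_zero]
    refine hu.2 i j ?_ hij
    have := Fin.val_ne_of_ne h
    omega

end Mirabolic

/-! ### Every nonzero section contains an eigenvector -/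

section Existence

variable {n : ℕ} {F R : Type*} [Field F] [Finite F] [CommRing R] [IsDomain R]

local notation "𝔸" => MonoidAlgebra R (GL (Fin n) F)

omit [Finite F] [IsDomain R] in
lemma translate_mem_iff {N : Submodule (MonoidAlgebra R (GL (Fin n) F)) 𝔸} {g : GL (Fin n) F}
    {x : 𝔸} : translate g x ∈ N ↔ x ∈ N := by
  refine ⟨fun h ↦ ?_, fun h ↦ translate_mem N g h⟩
  have := translate_mem N g⁻¹ h
  rwa [← translate_mul, inv_mul_cancel, translate_one] at this

/-- The pairing of two vectors on the coordinates before the `k`-th one. -/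
def headDot (k : Fin n) (c a : Fin n → F) : F := ∑ l : Fin n, if l < k then c l * a l else 0

omit [Finite F] in
lemma headDot_add_right (k : Fin n) (c a a' : Fin n → F) :
    headDot k c (a + a') = headDot k c a + headDot k c a' := by
  simp only [headDot, ← Finset.sum_add_distrib]
  refine Finset.sum_congr rfl fun l _ ↦ ?_
  split_ifs
  · rw [Pi.add_apply, mul_add]
  · rw [add_zero]

omit [Finite F] in
lemma headDot_comm (k : Fin n) (c a : Fin n → F) : headDot k c a = headDot k a c := by
  simp only [headDot, mul_comm]

omit [Finite F] in
open Classical in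
lemma sum_headDot {ψ : AddChar F R} (hψ : ψ ≠ 1) [Fintype F] (k : Fin n) (a : Fin n → F) :
    ∑ c : Fin n → F, ψ (-headDot k c a) =
      if ∀ i < k, a i = 0 then (Fintype.card F : R) ^ n else 0 := by
  split_ifs with h
  · have : ∀ c, headDot k c a = 0 := fun c ↦ Finset.sum_eq_zero fun l _ ↦ by
      split_ifs with hl
      · rw [h l hl, mul_zero]
      · rfl
    simp [this]
  · push Not at h
    obtain ⟨i, hi, hai⟩ := h
    let φ : AddChar (Fin n → F) R := ψ.compAddMonoidHom
      (AddMonoidHom.mk' (fun c ↦ -headDot k c a) fun c c' ↦ by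
        rw [headDot_comm, headDot_add_right, headDot_comm k a, headDot_comm k a, neg_add])
    refine AddChar.sum_eq_zero_of_ne_one (ψ := φ) fun hφ ↦ ?_
    obtain ⟨t, ht⟩ := AddChar.ne_one_iff.1 hψ
    apply ht
    have h1 : φ (Pi.single i (-t / a i)) = 1 := by rw [hφ]; rfl
    rw [← h1]
    change ψ t = ψ (-headDot k (Pi.single i (-t / a i)) a)
    congr 1
    rw [headDot, Finset.sum_eq_single i]
    · rw [if_pos hi, Pi.single_eq_same]
      field_simp
    · intro l _ hl
      simp [hl]
    · simp

/-- Eigenvectors modulo `N` for a group of unitriangular matrices with few nontrivial columns. -/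
def IsLateEigen (N : Submodule (MonoidAlgebra R (GL (Fin n) F)) 𝔸) (ψ : AddChar F R) (k : ℕ)
    (J : ℕ → Prop) (x : 𝔸) : Prop :=
  ∀ u, IsLateUnitri n F k u → translate u x - ψ (supportSum J u) • x ∈ N

omit [Finite F] [IsDomain R] in
lemma IsLateEigen.translate {N : Submodule (MonoidAlgebra R (GL (Fin n) F)) 𝔸}
    {ψ : AddChar F R} {k : ℕ} {J : ℕ → Prop} {x : 𝔸} (hx : IsLateEigen N ψ (k + 1) J x)
    {g : GL (Fin n) F} (hg : IsMirabolic k g) :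
    IsLateEigen N ψ (k + 1) J (GowSteinberg.translate g x) := fun u hu ↦ by
  obtain ⟨h1, h2⟩ := hg.conj hu J
  have h3 := translate_mem N g (hx _ h1)
  rw [map_sub, map_smul, h2, ← translate_mul] at h3
  rwa [← translate_mul, show u * g = g * (g⁻¹ * u * g) by group]

omit [Finite F] [IsDomain R] in
lemma IsLateEigen.smul {N : Submodule (MonoidAlgebra R (GL (Fin n) F)) 𝔸}
    {ψ : AddChar F R} {k : ℕ} {J : ℕ → Prop} {x : 𝔸} (hx : IsLateEigen N ψ k J x) (r : R) :
    IsLateEigen N ψ k J (r • x) := fun u hu ↦ by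
  have := Submodule.smul_of_tower_mem N r (hx u hu)
  rwa [smul_sub, smul_comm r, ← map_smul] at this

omit [Finite F] [IsDomain R] in
lemma IsLateEigen.sum {N : Submodule (MonoidAlgebra R (GL (Fin n) F)) 𝔸}
    {ψ : AddChar F R} {k : ℕ} {J : ℕ → Prop} {ι : Type*} (s : Finset ι) {x : ι → 𝔸}
    (hx : ∀ i ∈ s, IsLateEigen N ψ k J (x i)) : IsLateEigen N ψ k J (∑ i ∈ s, x i) :=
  fun u hu ↦ by
    rw [map_sum, Finset.smul_sum, ← Finset.sum_sub_distrib]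
    exact sum_mem fun i hi ↦ hx i hi u hu

omit [Finite F] [IsDomain R] in
-- A matrix trivial before column `k` factors as one trivial up to column `k` times a column matrix.
-- The new column only adds the superdiagonal position `k - 1`, the only place where `J'` may differ
-- from `J`.
lemma IsLateEigen.step {N : Submodule (MonoidAlgebra R (GL (Fin n) F)) 𝔸}
    {ψ : AddChar F R} {k : Fin n} {J J' : ℕ → Prop} {x : 𝔸}
    (hx : IsLateEigen N ψ (k + 1) J x) (hJ : ∀ i : ℕ, i + 1 ≠ (k : ℕ) → (J' i ↔ J i))
    (hc : ∀ a, GowSteinberg.translate (columnGL k a) x = ψ (supportSum J' (columnGL k a)) • x) :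
    IsLateEigen N ψ k J' x := fun u hu ↦ by
  set v := u * columnGL k (fun i ↦ -u.val i k) with hv
  have hvl : IsLateUnitri n F (k + 1) v := hu.factor
  have huv : u = v * columnGL k (fun i ↦ u.val i k) := by
    rw [hv, mul_assoc, columnGL_mul_columnGL, columnGL_zero, mul_one]
    intro i _
    simp
  have hs : supportSum J' v = supportSum J v := by
    refine Finset.sum_congr rfl fun i _ ↦ Finset.sum_congr rfl fun j _ ↦ ?_
    by_cases hik : (i : ℕ) + 1 = k
    · by_cases hij : (j : ℕ) = i + 1
      · have : v.val i j = 0 := hvl.2 i j (by omega) (by rintro rfl; omega)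
        simp [this]
      · simp [hij]
    · classical exact if_congr (and_congr Iff.rfl (hJ i hik)) rfl rfl
  have h1 := hx v hvl
  rw [huv, translate_mul, hc, map_smul, supportSum_mul J' hvl.1 (columnGL_mem_unitri _ _), hs,
    AddChar.map_add_eq_mul, mul_comm, mul_smul, ← smul_sub]
  exact Submodule.smul_of_tower_mem N _ h1

/-- The Fourier components `P c` of `x` under the column group sum to a unit multiple of `x`, so one
of them is outside `N`. They remain eigenvectors for the later columns, because column elements are
mirabolic. -/
lemma exists_isLateEigen_step {M N : Submodule (MonoidAlgebra R (GL (Fin n) F)) 𝔸}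
    {ψ : AddChar F R} (hψ : ψ ≠ 1) (hq : IsUnit (Nat.card F : R)) {k : Fin n} {J : ℕ → Prop}
    {x : 𝔸} (hxM : x ∈ M) (hxN : x ∉ N) (hx : IsLateEigen N ψ (k + 1) J x) :
    ∃ J' : ℕ → Prop, ∃ y ∈ M, y ∉ N ∧ IsLateEigen N ψ k J' y := by
  classical
  have := Fintype.ofFinite F
  let P : (Fin n → F) → 𝔸 := fun c ↦
    ∑ a : Fin n → F, ψ (-headDot k c a) • translate (columnGL k a) x
  have hPM : ∀ c, P c ∈ M := fun c ↦ sum_mem fun a _ ↦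
    Submodule.smul_of_tower_mem _ _ (translate_mem M _ hxM)
  have hPe : ∀ c, IsLateEigen N ψ (k + 1) J (P c) := fun c ↦ IsLateEigen.sum _ fun a _ ↦
    (hx.translate (isMirabolic_columnGL k a)).smul _
  have hPc : ∀ c a, translate (columnGL k a) (P c) = ψ (headDot k c a) • P c := fun c a ↦ by
    simp only [P, map_sum, Finset.smul_sum]
    refine Fintype.sum_equiv (Equiv.addLeft a) _ _ fun a' ↦ ?_
    rw [map_smul, ← translate_mul, columnGL_mul_columnGL, Equiv.coe_addLeft, smul_smul,
      ← AddChar.map_add_eq_mul, headDot_add_right]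
    congr 2
    ring
  have hPsum : ∑ c, P c = ((Nat.card F : R) ^ n *
      ((Finset.univ.filter fun a : Fin n → F ↦ ∀ i < k, a i = 0).card : R)) • x := by
    simp only [P]
    rw [Finset.sum_comm]
    simp only [← Finset.sum_smul, sum_headDot hψ, ite_smul, zero_smul]
    rw [← Finset.sum_filter, Finset.sum_congr rfl (g := fun _ ↦ (Nat.card F : R) ^ n • x),
      Finset.sum_const, mul_comm, mul_smul, Nat.cast_smul_eq_nsmul]
    intro a ha
    rw [columnGL_zero k a (Finset.mem_filter.1 ha).2, translate_one, Nat.card_eq_fintype_card]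
  -- The column group is indexed by functions on all of `Fin n`, although only the entries before
  -- `k` matter; the overcount is a power of `q`.
  have hcard : IsUnit ((Finset.univ.filter fun a : Fin n → F ↦ ∀ i < k, a i = 0).card : R) := by
    have : (Finset.univ.filter fun a : Fin n → F ↦ ∀ i < k, a i = 0) =
        Fintype.piFinset fun i : Fin n ↦ if i < k then {0} else Finset.univ := by
      ext a
      simp only [Finset.mem_filter, Finset.mem_univ, true_and, Fintype.mem_piFinset]
      refine forall_congr' fun i ↦ ?_
      split_ifs with h <;> simp [h]
    rw [this, Fintype.card_piFinset, Nat.cast_prod]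
    refine IsUnit.prod_iff.2 fun i _ ↦ ?_
    split_ifs
    · simp
    · rw [Finset.card_univ, ← Nat.card_eq_fintype_card]; exact hq
  obtain ⟨c, hc⟩ : ∃ c, P c ∉ N := by
    by_contra! h
    apply hxN
    rw [← smul_mem_iff_of_isUnit N ((hq.pow n).mul hcard), ← hPsum]
    exact sum_mem fun c _ ↦ h c
  -- For the trivial character the position `k - 1` is left out of the support. Otherwise an element
  -- of `GL_k` with last row `c` moves the character to the one that reads the entry in row `k - 1`.
  by_cases hc0 : ∀ i < k, c i = 0
  · refine ⟨fun i ↦ i + 1 ≠ (k : ℕ) ∧ J i, P c, hPM c, hc, (hPe c).step ?_ fun a ↦ ?_⟩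
    · intro i hi
      simp [hi]
    · rw [hPc, supportSum_columnGL]
      congr 2
      rw [headDot, Finset.sum_eq_zero, Finset.sum_eq_zero]
      · intro i _
        rw [if_neg]
        rintro ⟨h1, h2, _⟩
        exact h2 h1.symm
      · intro l _
        split_ifs with hl
        · rw [hc0 l hl, zero_mul]
        · rfl
  · push Not at hc0
    obtain ⟨i₀, hi₀, hci₀⟩ := hc0
    obtain ⟨g, hg, hrow⟩ := exists_mirabolic_row k hi₀ hci₀
    refine ⟨fun i ↦ i + 1 = (k : ℕ) ∨ J i, translate g (P c), translate_mem M _ (hPM c),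
      fun h ↦ hc (translate_mem_iff.1 h), ((hPe c).translate hg).step ?_ fun a ↦ ?_⟩
    · intro i hi
      simp [hi]
    · obtain ⟨a', ha', hsum⟩ := columnGL_mul_eq k hg a
      rw [← translate_mul, ha', translate_mul, hPc, map_smul, supportSum_columnGL]
      congr 2
      rw [Fin.lt_def] at hi₀
      let m : Fin n := ⟨k - 1, by omega⟩
      have hm : (m : ℕ) + 1 = k := by simp only [m]; omega
      rw [Finset.sum_eq_single m]
      · rw [if_pos ⟨hm.symm, Or.inl hm⟩, ← hsum m (by rw [Fin.lt_def]; omega), headDot]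
        refine Finset.sum_congr rfl fun l _ ↦ ?_
        rw [hrow m hm]
        split_ifs <;> rfl
      · intro i _ hi
        rw [if_neg]
        rintro ⟨h1, _⟩
        exact hi (Fin.ext (by omega))
      · simp

lemma exists_isLateEigen_zero {M N : Submodule (MonoidAlgebra R (GL (Fin n) F)) 𝔸}
    {ψ : AddChar F R} (hψ : ψ ≠ 1) (hq : IsUnit (Nat.card F : R)) (hMN : ¬ M ≤ N) :
    ∃ J : ℕ → Prop, ∃ x ∈ M, x ∉ N ∧ IsLateEigen N ψ 0 J x := by
  obtain ⟨x, hxM, hxN⟩ := SetLike.not_le_iff_exists.1 hMN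
  have key : ∀ m ≤ n, ∃ J : ℕ → Prop, ∃ x ∈ M, x ∉ N ∧ IsLateEigen N ψ (n - m) J x := by
    intro m
    -- The induction goes down from column `n`, where only the identity matrix is left.
    induction m with
    | zero =>
      refine fun _ ↦ ⟨fun _ ↦ False, x, hxM, hxN, fun u hu ↦ ?_⟩
      have : u = 1 := by
        ext i j
        rw [Units.val_one, Matrix.one_apply]
        split_ifs with h
        · rw [h, hu.1.2]
        · exact hu.2 i j (by omega) h
      have hs : supportSum (fun _ ↦ False) u = 0 := by simp [supportSum]
      rw [hs, this, translate_one, AddChar.map_zero_eq_one, one_smul, sub_self]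
      exact zero_mem _
    | succ m ih =>
      intro hm
      obtain ⟨J, y, hyM, hyN, hy⟩ := ih (by omega)
      let k : Fin n := ⟨n - (m + 1), by omega⟩
      have hk : n - m = k + 1 := by simp only [k]; omega
      rw [hk] at hy
      exact exists_isLateEigen_step hψ hq hyM hyN hy
  have := key n le_rfl
  rwa [Nat.sub_self] at this

/-- The blocks are the maximal runs linked by `J`: a new first position either enlarges the first
block or forms a block of size one. -/
lemma exists_list_blockIndex (n : ℕ) (J : ℕ → Prop) : ∃ l : List ℕ, (∀ x ∈ l, 0 < x) ∧
    l.sum = n ∧ ∀ i, i + 1 < n → (blockIndex l i = blockIndex l (i + 1) ↔ J i) := by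
  induction n generalizing J with
  | zero => exact ⟨[], by simp, by simp, by omega⟩
  | succ n ih =>
    obtain ⟨l, hpos, hsum, hl⟩ := ih fun i ↦ J (i + 1)
    by_cases h0 : J 0 ∧ l ≠ []
    · obtain ⟨h0, hne⟩ := h0
      obtain ⟨x, l', rfl⟩ := List.exists_cons_of_ne_nil hne
      simp only [List.mem_cons, forall_eq_or_imp, List.sum_cons] at hpos hsum
      refine ⟨(x + 1) :: l', ?_, ?_, ?_⟩
      · simp only [List.mem_cons, forall_eq_or_imp]
        exact ⟨by omega, hpos.2⟩
      · rw [List.sum_cons]; omega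
      · have hshift : ∀ i, blockIndex ((x + 1) :: l') (i + 1) = blockIndex (x :: l') i := fun i ↦ by
          simp only [blockIndex, Nat.add_lt_add_iff_right, Nat.add_sub_add_right]
        intro i hi
        cases i with
        | zero =>
          rw [hshift]
          simp [blockIndex, hpos.1, h0]
        | succ i => rw [hshift, hshift, hl i (by omega)]
    · refine ⟨1 :: l, ?_, ?_, ?_⟩
      · simp only [List.mem_cons, forall_eq_or_imp]
        exact ⟨by omega, hpos⟩
      · rw [List.sum_cons]; omega
      · have hshift : ∀ i, blockIndex (1 :: l) (i + 1) = blockIndex l i + 1 := fun i ↦ by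
          simp [blockIndex]
        intro i hi
        cases i with
        | zero =>
          rw [hshift]
          have hne : l ≠ [] := by
            rintro rfl
            simp at hsum; omega
          have : ¬ J 0 := fun h ↦ h0 ⟨h, hne⟩
          simp [blockIndex, this]
        | succ i => rw [hshift, hshift, ← hl i (by omega)]; omega

/-- Every nonzero section of the Steinberg lattice that is killed by a suitable prime contains the
eigenvector of a linear character of `U`. -/
theorem exists_whittaker_mem {M N : Submodule (MonoidAlgebra R (GL (Fin n) F)) 𝔸}
    {ψ : AddChar F R} (hψ : ψ ≠ 1) (hq : IsUnit (Nat.card F : R)) (hMN : ¬ M ≤ N)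
    (hM : M ≤ lattice n F R) (hN : ∀ r : R, ¬ IsUnit r → ∀ x ∈ lattice n F R, r • x ∈ N) :
    ∃ l : List ℕ, (∀ x ∈ l, 0 < x) ∧ l.sum = n ∧ whittaker ψ (blockLabel n l) ∈ M ∧
      whittaker ψ (blockLabel n l) ∉ N := by
  obtain ⟨J, x, hxM, hxN, hx⟩ := exists_isLateEigen_zero hψ hq hMN
  obtain ⟨l, hpos, hsum, hl⟩ := exists_list_blockIndex n J
  have hs : ∀ u : GL (Fin n) F, superSum (blockLabel n l) u = supportSum J u := fun u ↦ by
    refine Finset.sum_congr rfl fun i _ ↦ Finset.sum_congr rfl fun j _ ↦ ?_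
    by_cases hij : (j : ℕ) = i + 1
    · have := hl i (by omega)
      rw [← hij] at this
      classical exact if_congr (and_congr Iff.rfl this) rfl rfl
    · simp [hij]
  -- Modulo `N` the vector `x` is an eigenvector, so its projection is congruent to `|U| x`, and
  -- `|U|` is a unit.
  have hproj : charProj ψ (blockLabel n l) x ∉ N := fun h ↦ by
    apply hxN
    have hU : IsUnit (Nat.card (unitri n F) : R) := by
      rw [card_unitri, Nat.cast_pow]; exact hq.pow _
    rw [← smul_mem_iff_of_isUnit N hU]
    have h1 : charProj ψ (blockLabel n l) x - (Nat.card (unitri n F) : R) • x ∈ N := by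
      have : charProj ψ (blockLabel n l) x - (Nat.card (unitri n F) : R) • x =
          ∑ u : unitri n F, ψ (-supportSum J u.1) •
            (translate u.1 x - ψ (supportSum J u.1) • x) := by
        simp only [smul_sub, smul_smul, ← AddChar.map_add_eq_mul, neg_add_cancel,
          AddChar.map_zero_eq_one, one_smul, Finset.sum_sub_distrib, charProj_apply, hs,
          Finset.sum_const, Finset.card_univ, Nat.card_eq_fintype_card, Nat.cast_smul_eq_nsmul]
      rw [this]
      exact sum_mem fun u _ ↦ Submodule.smul_of_tower_mem N _
        (hx u.1 ⟨u.2, fun i j hj ↦ absurd hj (Nat.not_lt_zero _)⟩)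
    simpa using sub_mem h h1
  obtain ⟨r, hr⟩ := exists_charProj_eq_smul ψ (blockLabel n l) (hM hxM)
  have hMr := charProj_mem M ψ (blockLabel n l) hxM
  rw [hr] at hproj hMr
  have hru : IsUnit r := by
    by_contra h
    exact hproj (hN r h _ (whittaker_mem _ _))
  rw [smul_mem_iff_of_isUnit _ hru] at hproj hMr
  exact ⟨l, hpos, hsum, hMr, hproj⟩

end Existence

/-! ### Orders of linear groups and parabolic subgroups -/

section Order

lemma padicValNat_prod {ι : Type*} {ℓ : ℕ} [Fact ℓ.Prime] (s : Finset ι) (f : ι → ℕ)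
    (h : ∀ i ∈ s, f i ≠ 0) : padicValNat ℓ (∏ i ∈ s, f i) = ∑ i ∈ s, padicValNat ℓ (f i) := by
  classical
  induction s using Finset.induction_on with
  | empty => simp
  | insert i s hi ih =>
    rw [Finset.prod_insert hi, Finset.sum_insert hi, padicValNat.mul (h i (s.mem_insert_self i))
      (Finset.prod_ne_zero_iff.2 fun j hj ↦ h j (Finset.mem_insert_of_mem hj)),
      ih fun j hj ↦ h j (Finset.mem_insert_of_mem hj)]

lemma nat_card_GL_congr {m m' F : Type*} [Fintype m] [DecidableEq m] [Fintype m'] [DecidableEq m']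
    [Field F] (h : Fintype.card m = Fintype.card m') : Nat.card (GL m F) = Nat.card (GL m' F) :=
  Nat.card_congr (Units.mapEquiv
    (Matrix.reindexAlgEquiv F F (Fintype.equivOfCardEq h)).toMulEquiv).toEquiv

lemma nat_card_det_ne_zero (m F : Type*) [Fintype m] [DecidableEq m] [Field F] :
    Nat.card {M : Matrix m m F // M.det ≠ 0} = Nat.card (GL m F) :=
  Nat.card_congr
    { toFun M := Matrix.GeneralLinearGroup.mkOfDetNeZero M.1 M.2
      invFun g := ⟨g.val, (Matrix.isUnit_iff_isUnit_det _).1 g.isUnit |>.ne_zero⟩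
      left_inv _ := rfl
      right_inv _ := Units.ext rfl }

variable {n : ℕ} {F : Type*} [Field F] {α : Type*} [LinearOrder α] [Fintype α]

/-- A block upper triangular matrix is given by its invertible diagonal blocks and by the entries
above them. -/
def blockUpperEquiv (b : Fin n → α) : (blockUpper b : Subgroup (GL (Fin n) F)) ≃
    (∀ k : α, {M : Matrix {i // b i = k} {i // b i = k} F // M.det ≠ 0}) ×
      ({p : Fin n × Fin n // b p.1 < b p.2} → F) where
  toFun g := (fun k ↦ ⟨g.1.val.toSquareBlock b k, by
    have h := ((Matrix.isUnit_iff_isUnit_det _).1 g.1.isUnit).ne_zero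
    rw [Matrix.BlockTriangular.det_fintype (show g.1.val.BlockTriangular b from g.2)] at h
    exact Finset.prod_ne_zero_iff.1 h k (Finset.mem_univ k)⟩, fun p ↦ g.1.val p.1.1 p.1.2)
  invFun x :=
    let M : Matrix (Fin n) (Fin n) F := Matrix.of fun i j ↦
      if h : b j = b i then (x.1 (b i)).1 ⟨i, rfl⟩ ⟨j, h⟩ else
        if h : b i < b j then x.2 ⟨(i, j), h⟩ else 0
    have hM : M.BlockTriangular b := fun i j hij ↦ by
      simp only [M, Matrix.of_apply]
      rw [dif_neg hij.ne, dif_neg hij.asymm]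
    ⟨Matrix.GeneralLinearGroup.mkOfDetNeZero M (by
      rw [hM.det_fintype]
      refine Finset.prod_ne_zero_iff.2 fun k _ ↦ ?_
      convert (x.1 k).2
      ext ⟨i, hi⟩ ⟨j, hj⟩
      subst hi
      simp only [M, Matrix.toSquareBlock_def, Matrix.of_apply]
      rw [dif_pos hj]), hM⟩
  left_inv g := by
    refine Subtype.ext (Units.ext ?_)
    ext i j
    change (if h : b j = b i then g.1.val i j else if h : b i < b j then g.1.val i j else 0) = _
    split_ifs with h1 h2
    · rfl
    · rfl
    · exact (g.2 (lt_of_le_of_ne (not_lt.1 h2) h1)).symm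
  right_inv x := by
    refine Prod.ext ?_ ?_
    · funext k
      refine Subtype.ext ?_
      ext ⟨i, hi⟩ ⟨j, hj⟩
      subst hi
      change (if h : b j = b i then (x.1 (b i)).1 ⟨i, rfl⟩ ⟨j, h⟩ else _) = _
      rw [dif_pos hj]
    · funext ⟨⟨i, j⟩, hij⟩
      change (if h : b j = b i then (x.1 (b i)).1 ⟨i, rfl⟩ ⟨j, h⟩ else
        if h : b i < b j then x.2 ⟨(i, j), h⟩ else 0) = _
      have hij' : b i < b j := hij
      rw [dif_neg hij'.ne', dif_pos hij']

lemma card_blockUpper_eq_prod (b : Fin n → α) :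
    Nat.card (blockUpper b : Subgroup (GL (Fin n) F)) =
      (∏ k : α, Nat.card (GL (Fin (Fintype.card {i // b i = k})) F)) *
        Nat.card F ^ Nat.card {p : Fin n × Fin n // b p.1 < b p.2} := by
  rw [Nat.card_congr (blockUpperEquiv b), Nat.card_prod, Nat.card_pi, Nat.card_fun]
  congr 1
  refine Finset.prod_congr rfl fun k _ ↦ ?_
  rw [nat_card_det_ne_zero]
  exact nat_card_GL_congr (by simp)

lemma card_fiber_index (a : Composition n) (k : Fin a.length) :
    Fintype.card {i // a.index i = k} = a.blocksFun k := by
  rw [← Fintype.card_fin (a.blocksFun k)]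
  refine Fintype.card_congr
    { toFun i := Fin.cast (by rw [i.2]) (a.invEmbedding i.1)
      invFun j := ⟨a.embedding k j, a.index_embedding k j⟩
      left_inv := ?_
      right_inv := ?_ }
  · rintro ⟨i, rfl⟩
    exact Subtype.ext (a.embedding_comp_inv i)
  · intro j
    apply Fin.ext
    simp [Composition.coe_invEmbedding, a.index_embedding, a.coe_embedding]

/-- The valuation of `(q - 1) (q² - 1) ⋯ (q^m - 1)`. -/
def orderVal (ℓ q m : ℕ) : ℕ := ∑ j ∈ Finset.range m, padicValNat ℓ (q ^ (j + 1) - 1)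

lemma padicValNat_card_GL [Finite F] {ℓ : ℕ} [Fact ℓ.Prime] (hq : ¬ ℓ ∣ Nat.card F) (m : ℕ) :
    padicValNat ℓ (Nat.card (GL (Fin m) F)) = orderVal ℓ (Nat.card F) m := by
  have := Fintype.ofFinite F
  have h1 : 1 < Nat.card F := Finite.one_lt_card
  have hne : ∀ j, Nat.card F ^ (j + 1) - 1 ≠ 0 := fun j ↦
    Nat.sub_ne_zero_of_lt (Nat.one_lt_pow (Nat.succ_ne_zero j) h1)
  rw [Matrix.card_GL_field, orderVal, ← Nat.card_eq_fintype_card, ← Finset.prod_range fun i ↦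
    Nat.card F ^ m - Nat.card F ^ i, ← Finset.prod_range_reflect, padicValNat_prod]
  · refine Finset.sum_congr rfl fun j hj ↦ ?_
    rw [Finset.mem_range] at hj
    have : Nat.card F ^ m - Nat.card F ^ (m - 1 - j) =
        Nat.card F ^ (m - 1 - j) * (Nat.card F ^ (j + 1) - 1) := by
      rw [Nat.mul_sub, mul_one, ← pow_add]
      congr 2; omega
    rw [this, padicValNat.mul (by positivity) (hne j), padicValNat.pow,
      padicValNat.eq_zero_of_not_dvd hq, mul_zero, zero_add]
  · intro j hj
    rw [Finset.mem_range] at hj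
    exact Nat.sub_ne_zero_of_lt (Nat.pow_lt_pow_right h1 (by omega))

/-- Only the Levi factor matters, since the entries above the blocks contribute a power of `q`. The
additive form avoids truncated subtraction. -/
lemma padicValNat_index_parabolic [Finite F] {ℓ : ℕ} [Fact ℓ.Prime] (hq : ¬ ℓ ∣ Nat.card F)
    (a : Composition n) :
    padicValNat ℓ (parabolic a : Subgroup (GL (Fin n) F)).index +
      (a.blocks.map (orderVal ℓ (Nat.card F))).sum = orderVal ℓ (Nat.card F) n := by
  have hpos : 0 < Nat.card F := Nat.card_pos
  have h := (parabolic a : Subgroup (GL (Fin n) F)).index_mul_card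
  apply_fun padicValNat ℓ at h
  rw [padicValNat_card_GL hq, parabolic, card_blockUpper_eq_prod,
    padicValNat.mul Subgroup.index_ne_zero_of_finite
      (mul_ne_zero (Finset.prod_ne_zero_iff.2 fun _ _ ↦ Nat.card_pos.ne')
        (pow_ne_zero _ hpos.ne')),
    padicValNat.mul (Finset.prod_ne_zero_iff.2 fun _ _ ↦ Nat.card_pos.ne')
      (pow_ne_zero _ hpos.ne'), padicValNat.pow,
    padicValNat.eq_zero_of_not_dvd hq, mul_zero, add_zero,
    padicValNat_prod _ _ (fun _ _ ↦ Nat.card_pos.ne')] at h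
  rw [← h]
  congr 1
  rw [← a.ofFn_blocksFun, List.map_ofFn, List.sum_ofFn]
  refine Finset.sum_congr rfl fun k _ ↦ ?_
  rw [padicValNat_card_GL hq, Function.comp_apply, card_fiber_index]

lemma Composition.coe_index_eq_blockIndex (a : Composition n) (i : Fin n) :
    (a.index i : ℕ) = blockIndex a.blocks i := by
  have key : ∀ (l : List ℕ) (k j : ℕ), (l.take k).sum ≤ j → j < (l.take (k + 1)).sum →
      k = blockIndex l j := by
    intro l
    induction l with
    | nil => intro k j _ h; simp at h
    | cons x l ih =>
      intro k j h1 h2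
      cases k with
      | zero =>
        rw [blockIndex, if_pos (by simpa using h2)]
      | succ k =>
        rw [List.take_succ_cons, List.sum_cons] at h1 h2
        rw [blockIndex, if_neg (by omega), ← ih k (j - x) (by omega) (by omega)]
  exact key _ _ _ (a.sizeUpTo_index_le i) (a.lt_sizeUpTo_index_succ i)

lemma parabolic_eq_blockUpper (a : Composition n) :
    (parabolic a : Subgroup (GL (Fin n) F)) = blockUpper (blockLabel n a.blocks) := by
  ext g
  refine forall_congr' fun i ↦ forall_congr' fun j ↦ imp_congr_left ?_
  rw [Fin.lt_def, Composition.coe_index_eq_blockIndex, Composition.coe_index_eq_blockIndex]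
  rfl

end Order

/-! ### Valuations of `q`-integers and the combinatorics of partitions -/

section Arithmetic

/-- The `q`-analogue of `m`. -/
def qInt (q m : ℕ) : ℕ := ∑ j ∈ Finset.range m, q ^ j

lemma qInt_add (q a b : ℕ) : qInt q (a + b) = qInt q a + q ^ a * qInt q b := by
  rw [qInt, Finset.sum_range_add, qInt, qInt, Finset.mul_sum]
  simp only [pow_add]

lemma qInt_mul (q a b : ℕ) : qInt q (a * b) = qInt q a * qInt (q ^ a) b := by
  induction b with
  | zero => simp [qInt]
  | succ b ih =>
    rw [Nat.mul_succ, qInt_add, ih, qInt_add, mul_add, ← pow_mul]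
    simp [qInt, mul_comm]

lemma qInt_pos {q m : ℕ} (hm : m ≠ 0) : 0 < qInt q m := by
  obtain ⟨m, rfl⟩ := Nat.exists_eq_succ_of_ne_zero hm
  rw [qInt, Finset.sum_range_succ']
  simp

lemma sub_one_mul_qInt {q : ℕ} (hq : 1 < q) (m : ℕ) : (q - 1) * qInt q m = q ^ m - 1 := by
  rw [qInt, Nat.geomSum_eq hq, Nat.mul_div_cancel' (by simpa using Nat.sub_dvd_pow_sub_pow q 1 m)]

variable {ℓ q : ℕ} [hℓ : Fact ℓ.Prime]

omit hℓ in
lemma modEq_one_of_dvd_qInt (hq1 : 1 < q) {a : ℕ} (h : ℓ ∣ qInt q a) : q ^ a ≡ 1 [MOD ℓ] := by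
  have h1 : ℓ ∣ q ^ a - 1 := by rw [← sub_one_mul_qInt hq1]; exact h.mul_left _
  exact ((Nat.modEq_iff_dvd' (Nat.one_le_pow _ _ (by omega))).2 h1).symm

omit hℓ in
lemma qInt_modEq_self {Q : ℕ} (hQ : Q ≡ 1 [MOD ℓ]) (k : ℕ) : qInt Q k ≡ k [MOD ℓ] := by
  induction k with
  | zero => rfl
  | succ k ih =>
    rw [qInt, Finset.sum_range_succ]
    have := hQ.pow k
    rw [one_pow] at this
    exact ih.add this

omit hℓ in
lemma gowE_eq (hq1 : 1 < q) : gowE ℓ q = sInf {i : ℕ | 2 ≤ i ∧ ℓ ∣ qInt q i} := by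
  simp only [gowE, qInt, Nat.geomSum_eq hq1]

lemma gowE_spec (hq1 : 1 < q) (hq : ¬ ℓ ∣ q) : 2 ≤ gowE ℓ q ∧ ℓ ∣ qInt q (gowE ℓ q) := by
  have hne : {i : ℕ | 2 ≤ i ∧ ℓ ∣ qInt q i}.Nonempty := by
    have h2 := hℓ.out.two_le
    -- By Fermat `q ^ (ℓ - 1) ≡ 1`, and the extra factor `ℓ` is needed because the `q`-integer of `ℓ
    -- - 1` need not vanish modulo `ℓ` when `q ≡ 1`.
    refine ⟨(ℓ - 1) * ℓ, by nlinarith [Nat.sub_add_cancel hℓ.out.one_le], ?_⟩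
    rw [qInt_mul]
    refine Dvd.dvd.mul_left ?_ _
    have h := Nat.ModEq.pow_totient ((Nat.Prime.coprime_iff_not_dvd hℓ.out).2 hq).symm
    rw [Nat.totient_prime hℓ.out] at h
    exact (Nat.modEq_zero_iff_dvd.1 ((qInt_modEq_self h ℓ).trans (by simp [Nat.ModEq])))
  rw [gowE_eq hq1]
  exact Nat.sInf_mem hne

lemma gowE_pos (hq1 : 1 < q) (hq : ¬ ℓ ∣ q) : 0 < gowE ℓ q := by
  have := (gowE_spec hq1 hq).1
  omega

lemma dvd_qInt_iff (hq1 : 1 < q) (hq : ¬ ℓ ∣ q) (j : ℕ) : ℓ ∣ qInt q j ↔ gowE ℓ q ∣ j := by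
  obtain ⟨h2, he⟩ := gowE_spec hq1 hq
  induction j using Nat.strong_induction_on with
  | _ j ih =>
    by_cases hj : j < gowE ℓ q
    · rcases Nat.lt_or_ge j 2 with hj2 | hj2
      · interval_cases j
        · simp [qInt]
        · simp only [qInt, Finset.range_one, Finset.sum_singleton, pow_zero, Nat.dvd_one]
          have := hℓ.out.one_lt
          omega
      · have h1 : ¬ ℓ ∣ qInt q j := fun h ↦ by
          rw [gowE_eq hq1] at hj
          exact Nat.notMem_of_lt_sInf hj ⟨hj2, h⟩
        refine iff_of_false h1 fun h ↦ ?_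
        have := Nat.le_of_dvd (by omega) h
        omega
    · obtain ⟨i, rfl⟩ := Nat.exists_eq_add_of_le (not_lt.1 hj)
      rw [qInt_add, Nat.dvd_add_right he, Nat.dvd_add_right dvd_rfl, ← ih i (by omega)]
      refine ⟨fun h ↦ ?_, fun h ↦ h.mul_left _⟩
      rcases (Nat.Prime.dvd_mul hℓ.out).1 h with h | h
      · exact absurd (hℓ.out.dvd_of_dvd_pow h) hq
      · exact h

/-- Lifting the exponent. For `ℓ = 2` and even `k` the formula involves `Q + 1`, and the congruence
modulo `4` makes its valuation `1`. -/
lemma padicValNat_qInt_of_modEq {Q : ℕ} (hQ1 : 1 < Q) (hQ : Q ≡ 1 [MOD ℓ])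
    (h2 : ℓ = 2 → Q ≡ 1 [MOD 4]) {k : ℕ} (hk : k ≠ 0) :
    padicValNat ℓ (qInt Q k) = padicValNat ℓ k := by
  have hndvd : ¬ ℓ ∣ Q := fun h ↦ by
    have := (Nat.modEq_zero_iff_dvd.2 h).symm.trans hQ
    exact hℓ.out.one_lt.ne' (Nat.dvd_one.1 (Nat.modEq_zero_iff_dvd.1 this.symm))
  have hdvd : ℓ ∣ Q - 1 := (Nat.modEq_iff_dvd' hQ1.le).1 hQ.symm
  have hmul := congrArg (padicValNat ℓ) (sub_one_mul_qInt hQ1 k)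
  rw [padicValNat.mul (Nat.sub_ne_zero_of_lt hQ1) (qInt_pos hk).ne'] at hmul
  rcases hℓ.out.eq_two_or_odd' with rfl | hodd
  · by_cases hke : Even k
    · have h3 := padicValNat.pow_two_sub_one hQ1 hndvd hk hke
      have h4 : padicValNat 2 (Q + 1) = 1 := by
        have h5 : Q % 4 = 1 := h2 rfl
        have h6 : Q + 1 = 2 ^ 1 * ((Q + 1) / 2) := by
          omega
        rw [h6, padicValNat_base_pow_mul,
          padicValNat.eq_zero_of_not_dvd (by omega)]
        all_goals omega
      omega
    · have h3 : ¬ 2 ∣ k := fun h ↦ hke (even_iff_two_dvd.2 h)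
      rw [padicValNat.eq_zero_of_not_dvd h3, padicValNat.eq_zero_of_not_dvd]
      intro h
      exact h3 ((qInt_modEq_self hQ k).dvd_iff dvd_rfl |>.1 h)
  · have h3 := padicValNat.pow_sub_pow hodd hQ1 hdvd hndvd hk
    rw [one_pow] at h3
    omega

lemma gowE_two (hq1 : 1 < q) (hq : ¬ 2 ∣ q) : gowE 2 q = 2 := by
  have : Fact (Nat.Prime 2) := ⟨Nat.prime_two⟩
  refine le_antisymm ?_ (gowE_spec hq1 hq).1
  refine Nat.le_of_dvd two_pos ((dvd_qInt_iff hq1 hq 2).1 ?_)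
  simp [qInt, Finset.sum_range_succ]
  omega

lemma padicValNat_qInt (hq1 : 1 < q) (hq : ¬ ℓ ∣ q) {k : ℕ} (hk : k ≠ 0) :
    padicValNat ℓ (qInt q (gowE ℓ q * k)) = gowD ℓ q + padicValNat ℓ k := by
  obtain ⟨h2, he⟩ := gowE_spec hq1 hq
  rw [qInt_mul, padicValNat.mul (qInt_pos (by omega)).ne' (qInt_pos hk).ne',
    padicValNat_qInt_of_modEq (Nat.one_lt_pow (by omega) hq1) (modEq_one_of_dvd_qInt hq1 he) _ hk,
    gowD, ← Nat.geomSum_eq hq1]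
  · rfl
  -- For `ℓ = 2` one has `e = 2`, and the square of an odd number is `1` modulo `4`.
  · rintro rfl
    rw [gowE_two hq1 hq]
    have : q % 4 = 1 ∨ q % 4 = 3 := by omega
    unfold Nat.ModEq
    rw [pow_two, Nat.mul_mod]
    rcases this with h | h <;> rw [h]

/-- The valuation of the `q`-factorial of `m`. -/
def qFactVal (ℓ q m : ℕ) : ℕ :=
  gowD ℓ q * (m / gowE ℓ q) + padicValNat ℓ (m / gowE ℓ q).factorial

/-- The linear term cancels in the index of a parabolic subgroup, as the block sizes add up to `n`;
only `qFactVal` remains. -/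
lemma orderVal_eq (hq1 : 1 < q) (hq : ¬ ℓ ∣ q) (m : ℕ) :
    orderVal ℓ q m = m * padicValNat ℓ (q - 1) + qFactVal ℓ q m := by
  induction m with
  | zero => simp [orderVal, qFactVal]
  | succ m ih =>
    rw [orderVal, Finset.sum_range_succ, ← orderVal, ih, ← sub_one_mul_qInt hq1,
      padicValNat.mul (Nat.sub_ne_zero_of_lt hq1) (qInt_pos m.succ_ne_zero).ne']
    have hdiv : (m + 1) / gowE ℓ q = m / gowE ℓ q + if gowE ℓ q ∣ m + 1 then 1 else 0 :=
      Nat.succ_div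
    by_cases h : gowE ℓ q ∣ m + 1
    · rw [if_pos h] at hdiv
      obtain ⟨k, hk⟩ := h
      have hk0 : k ≠ 0 := by rintro rfl; omega
      have hmk : m / gowE ℓ q + 1 = k := by
        rw [← hdiv, hk, Nat.mul_div_cancel_left _ (gowE_pos hq1 hq)]
      have h3 : padicValNat ℓ (qInt q (m + 1)) = gowD ℓ q + padicValNat ℓ k := by
        rw [hk, padicValNat_qInt hq1 hq hk0]
      have h4 : padicValNat ℓ k.factorial =
          padicValNat ℓ k + padicValNat ℓ (m / gowE ℓ q).factorial := by
        rw [← hmk, Nat.factorial_succ,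
          padicValNat.mul (Nat.succ_ne_zero _) (Nat.factorial_ne_zero _)]
      simp only [qFactVal, hdiv, hmk, h4, h3]
      rw [← hmk]
      ring
    · have h3 : padicValNat ℓ (qInt q (m + 1)) = 0 :=
        padicValNat.eq_zero_of_not_dvd (mt (dvd_qInt_iff hq1 hq _).1 h)
      rw [if_neg h, add_zero] at hdiv
      simp only [qFactVal, hdiv, h3]
      ring

/-- Some inner binomial coefficient of `k` is prime to `ℓ`: take `j = 1` if `ℓ` does not divide `k`,
and otherwise scale a splitting of `k / ℓ`. -/
lemma exists_factorial_split (k : ℕ) (hk0 : k ≠ 0) (hk : ∀ i, k ≠ ℓ ^ i) : ∃ j, 0 < j ∧ j < k ∧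
    padicValNat ℓ j.factorial + padicValNat ℓ (k - j).factorial = padicValNat ℓ k.factorial := by
  induction k using Nat.strong_induction_on with
  | _ k ih =>
    have h1 : k ≠ 1 := by simpa using hk 0
    by_cases h : ℓ ∣ k
    · obtain ⟨k, rfl⟩ := h
      have h2 := hℓ.out.two_le
      have hk' : k ≠ 0 := by rintro rfl; simp at hk0
      obtain ⟨j, hj0, hj, hs⟩ := ih k (by nlinarith [Nat.pos_of_ne_zero hk']) hk'
        fun i hi ↦ hk (i + 1) (by rw [hi, pow_succ'])
      refine ⟨ℓ * j, by positivity, Nat.mul_lt_mul_of_pos_left hj (by omega), ?_⟩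
      rw [← Nat.mul_sub, padicValNat_factorial_mul, padicValNat_factorial_mul,
        padicValNat_factorial_mul]
      omega
    · refine ⟨1, one_pos, by omega, ?_⟩
      obtain ⟨k, rfl⟩ := Nat.exists_eq_succ_of_ne_zero hk0
      rw [Nat.factorial_succ k, padicValNat.mul k.succ_ne_zero (Nat.factorial_ne_zero k),
        padicValNat.eq_zero_of_not_dvd h]
      simp

/-- A multiple of `e` is split through its quotient by `e`; below `e` all valuations vanish; in the
remaining case the residue modulo `e` is split off at no cost. -/
lemma exists_qFactVal_split (hq1 : 1 < q) (hq : ¬ ℓ ∣ q) {m : ℕ} (hm0 : m ≠ 0) (hm1 : m ≠ 1)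
    (hm : ∀ i, m ≠ gowE ℓ q * ℓ ^ i) : ∃ r s, 0 < r ∧ 0 < s ∧ r + s = m ∧
    qFactVal ℓ q r + qFactVal ℓ q s = qFactVal ℓ q m := by
  have he := gowE_pos hq1 hq
  by_cases h : gowE ℓ q ∣ m
  · obtain ⟨k, rfl⟩ := h
    obtain ⟨j, hj0, hj, hs⟩ := exists_factorial_split (ℓ := ℓ) k (by rintro rfl; simp at hm0)
      fun i hi ↦ hm i (by rw [hi])
    obtain ⟨i, rfl⟩ := Nat.exists_eq_add_of_le hj.le
    refine ⟨gowE ℓ q * j, gowE ℓ q * i, by positivity, Nat.mul_pos he (by omega),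
      (mul_add _ _ _).symm, ?_⟩
    rw [Nat.add_sub_cancel_left] at hs
    simp only [qFactVal, Nat.mul_div_cancel_left _ he]
    rw [← hs]
    ring
  · rcases Nat.lt_or_ge m (gowE ℓ q) with h1 | h1
    · refine ⟨1, m - 1, one_pos, by omega, by omega, ?_⟩
      simp [qFactVal, Nat.div_eq_of_lt h1, Nat.div_eq_of_lt (show 1 < gowE ℓ q by omega),
        Nat.div_eq_of_lt (show m - 1 < gowE ℓ q by omega)]
    · have h2 := Nat.mod_lt m he
      refine ⟨m % gowE ℓ q, m - m % gowE ℓ q,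
        Nat.pos_of_ne_zero fun h0 ↦ h (Nat.dvd_of_mod_eq_zero h0), by omega, by omega, ?_⟩
      have h3 : (m - m % gowE ℓ q) / gowE ℓ q = m / gowE ℓ q := by
        conv_lhs => rw [show m - m % gowE ℓ q = gowE ℓ q * (m / gowE ℓ q) by
          have := Nat.div_add_mod m (gowE ℓ q); omega]
        exact Nat.mul_div_cancel_left _ he
      simp [qFactVal, Nat.div_eq_of_lt h2, h3]

lemma qFactVal_one (hq1 : 1 < q) (hq : ¬ ℓ ∣ q) : qFactVal ℓ q 1 = 0 := by
  have := (gowE_spec hq1 hq).1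
  simp [qFactVal, Nat.div_eq_of_lt (show 1 < gowE ℓ q by omega)]

lemma qFactVal_gowE_mul (hq1 : 1 < q) (hq : ¬ ℓ ∣ q) (k : ℕ) :
    qFactVal ℓ q (gowE ℓ q * k) = gowD ℓ q * k + padicValNat ℓ k.factorial := by
  rw [qFactVal, Nat.mul_div_cancel_left _ (gowE_pos hq1 hq)]

lemma padicValNat_factorial_self : padicValNat ℓ ℓ.factorial = 1 := by
  have := padicValNat_factorial_mul (p := ℓ) 1
  simpa using this

lemma padicValNat_factorial_sq : padicValNat ℓ (ℓ ^ 2).factorial = ℓ + 1 := by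
  rw [pow_two, padicValNat_factorial_mul, padicValNat_factorial_self, add_comm]

omit hℓ in
/-- The size and the valuation of a partition with `x`, `y`, `z` parts `e`, `e ℓ`, `e ℓ²` determine
these numbers. -/
lemma partition_counts_unique {d N x y z x' y' z' : ℕ} (h2 : 2 ≤ ℓ)
    (hN : (d ≤ ℓ ∧ N ≤ d * ℓ) ∨ (d = ℓ + 1 ∧ N ≤ ℓ ^ 2) ∨ (ℓ + 1 < d ∧ N < ℓ ^ 2 + ℓ))
    (hs : x + ℓ * y + ℓ ^ 2 * z ≤ N) (hs' : x' + ℓ * y' + ℓ ^ 2 * z' ≤ N)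
    (h : d * (x + ℓ * y + ℓ ^ 2 * z) + y + (ℓ + 1) * z =
      d * (x' + ℓ * y' + ℓ ^ 2 * z') + y' + (ℓ + 1) * z') : x = x' ∧ y = y' ∧ z = z' := by
  have h2l : ℓ * 2 ≤ ℓ ^ 2 := by rw [pow_two]; exact Nat.mul_le_mul_left _ h2
  have hda : d ≤ ℓ → d * ℓ ≤ ℓ ^ 2 := fun h ↦ by rw [pow_two]; exact Nat.mul_le_mul_right _ h
  have hNb : N < ℓ ^ 2 + ℓ := by
    rcases hN with hN | hN | hN
    · have := hda hN.1
      omega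
    · omega
    · omega
  have key : ∀ x y z x' y' z' : ℕ, x + ℓ * y + ℓ ^ 2 * z ≤ N → x' + ℓ * y' + ℓ ^ 2 * z' ≤ N →
      d * (x + ℓ * y + ℓ ^ 2 * z) + y + (ℓ + 1) * z =
        d * (x' + ℓ * y' + ℓ ^ 2 * z') + y' + (ℓ + 1) * z' →
      x' + ℓ * y' + ℓ ^ 2 * z' ≤ x + ℓ * y + ℓ ^ 2 * z := by
    intro x y z x' y' z' hs hs' h
    by_contra! hlt
    -- A deficit in the total costs at least `d`, which `y + (ℓ + 1) z` has to make up. As `N < ℓ² +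
    -- ℓ` leaves only `z ≤ 1`, this pushes the smaller total up to `N` or beyond in each case.
    have hd : d * (x + ℓ * y + ℓ ^ 2 * z) + d ≤ d * (x' + ℓ * y' + ℓ ^ 2 * z') := by
      rw [← Nat.mul_succ]; exact Nat.mul_le_mul_left d hlt
    have hz : z ≤ 1 := by
      by_contra! hz
      have : ℓ ^ 2 * 2 ≤ ℓ ^ 2 * z := Nat.mul_le_mul_left _ hz
      omega
    have hlow : d ≤ y + (ℓ + 1) * z := by omega
    interval_cases z
    · have hdy : ℓ * d ≤ ℓ * y := Nat.mul_le_mul_left _ (by omega)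
      rcases hN with hN | hN | hN
      · linarith
      · rw [hN.1] at hdy
        linarith
      · have : ℓ * (ℓ + 1) ≤ ℓ * d := Nat.mul_le_mul_left _ hN.1.le
        linarith
    · rcases hN with hN | hN | hN
      · have := hda hN.1
        linarith [Nat.zero_le (ℓ * y)]
      · linarith [Nat.zero_le (ℓ * y)]
      · have : ℓ * 1 ≤ ℓ * y := Nat.mul_le_mul_left _ (by omega)
        linarith
  have hss := le_antisymm (key _ _ _ _ _ _ hs hs' h) (key _ _ _ _ _ _ hs' hs h.symm)
  rw [hss] at h
  -- With equal totals, one part `e ℓ²` fewer must be compensated by `ℓ + 1` more parts `e ℓ`, which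
  -- alone take `ℓ² + ℓ > N`.
  have hfin : ∀ x y z x' y' z' : ℕ, x + ℓ * y + ℓ ^ 2 * z ≤ N →
      x' + ℓ * y' + ℓ ^ 2 * z' ≤ N → x + ℓ * y + ℓ ^ 2 * z = x' + ℓ * y' + ℓ ^ 2 * z' →
      y + (ℓ + 1) * z = y' + (ℓ + 1) * z' → z ≤ z' := by
    intro x y z x' y' z' hs hs' hss h
    by_contra! hz
    have hy : y + (ℓ + 1) ≤ y' := by
      have : (ℓ + 1) * (z' + 1) ≤ (ℓ + 1) * z := Nat.mul_le_mul_left _ hz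
      rw [Nat.mul_succ] at this
      omega
    have hy2 : ℓ * (ℓ + 1) ≤ ℓ * y' := Nat.mul_le_mul_left _ (by omega)
    linarith [Nat.zero_le (ℓ ^ 2 * z')]
  have hz := le_antisymm (hfin _ _ _ _ _ _ hs hs' hss.symm (by omega))
    (hfin _ _ _ _ _ _ hs' hs hss (by omega))
  subst hz
  have hy : y = y' := by omega
  subst hy
  exact ⟨by omega, rfl, rfl⟩

omit hℓ in
lemma list_count_sum {ι : Type*} [DecidableEq ι] (f : ι → ℕ) (s : Finset ι) (l : List ι)
    (hl : ∀ x ∈ l, x ∈ s) : (l.map f).sum = ∑ x ∈ s, l.count x * f x := by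
  induction l with
  | nil => simp
  | cons a l ih =>
    rw [List.map_cons, List.sum_cons, ih fun x hx ↦ hl x (List.mem_cons_of_mem _ hx)]
    simp only [List.count_cons, add_mul, Finset.sum_add_distrib, beq_iff_eq, ite_mul, one_mul,
      zero_mul]
    rw [Finset.sum_ite_eq, if_pos (hl a List.mem_cons_self), add_comm]

/-- A sorted list with entries `1` and `e ℓ^i` is determined by its sum and its valuation. -/
lemma star_list_unique (hq1 : 1 < q) (hq : ¬ ℓ ∣ q) {n : ℕ}
    (hN : (gowD ℓ q ≤ ℓ ∧ n / gowE ℓ q ≤ gowD ℓ q * ℓ) ∨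
      (gowD ℓ q = ℓ + 1 ∧ n / gowE ℓ q ≤ ℓ ^ 2) ∨
      (ℓ + 1 < gowD ℓ q ∧ n / gowE ℓ q < ℓ ^ 2 + ℓ)) {l l' : List ℕ}
    (hl : l.Pairwise (· ≤ ·)) (hl' : l'.Pairwise (· ≤ ·))
    (hs : ∀ k ∈ l, k = 1 ∨ ∃ i : ℕ, k = gowE ℓ q * ℓ ^ i)
    (hs' : ∀ k ∈ l', k = 1 ∨ ∃ i : ℕ, k = gowE ℓ q * ℓ ^ i)
    (hsum : l.sum = n) (hsum' : l'.sum = n)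
    (h : (l.map (qFactVal ℓ q)).sum = (l'.map (qFactVal ℓ q)).sum) : l = l' := by
  have h2 := hℓ.out.two_le
  have he := (gowE_spec hq1 hq).1
  have he0 := gowE_pos hq1 hq
  set e := gowE ℓ q with hedef
  have hNb : n / e < ℓ ^ 2 + ℓ := by rcases hN with hN | hN | hN <;> nlinarith
  let s : Finset ℕ := {1, e, e * ℓ, e * ℓ ^ 2}
  have hmem : ∀ l : List ℕ, l.sum = n → (∀ k ∈ l, k = 1 ∨ ∃ i : ℕ, k = e * ℓ ^ i) →
      ∀ k ∈ l, k ∈ s := by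
    intro l hsum hs k hk
    rcases hs k hk with rfl | ⟨i, rfl⟩
    · simp [s]
    · have hle : e * ℓ ^ i ≤ n := hsum ▸ List.single_le_sum (by simp) _ hk
      have hle2 : ℓ ^ i ≤ n / e := (Nat.le_div_iff_mul_le he0).2 (by rwa [mul_comm])
      -- A part `e ℓ³` is too large, since `ℓ³ ≥ ℓ² + ℓ > n / e`.
      have hi : i < 3 := by
        by_contra! hi
        have : ℓ ^ 3 ≤ ℓ ^ i := Nat.pow_le_pow_right (by omega) hi
        have : ℓ * ℓ ^ 2 = ℓ ^ 3 := by ring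
        nlinarith
      interval_cases i <;> simp [s]
  have hsumf : ∀ f : ℕ → ℕ, ∑ x ∈ s, f x = f 1 + f e + f (e * ℓ) + f (e * ℓ ^ 2) := by
    intro f
    have h1 : e < e * ℓ := by nlinarith
    have h3 : e * ℓ < e * ℓ ^ 2 := by nlinarith
    simp only [s]
    rw [Finset.sum_insert, Finset.sum_insert, Finset.sum_insert, Finset.sum_singleton]
    · ring
    · simp only [Finset.mem_singleton]; omega
    · simp only [Finset.mem_singleton, Finset.mem_insert]; omega
    · simp only [Finset.mem_singleton, Finset.mem_insert]; omega
  have hval : ∀ l : List ℕ, (∀ k ∈ l, k ∈ s) → (l.map (qFactVal ℓ q)).sum =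
      gowD ℓ q * (l.count e + ℓ * l.count (e * ℓ) + ℓ ^ 2 * l.count (e * ℓ ^ 2)) +
        l.count (e * ℓ) + (ℓ + 1) * l.count (e * ℓ ^ 2) := by
    intro l hl
    have h1 := qFactVal_gowE_mul hq1 hq 1
    rw [← hedef, mul_one, Nat.factorial_one, padicValNat_one_right] at h1
    rw [list_count_sum _ s l hl, hsumf, qFactVal_one hq1 hq, h1, qFactVal_gowE_mul hq1 hq,
      qFactVal_gowE_mul hq1 hq, padicValNat_factorial_self, padicValNat_factorial_sq]
    ring
  have hlen : ∀ l : List ℕ, (∀ k ∈ l, k ∈ s) → l.sum =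
      l.count 1 + e * (l.count e + ℓ * l.count (e * ℓ) + ℓ ^ 2 * l.count (e * ℓ ^ 2)) := by
    intro l hl
    have := list_count_sum id s l hl
    rw [List.map_id, hsumf] at this
    simp only [id] at this
    rw [this]
    ring
  have hm := hmem l hsum hs
  have hm' := hmem l' hsum' hs'
  have hb : ∀ l : List ℕ, l.sum = n → (∀ k ∈ l, k ∈ s) →
      l.count e + ℓ * l.count (e * ℓ) + ℓ ^ 2 * l.count (e * ℓ ^ 2) ≤ n / e := by
    intro l hsum hl
    rw [Nat.le_div_iff_mul_le he0, ← hsum, hlen l hl, mul_comm]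
    omega
  obtain ⟨hx, hy, hz⟩ := partition_counts_unique h2 hN (hb l hsum hm) (hb l' hsum' hm')
    (by rw [← hval l hm, ← hval l' hm', h])
  have h1 : l.count 1 = l'.count 1 := by
    have h3 := hlen l hm
    have h4 := hlen l' hm'
    rw [hx, hy, hz] at h3
    omega
  refine List.Perm.eq_of_pairwise (fun a b _ _ ↦ le_antisymm) hl hl' ?_
  rw [List.perm_iff_count]
  intro a
  by_cases ha : a ∈ s
  · simp only [s, Finset.mem_insert, Finset.mem_singleton] at ha
    rcases ha with rfl | rfl | rfl | rfl <;> assumption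
  · rw [List.count_eq_zero_of_not_mem fun h ↦ ha (hm a h),
      List.count_eq_zero_of_not_mem fun h ↦ ha (hm' a h)]

end Arithmetic

/-! ### The valuation of the index and its injectivity on `𝒫*` -/

section ParabolicIndex

variable {n : ℕ} {F : Type*} [Field F] [Finite F] {ℓ : ℕ} [Fact ℓ.Prime]

lemma padicValNat_index_blockLabel (hq : ¬ ℓ ∣ Nat.card F) {l : List ℕ} (hpos : ∀ x ∈ l, 0 < x)
    (hl : l.sum = n) :
    padicValNat ℓ (blockUpper (blockLabel n l) : Subgroup (GL (Fin n) F)).index +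
      (l.map (qFactVal ℓ (Nat.card F))).sum = qFactVal ℓ (Nat.card F) n := by
  have h1 : 1 < Nat.card F := Finite.one_lt_card
  let a : Composition n := ⟨l, fun h ↦ hpos _ h, hl⟩
  have h := padicValNat_index_parabolic (F := F) hq a
  have h2 : (a.blocks.map (orderVal ℓ (Nat.card F))).sum =
      n * padicValNat ℓ (Nat.card F - 1) + (l.map (qFactVal ℓ (Nat.card F))).sum := by
    change (l.map _).sum = _
    rw [List.map_congr_left fun m _ ↦ orderVal_eq h1 hq m, List.sum_map_add, List.sum_map_mul_right,
      List.map_id', hl]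
  rw [h2, parabolic_eq_blockUpper, orderVal_eq h1 hq] at h
  change padicValNat ℓ (blockUpper (blockLabel n l)).index + _ = _ at h
  omega

theorem injOn_padicValNat_index_parabolicStar (hq : ¬ ℓ ∣ Nat.card F)
    (hN : (gowD ℓ (Nat.card F) ≤ ℓ ∧ n / gowE ℓ (Nat.card F) ≤ gowD ℓ (Nat.card F) * ℓ) ∨
      (gowD ℓ (Nat.card F) = ℓ + 1 ∧ n / gowE ℓ (Nat.card F) ≤ ℓ ^ 2) ∨
      (ℓ + 1 < gowD ℓ (Nat.card F) ∧ n / gowE ℓ (Nat.card F) < ℓ ^ 2 + ℓ)) :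
    Set.InjOn (fun P ↦ padicValNat ℓ P.index) (parabolicStar n F ℓ (gowE ℓ (Nat.card F))) := by
  rintro _ ⟨a, ha, hs, rfl⟩ _ ⟨a', ha', hs', rfl⟩ h
  have h1 : 1 < Nat.card F := Finite.one_lt_card
  have e1 := padicValNat_index_blockLabel (F := F) hq (fun x hx ↦ a.blocks_pos hx) a.blocks_sum
  have e2 := padicValNat_index_blockLabel (F := F) hq (fun x hx ↦ a'.blocks_pos hx) a'.blocks_sum
  rw [← parabolic_eq_blockUpper] at e1 e2
  simp only at h
  rw [Composition.ext (star_list_unique h1 hq hN ha ha' hs hs' a.blocks_sum a'.blocks_sum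
    (by omega))]

end ParabolicIndex

/-! ### Reduction from all compositions to those of `𝒫*` -/

section StarComposition

variable {n : ℕ} {F R : Type*} [Field F] [Finite F] [CommRing R] [IsDomain R]

local notation "𝔸" => MonoidAlgebra R (GL (Fin n) F)

omit [IsDomain R] in
lemma whittaker_mem_iff_of_perm (hq : IsUnit (Nat.card F : R)) (ψ : AddChar F R) (N : Submodule 𝔸 𝔸)
    {l l' : List ℕ} (h : l.Perm l') (hl : l.sum = n) :
    whittaker ψ (blockLabel n l) ∈ N ↔ whittaker ψ (blockLabel n l') ∈ N := by
  -- A variable prefix lets the induction on the permutation pass under a common first block.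
  suffices key : ∀ p : List ℕ, (p ++ l).sum = n →
      (whittaker ψ (blockLabel n (p ++ l)) ∈ N ↔ whittaker ψ (blockLabel n (p ++ l')) ∈ N) from
    key [] hl
  clear hl
  induction h with
  | nil => exact fun _ _ ↦ Iff.rfl
  | cons x _ ih =>
    intro p hp
    have := ih (p ++ [x]) (by simpa using hp)
    simpa using this
  | swap x y l =>
    intro p hp
    have hp' : (p ++ x :: y :: l).sum = n := by
      simp only [List.sum_append, List.sum_cons] at hp ⊢; omega
    obtain ⟨τ, hτ⟩ := blockMove_swap p l y x hp
    obtain ⟨τ', hτ'⟩ := blockMove_swap p l x y hp'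
    exact ⟨hτ'.whittaker_mem_left hq ψ, hτ.whittaker_mem_left hq ψ⟩
  | trans h _ ih ih' =>
    intro p hp
    exact (ih p hp).trans (ih' p (by rw [List.sum_append, ← h.sum_eq, ← List.sum_append]; exact hp))

omit [Finite F] in
lemma blockUpper_split_le (l₁ l₂ : List ℕ) (r s : ℕ) :
    (blockUpper (blockLabel n (l₁ ++ r :: s :: l₂)) : Subgroup (GL (Fin n) F)) ≤
      blockUpper (blockLabel n (l₁ ++ (r + s) :: l₂)) := by
  have key : ∀ i : Fin n, (blockLabel n (l₁ ++ r :: s :: l₂) i ≤ l₁.length ∧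
      blockLabel n (l₁ ++ (r + s) :: l₂) i = blockLabel n (l₁ ++ r :: s :: l₂) i) ∨
      (l₁.length < blockLabel n (l₁ ++ r :: s :: l₂) i ∧
        blockLabel n (l₁ ++ (r + s) :: l₂) i + 1 = blockLabel n (l₁ ++ r :: s :: l₂) i) :=
    fun i ↦ by
      simp only [blockLabel]
      rcases blockIndex_append_cons_cons l₁ l₂ r s i with h | h | h | h <;>
        rcases blockIndex_append_cons l₁ l₂ r s i with h' | h' | h' <;> omega
  intro g hg
  rw [mem_blockUpper] at hg ⊢
  intro i j hij
  refine hg i j ?_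
  have := key i
  have := key j
  have := blockLabel_mono n (l₁ ++ r :: s :: l₂)
  omega

variable [CharZero R] {ℓ : ℕ} [Fact ℓ.Prime]

/-- The additivity `hv` says that the two indices have equal valuation, so their quotient `k` is a
unit of `R` and membership passes through the merging move in both directions. -/
lemma whittaker_mem_iff_of_split (hU : ∀ k : ℕ, ¬ ℓ ∣ k → IsUnit (k : R)) (hq : ¬ ℓ ∣ Nat.card F)
    {ψ : AddChar F R} (hψ : ψ ≠ 1) (N : Submodule 𝔸 𝔸) {l₁ l₂ : List ℕ} {r s : ℕ} (hr : 0 < r)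
    (hs : 0 < s) (h₁ : ∀ x ∈ l₁, 0 < x) (h₂ : ∀ x ∈ l₂, 0 < x)
    (hsum : (l₁ ++ r :: s :: l₂).sum = n)
    (hv : qFactVal ℓ (Nat.card F) r + qFactVal ℓ (Nat.card F) s =
      qFactVal ℓ (Nat.card F) (r + s)) :
    whittaker ψ (blockLabel n (l₁ ++ (r + s) :: l₂)) ∈ N ↔
      whittaker ψ (blockLabel n (l₁ ++ r :: s :: l₂)) ∈ N := by
  obtain ⟨τ, hτ⟩ := blockMove_merge l₁ l₂ r s hsum
  obtain ⟨k, hk⟩ := Subgroup.index_dvd_of_le (blockUpper_split_le (n := n) (F := F) l₁ l₂ r s)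
  rw [mul_comm] at hk
  have hb := padicValNat_index_blockLabel (n := n) (F := F) hq (l := l₁ ++ r :: s :: l₂) (by
    simp only [List.mem_append, List.mem_cons]
    rintro x (h | rfl | rfl | h)
    exacts [h₁ x h, hr, hs, h₂ x h]) hsum
  have ha := padicValNat_index_blockLabel (n := n) (F := F) hq (l := l₁ ++ (r + s) :: l₂) (by
    simp only [List.mem_append, List.mem_cons]
    rintro x (h | rfl | h)
    exacts [h₁ x h, by omega, h₂ x h]) (by
      simp only [List.sum_append, List.sum_cons] at hsum ⊢; omega)
  simp only [List.map_append, List.map_cons, List.sum_append, List.sum_cons] at ha hb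
  have hk0 : k ≠ 0 := by
    rintro rfl
    exact Subgroup.index_ne_zero_of_finite (hk.trans (zero_mul _))
  rw [hk, padicValNat.mul hk0 Subgroup.index_ne_zero_of_finite] at hb
  have hkv : padicValNat ℓ k = 0 := by omega
  have hkℓ : ¬ ℓ ∣ k := fun h ↦ by
    have := one_le_padicValNat_of_dvd hk0 h
    omega
  exact ⟨hτ.whittaker_mem_left (hU _ hq) ψ,
    hτ.whittaker_mem_right (hU _ hq) hψ (hU k hkℓ) hk⟩

lemma exists_star_list (hU : ∀ k : ℕ, ¬ ℓ ∣ k → IsUnit (k : R)) (hq : ¬ ℓ ∣ Nat.card F)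
    {ψ : AddChar F R} (hψ : ψ ≠ 1) {l : List ℕ} (hpos : ∀ x ∈ l, 0 < x) (hsum : l.sum = n) :
    ∃ l' : List ℕ, (∀ x ∈ l', 0 < x) ∧ l'.sum = n ∧
      (∀ k ∈ l', k = 1 ∨ ∃ i : ℕ, k = gowE ℓ (Nat.card F) * ℓ ^ i) ∧
      ∀ N : Submodule 𝔸 𝔸, whittaker ψ (blockLabel n l) ∈ N ↔
        whittaker ψ (blockLabel n l') ∈ N := by
  have h1 : 1 < Nat.card F := Finite.one_lt_card
  -- Each split adds a block, and there are at most `n` blocks.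
  induction hm : n - l.length using Nat.strong_induction_on generalizing l with
  | _ m ih =>
    by_cases hl : ∀ k ∈ l, k = 1 ∨ ∃ i : ℕ, k = gowE ℓ (Nat.card F) * ℓ ^ i
    · exact ⟨l, hpos, hsum, hl, fun _ ↦ Iff.rfl⟩
    · push Not at hl
      obtain ⟨k, hk, hk1, hki⟩ := hl
      obtain ⟨r, s, hr, hs, rfl, hv⟩ := exists_qFactVal_split h1 hq (hpos k hk).ne' hk1 hki
      obtain ⟨l₁, l₂, rfl⟩ := List.append_of_mem hk
      have h₁ : ∀ x ∈ l₁, 0 < x := fun x hx ↦ hpos x (by simp [hx])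
      have h₂ : ∀ x ∈ l₂, 0 < x := fun x hx ↦ hpos x (by simp [hx])
      have hpos' : ∀ x ∈ l₁ ++ r :: s :: l₂, 0 < x := by
        simp only [List.mem_append, List.mem_cons]
        rintro x (h | rfl | rfl | h)
        exacts [h₁ x h, hr, hs, h₂ x h]
      have hsum' : (l₁ ++ r :: s :: l₂).sum = n := by
        simp only [List.sum_append, List.sum_cons] at hsum ⊢; omega
      have hlen := List.length_le_sum_of_one_le _ hpos'
      simp only [List.length_append, List.length_cons] at hlen hm
      obtain ⟨l', hp, hs', hst, hiff⟩ := ih (n - (l₁ ++ r :: s :: l₂).length) (by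
        simp only [List.length_append, List.length_cons]; omega) hpos' hsum' rfl
      exact ⟨l', hp, hs', hst, fun N ↦
        (whittaker_mem_iff_of_split hU hq hψ N hr hs h₁ h₂ hsum' hv).trans (hiff N)⟩

/-- Every nonzero section of the Steinberg lattice that is killed by `ℓ` contains the eigenvector
attached to a member of `𝒫*`. -/
theorem exists_star_whittaker_mem (hU : ∀ k : ℕ, ¬ ℓ ∣ k → IsUnit (k : R))
    (hq : ¬ ℓ ∣ Nat.card F) {ψ : AddChar F R} (hψ : ψ ≠ 1) {M N : Submodule 𝔸 𝔸} (hMN : ¬ M ≤ N)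
    (hM : M ≤ lattice n F R) (hN : ∀ r : R, ¬ IsUnit r → ∀ x ∈ lattice n F R, r • x ∈ N) :
    ∃ a : Composition n, a.blocks.Pairwise (· ≤ ·) ∧
      (∀ k ∈ a.blocks, k = 1 ∨ ∃ i : ℕ, k = gowE ℓ (Nat.card F) * ℓ ^ i) ∧
      whittaker ψ (blockLabel n a.blocks) ∈ M ∧ whittaker ψ (blockLabel n a.blocks) ∉ N := by
  obtain ⟨l, hpos, hsum, hlM, hlN⟩ := exists_whittaker_mem hψ (hU _ hq) hMN hM hN
  obtain ⟨l', hpos', hsum', hstar, hiff⟩ := exists_star_list (n := n) hU hq hψ hpos hsum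
  have hperm := List.perm_insertionSort (· ≤ ·) l'
  have hiff' := fun N ↦ (hiff N).trans (whittaker_mem_iff_of_perm (hU _ hq) ψ N hperm.symm hsum')
  exact ⟨⟨l'.insertionSort (· ≤ ·), fun h ↦ hpos' _ (hperm.mem_iff.1 h), hperm.sum_eq.trans hsum'⟩,
    List.pairwise_insertionSort _ _, fun k hk ↦ hstar k (hperm.mem_iff.1 hk),
    (hiff' M).1 hlM, fun h ↦ hlN ((hiff' N).2 h)⟩

end StarComposition

/-! ### Passage to the reduction and the composition series -/

section Filtration

/-- A finite chain of submodules in which each term is equal to the next one or covers it is a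
composition series after deletion of the repeated terms. -/
lemma exists_compositionSeries_range {S V : Type*} [Ring S] [AddCommGroup V] [Module S V]
    (f : ℕ → Submodule S V) (h0 : f 0 = ⊤) {m : ℕ} (hm : f m = ⊥)
    (hstep : ∀ c, f (c + 1) = f c ∨ f (c + 1) ⋖ f c) :
    ∃ s : CompositionSeries (Submodule S V),
      s.head = ⊥ ∧ s.last = ⊤ ∧ Set.range s = Set.range f := by
  have hanti : Antitone f := antitone_nat_of_succ_le fun c ↦ by
    rcases hstep c with h | h
    · exact h.le
    · exact h.le
  have key : ∀ k ≤ m, ∃ s : CompositionSeries (Submodule S V),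
      s.head = ⊥ ∧ s.last = f (m - k) ∧ Set.range s = f '' {i | m - k ≤ i} := by
    intro k
    induction k with
    | zero =>
      refine fun _ ↦ ⟨RelSeries.singleton _ ⊥, rfl, hm.symm, ?_⟩
      ext x
      constructor
      · rintro ⟨i, rfl⟩
        exact ⟨m, by simp, hm⟩
      · rintro ⟨i, hi, rfl⟩
        exact ⟨0, (le_bot_iff.1 (hm ▸ hanti hi)).symm⟩
    | succ k ih =>
      intro hk
      obtain ⟨s, hs, hl, hr⟩ := ih (by omega)
      have hmk : m - k = m - (k + 1) + 1 := by omega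
      have himg : f '' {i | m - (k + 1) ≤ i} =
          insert (f (m - (k + 1))) (f '' {i | m - k ≤ i}) := by
        rw [← Set.image_insert_eq]
        congr 1
        ext i
        simp only [Set.mem_ofPred_eq, Set.mem_insert_iff]
        omega
      rcases hstep (m - (k + 1)) with h | h
      · rw [← hmk] at h
        refine ⟨s, hs, hl.trans h, ?_⟩
        rw [himg, hr, ← h, Set.insert_eq_of_mem]
        exact ⟨m - k, le_refl (m - k), rfl⟩
      · rw [← hmk, ← hl] at h
        refine ⟨s.snoc (f (m - (k + 1))) h, by simpa using hs, by simp, ?_⟩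
        rw [himg, ← hr]
        ext x
        change x ∈ s.snoc (f (m - (k + 1))) h ↔ x = _ ∨ x ∈ s
        rw [RelSeries.mem_snoc, or_comm]
  obtain ⟨s, hs, hl, hr⟩ := key m le_rfl
  rw [Nat.sub_self] at hl hr
  exact ⟨s, hs, hl.trans h0, by simpa using hr⟩

/-- An `F_p`-linear form on `F` that does not vanish at `1` is followed by the character of `F_p`
given by powers of `ζ`. -/
lemma exists_addChar_ne_one {F R : Type*} [Field F] [CommRing R] {p : ℕ} [CharP F p]
    [Fact p.Prime] {ζ : R} (hζ : IsPrimitiveRoot ζ p) : ∃ ψ : AddChar F R, ψ ≠ 1 := by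
  let _ : Algebra (ZMod p) F := ZMod.algebra F p
  obtain ⟨φ, hφ⟩ : ∃ φ : Module.Dual (ZMod p) F, φ 1 ≠ 0 := by
    by_contra! h
    exact one_ne_zero ((Module.forall_dual_apply_eq_zero_iff (ZMod p) (1 : F)).1 h)
  refine ⟨(AddChar.zmodChar p hζ.pow_eq_one).compAddMonoidHom φ.toAddMonoidHom,
    AddChar.ne_one_iff.2 ⟨1, fun h ↦ hφ ?_⟩⟩
  change ζ ^ (φ 1).val = 1 at h
  rw [hζ.pow_eq_one_iff_dvd] at h
  exact (ZMod.val_eq_zero _).1 (Nat.eq_zero_of_dvd_of_lt h (ZMod.val_lt _))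

variable {n : ℕ} {F R : Type*} [Field F] [Finite F] [CommRing R]

/-- The preimage in `RG` of a submodule of the reduction of the Steinberg lattice. -/
def latticePreimage {ℓ : ℕ}
    (X : Submodule (MonoidAlgebra (ResidueRing R ℓ) (GL (Fin n) F)) (Reduction n F R ℓ)) :
    Submodule (MonoidAlgebra R (GL (Fin n) F)) (MonoidAlgebra R (GL (Fin n) F)) where
  carrier := {x | ∃ h : x ∈ lattice n F R, (Submodule.Quotient.mk ⟨x, h⟩ : Reduction n F R ℓ) ∈ X}
  zero_mem' := ⟨zero_mem _, zero_mem X⟩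
  add_mem' := by
    rintro x y ⟨hx, hx'⟩ ⟨hy, hy'⟩
    exact ⟨add_mem hx hy, add_mem hx' hy'⟩
  smul_mem' := by
    rintro a x ⟨hx, hx'⟩
    refine ⟨Submodule.smul_mem _ a hx, ?_⟩
    have := X.smul_mem (reduce n F R ℓ a) hx'
    rwa [reduce_smul, ← Submodule.Quotient.mk_smul] at this

lemma latticePreimage_le_lattice {ℓ : ℕ}
    (X : Submodule (MonoidAlgebra (ResidueRing R ℓ) (GL (Fin n) F)) (Reduction n F R ℓ)) :
    latticePreimage X ≤ lattice n F R := fun _ h ↦ h.1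

lemma le_of_latticePreimage_le {ℓ : ℕ}
    {X Y : Submodule (MonoidAlgebra (ResidueRing R ℓ) (GL (Fin n) F)) (Reduction n F R ℓ)}
    (h : latticePreimage X ≤ latticePreimage Y) : X ≤ Y := fun x hx ↦ by
  obtain ⟨y, rfl⟩ := Submodule.Quotient.mk_surjective _ x
  exact (h ⟨y.2, hx⟩).2

variable (n) in
/-- The class in the reduction of the eigenvector of a linear character of `U`. -/
def whittakerClass (ψ : AddChar F R) (ℓ : ℕ) (b : Fin n → ℕ) : Reduction n F R ℓ :=
  Submodule.Quotient.mk ⟨whittaker ψ b, whittaker_mem ψ b⟩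

lemma isUnit_natCast_of_not_dvd [IsLocalRing R] {ℓ : ℕ} (hℓ : ℓ.Prime)
    (hR : IsLocalRing.maximalIdeal R = Ideal.span {(ℓ : R)}) {k : ℕ} (hk : ¬ ℓ ∣ k) :
    IsUnit (k : R) := by
  by_contra h
  have h1 : (k : R) ∈ IsLocalRing.maximalIdeal R := h
  have h2 : (ℓ : R) ∈ IsLocalRing.maximalIdeal R := by
    rw [hR]; exact Ideal.mem_span_singleton_self _
  have h3 : IsCoprime (ℓ : R) (k : R) := ((Nat.Prime.coprime_iff_not_dvd hℓ).2 hk).cast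
  obtain ⟨u, v, huv⟩ := h3
  apply (IsLocalRing.maximalIdeal.isMaximal R).ne_top
  rw [Ideal.eq_top_iff_one, ← huv]
  exact add_mem (Ideal.mul_mem_left _ _ h2) (Ideal.mul_mem_left _ _ h1)

lemma natCast_pow_dvd_iff [IsDomain R] [CharZero R] [IsLocalRing R] {ℓ : ℕ} (hℓ : ℓ.Prime)
    (hR : IsLocalRing.maximalIdeal R = Ideal.span {(ℓ : R)}) {c k : ℕ} (hk : k ≠ 0) :
    (ℓ : R) ^ c ∣ (k : R) ↔ c ≤ padicValNat ℓ k := by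
  have : Fact ℓ.Prime := ⟨hℓ⟩
  rw [← padicValNat_dvd_iff_le hk]
  refine ⟨fun h ↦ ?_, fun h ↦ by simpa using (Nat.cast_dvd_cast h : ((ℓ ^ c : ℕ) : R) ∣ k)⟩
  rw [padicValNat_dvd_iff_le hk]
  by_contra! hc
  obtain ⟨u, hu⟩ := pow_padicValNat_dvd (p := ℓ) (n := k)
  have huℓ : ¬ ℓ ∣ u := fun ⟨v, hv⟩ ↦
    pow_succ_padicValNat_not_dvd (p := ℓ) hk ⟨v, by rw [pow_succ, mul_assoc, ← hv, ← hu]⟩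
  have h1 : (ℓ : R) ^ padicValNat ℓ k * ℓ ∣ (ℓ : R) ^ padicValNat ℓ k * u := by
    rw [← pow_succ]
    refine (pow_dvd_pow _ hc).trans ?_
    have : (k : R) = (ℓ : R) ^ padicValNat ℓ k * u := by
      conv_lhs => rw [hu]
      push_cast; rfl
    rwa [← this]
  have h2 : (ℓ : R) ∣ u :=
    (mul_dvd_mul_iff_left (pow_ne_zero _ (Nat.cast_ne_zero.2 hℓ.ne_zero))).1 h1
  have h3 : (ℓ : R) ∈ IsLocalRing.maximalIdeal R := by
    rw [hR]; exact Ideal.mem_span_singleton_self _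
  exact h3 (isUnit_of_dvd_unit h2 (isUnit_natCast_of_not_dvd hℓ hR huℓ))

variable [IsDomain R] [CharZero R]

lemma form_whittaker {ψ : AddChar F R} (hψ : ψ ≠ 1) {b : Fin n → ℕ} (hb : Monotone b)
    {y : lattice n F R} {r : R} (hr : charProj ψ⁻¹ b y.1 = r • whittaker ψ⁻¹ b) :
    form ⟨whittaker ψ b, whittaker_mem ψ b⟩ y = algebraMap R (FractionRing R)
      (r * ((blockUpper b : Subgroup (GL (Fin n) F)).index : R)) := by
  have h0 : (Nat.card (borel n F) : FractionRing R) ≠ 0 := Nat.cast_ne_zero.2 Nat.card_pos.ne'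
  rw [form, groupForm_whittaker hψ hb hr, div_eq_iff h0, mul_left_comm, map_mul, map_natCast,
    mul_comm]

omit [CharZero R] in
lemma form_comm (x y : lattice n F R) : form x y = form y x := by
  rw [form, form, groupForm_comm]

/-- By multiplicity one, all form values of the eigenvector are multiples of the index, which gives
one direction. Conversely, a lift of the class in `I(c)` is paired with the eigenvector of `ψ⁻¹`;
the value is a unit times the index. -/
lemma whittakerClass_mem_gowFiltration_iff [IsLocalRing R] {ℓ : ℕ} (hℓ : ℓ.Prime)
    (hR : IsLocalRing.maximalIdeal R = Ideal.span {(ℓ : R)}) (hq : ¬ ℓ ∣ Nat.card F)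
    {ψ : AddChar F R} (hψ : ψ ≠ 1) {b : Fin n → ℕ} (hb : Monotone b) (c : ℕ) :
    whittakerClass n ψ ℓ b ∈ gowFiltration n F R ℓ c ↔
      c ≤ padicValNat ℓ (blockUpper b : Subgroup (GL (Fin n) F)).index := by
  rw [← natCast_pow_dvd_iff (R := R) hℓ hR Subgroup.index_ne_zero_of_finite]
  constructor
  · rintro ⟨y, hy, hyW⟩
    have hψ' : ψ⁻¹ ≠ 1 := inv_ne_one.2 hψ
    obtain ⟨z, hz⟩ := (Submodule.Quotient.eq _).1 hyW
    obtain ⟨t, ht⟩ := exists_charProj_eq_smul ψ b z.2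
    have hyz : y.1 = whittaker ψ b + (ℓ : R) • z.1 := by
      have h1 := congrArg Subtype.val hz
      have h2 : ℓ • z.1 = y.1 - whittaker ψ b := h1
      rw [Nat.cast_smul_eq_nsmul, h2]
      abel
    have hr : charProj ψ⁻¹⁻¹ b y.1 =
        ((Nat.card (unitri n F) : R) + ℓ * t) • whittaker ψ⁻¹⁻¹ b := by
      rw [inv_inv, hyz, map_add, map_smul, ht, whittaker, charProj_charProj, add_smul, smul_smul]
    obtain ⟨s, hs⟩ := hy ⟨whittaker ψ⁻¹ b, whittaker_mem ψ⁻¹ b⟩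
    rw [form_comm, form_whittaker hψ' hb hr] at hs
    have hs := IsFractionRing.injective R (FractionRing R) hs
    -- Changing the lift by an element of `ℓ I` changes the scalar `|U|` only modulo `ℓ`, so it
    -- remains a unit.
    have hunit : IsUnit ((Nat.card (unitri n F) : R) + ℓ * t) := by
      have h1 : IsUnit (Nat.card (unitri n F) : R) := by
        rw [card_unitri, Nat.cast_pow]
        exact (isUnit_natCast_of_not_dvd hℓ hR hq).pow _
      by_contra h
      have h2 : (Nat.card (unitri n F) : R) + ℓ * t ∈ IsLocalRing.maximalIdeal R := h
      have h3 : (ℓ : R) * t ∈ IsLocalRing.maximalIdeal R := by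
        rw [hR]; exact Ideal.mul_mem_right _ _ (Ideal.mem_span_singleton_self _)
      exact (Ideal.add_mem_iff_left _ h3).1 h2 h1
    exact (hunit.dvd_mul_left).1 ⟨s, hs⟩
  · rintro ⟨k, hk⟩
    refine ⟨⟨whittaker ψ b, whittaker_mem ψ b⟩, fun y ↦ ?_, rfl⟩
    obtain ⟨r, hr⟩ := exists_charProj_eq_smul ψ⁻¹ b y.2
    exact ⟨r * k, by rw [form_whittaker hψ hb hr, hk, mul_left_comm]⟩

variable [IsLocalRing R] {ℓ : ℕ}

lemma exists_star_whittakerClass_mem (hℓ : ℓ.Prime)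
    (hR : IsLocalRing.maximalIdeal R = Ideal.span {(ℓ : R)}) (hq : ¬ ℓ ∣ Nat.card F)
    {ψ : AddChar F R} (hψ : ψ ≠ 1)
    {X Y : Submodule (MonoidAlgebra (ResidueRing R ℓ) (GL (Fin n) F)) (Reduction n F R ℓ)}
    (hXY : ¬ X ≤ Y) : ∃ a : Composition n, a.blocks.Pairwise (· ≤ ·) ∧
      (∀ k ∈ a.blocks, k = 1 ∨ ∃ i : ℕ, k = gowE ℓ (Nat.card F) * ℓ ^ i) ∧
      whittakerClass n ψ ℓ (blockLabel n a.blocks) ∈ X ∧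
      whittakerClass n ψ ℓ (blockLabel n a.blocks) ∉ Y := by
  have : Fact ℓ.Prime := ⟨hℓ⟩
  obtain ⟨a, ha, hs, hX, hY⟩ := exists_star_whittaker_mem
    (fun k hk ↦ isUnit_natCast_of_not_dvd hℓ hR hk) hq hψ (mt le_of_latticePreimage_le hXY)
    (latticePreimage_le_lattice X) fun r hr x hx ↦ by
      have h1 : r ∈ IsLocalRing.maximalIdeal R := hr
      rw [hR, Ideal.mem_span_singleton] at h1
      obtain ⟨s, rfl⟩ := h1
      refine ⟨Submodule.smul_of_tower_mem _ _ hx, ?_⟩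
      have h2 : (⟨((ℓ : R) * s) • x, Submodule.smul_of_tower_mem _ _ hx⟩ : lattice n F R) =
          ℓ • ⟨s • x, Submodule.smul_of_tower_mem _ _ hx⟩ :=
        Subtype.ext (by
          change ((ℓ : R) * s) • x = ℓ • (s • x)
          rw [mul_smul, Nat.cast_smul_eq_nsmul])
      rw [h2, Submodule.Quotient.mk_smul, nsmul_reduction_eq_zero]
      exact zero_mem _
  exact ⟨a, ha, hs, hX.2, fun h ↦ hY ⟨_, h⟩⟩

/-- The Gow filtration is a composition series after deletion of the repeated terms. -/
theorem exists_compositionSeries_gowFiltration (hℓ : ℓ.Prime)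
    (hR : IsLocalRing.maximalIdeal R = Ideal.span {(ℓ : R)}) (hq : ¬ ℓ ∣ Nat.card F)
    {ψ : AddChar F R} (hψ : ψ ≠ 1)
    (hN : (gowD ℓ (Nat.card F) ≤ ℓ ∧ n / gowE ℓ (Nat.card F) ≤ gowD ℓ (Nat.card F) * ℓ) ∨
      (gowD ℓ (Nat.card F) = ℓ + 1 ∧ n / gowE ℓ (Nat.card F) ≤ ℓ ^ 2) ∨
      (ℓ + 1 < gowD ℓ (Nat.card F) ∧ n / gowE ℓ (Nat.card F) < ℓ ^ 2 + ℓ)) :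
    ∃ s : CompositionSeries (Submodule (MonoidAlgebra (ResidueRing R ℓ) (GL (Fin n) F))
      (Reduction n F R ℓ)),
      s.head = ⊥ ∧ s.last = ⊤ ∧ Set.range s = Set.range (gowFiltration n F R ℓ) := by
  have : Fact ℓ.Prime := ⟨hℓ⟩
  have h1 : 1 < Nat.card F := Finite.one_lt_card
  have hmem := fun (a : Composition n) c ↦
    whittakerClass_mem_gowFiltration_iff hℓ hR hq hψ (blockLabel_mono n a.blocks) c
  have hval := fun a : Composition n ↦
    padicValNat_index_blockLabel (F := F) hq (fun x hx ↦ a.blocks_pos hx) a.blocks_sum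
  -- No index has valuation above `qFactVal ℓ q n`, so one step later no eigenvector is left and the
  -- term is zero.
  refine exists_compositionSeries_range _ (top_le_iff.1 ?_)
    (m := qFactVal ℓ (Nat.card F) n + 1) (le_bot_iff.1 ?_) fun c ↦ ?_
  · by_contra h
    obtain ⟨a, -, -, -, ha⟩ := exists_star_whittakerClass_mem hℓ hR hq hψ h
    exact ha ((hmem a 0).2 (Nat.zero_le _))
  · by_contra h
    obtain ⟨a, -, -, ha, -⟩ := exists_star_whittakerClass_mem hℓ hR hq hψ h
    rw [hmem] at ha
    have := hval a
    omega
  · have hle : gowFiltration n F R ℓ (c + 1) ≤ gowFiltration n F R ℓ c := by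
      by_contra h
      obtain ⟨a, -, -, ha, ha'⟩ := exists_star_whittakerClass_mem hℓ hR hq hψ h
      rw [hmem] at ha ha'
      omega
    rw [or_iff_not_imp_left]
    intro hne
    refine ⟨lt_of_le_of_ne hle hne, fun X hX1 hX2 ↦ ?_⟩
    -- The eigenvectors found in `X` outside `L(c + 1)` and in `L(c)` outside `X` both have index of
    -- valuation exactly `c`, so injectivity identifies them.
    obtain ⟨a, ha, hs, haX, haN⟩ := exists_star_whittakerClass_mem hℓ hR hq hψ hX1.not_ge
    obtain ⟨a', ha', hs', haX', haN'⟩ := exists_star_whittakerClass_mem hℓ hR hq hψ hX2.not_ge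
    have h2 := (hmem a c).1 (hX2.le haX)
    rw [hmem] at haN haX'
    have h3 : ¬ c + 1 ≤ _ := fun h ↦ haN' (hX1.le ((hmem a' (c + 1)).2 h))
    have h4 := hval a
    have h5 := hval a'
    have := star_list_unique h1 hq hN ha ha' hs hs' a.blocks_sum a'.blocks_sum (by omega)
    rw [this] at haX
    exact haN' haX

end Filtration

end

end GowSteinberg

/-! ### The main theorem -/

open GowSteinberg in
theorem theoremA1 (n : ℕ) (hn : 2 ≤ n) {F : Type*} [Field F] [Finite F]
    (p : ℕ) [CharP F p] (ℓ : ℕ) (hℓ : ℓ.Prime) (hℓp : ℓ ≠ p)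
    {R : Type*} [CommRing R] [IsDomain R] [IsPrincipalIdealRing R] [IsLocalRing R] [CharZero R]
    (hR : IsLocalRing.maximalIdeal R = Ideal.span {(ℓ : R)})
    (ζ : R) (hζ : IsPrimitiveRoot ζ p)
    (q e d : ℕ) (hq : q = Nat.card F) (he : e = gowE ℓ q) (hd : d = gowD ℓ q)
    (hcases : (d ≤ ℓ ∧ n / e ≤ d * ℓ) ∨ (d = ℓ + 1 ∧ n / e ≤ ℓ ^ 2) ∨
      (ℓ + 1 < d ∧ n / e < ℓ ^ 2 + ℓ)) :
    (∃ s : CompositionSeries (Submodule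
        (MonoidAlgebra (ResidueRing R ℓ) (Matrix.GeneralLinearGroup (Fin n) F))
        (Reduction n F R ℓ)),
      s.head = ⊥ ∧ s.last = ⊤ ∧ Set.range s = Set.range (gowFiltration n F R ℓ)) ∧
    Set.InjOn (fun P ↦ padicValNat ℓ P.index) (parabolicStar n F ℓ e) := by
  subst hq he hd
  have hp : p.Prime := (CharP.char_is_prime_or_zero F p).resolve_right
    (CharP.char_ne_zero_of_finite F p)
  have : Fact p.Prime := ⟨hp⟩
  have : Fact ℓ.Prime := ⟨hℓ⟩
  have hℓq : ¬ ℓ ∣ Nat.card F := fun h ↦ by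
    have := Fintype.ofFinite F
    obtain ⟨m, -, hm⟩ := FiniteField.card F p
    rw [Nat.card_eq_fintype_card, hm] at h
    exact hℓp ((Nat.prime_dvd_prime_iff_eq hℓ hp).1 (hℓ.dvd_of_dvd_pow h))
  obtain ⟨ψ, hψ⟩ := exists_addChar_ne_one (F := F) hζ
  exact ⟨exists_compositionSeries_gowFiltration hℓ hR hℓq hψ hcases,
    injOn_padicValNat_index_parabolicStar hℓq hcases⟩
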